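/- Let $n\ge 2$, $S^1=\mathbb R/2\pi\mathbb Z$, $e_{ij}$ the elementary matrices, $b=\sum_{i=1}^{n-1}e_{i+1,i}$, $J=e_{1n}\lambda+b$, $V_n=\bigoplus_{i=1}^{n-1}\mathbb R e_{in}$, $V_n^t=\bigoplus_{i=1}^{n-1}\mathbb R e_{ni}$, $\pi_0(y)=\sum_{i=1}^{n-1}y_{ni}e_{ni}$, $\langle y_1,y_2\rangle=\oint\mathrm{tr}(y_1y_2)\,dx$ and $[\partial_x+M,C]=C_x+[M,C]$. Let $\mathcal N_n^+$ be the strictly upper triangular matrices and $N_n^+$ the upper triangular matrices with $1$'s on the diagonal. Let $\mathcal M_n(S^1)$ be the set of smooth closed curves $\gamma:S^1\to\mathbb R^n$ with $\det(\gamma,\gamma_x,\dots,\gamma_x^{(n-1)})=1$, let $g=(\gamma,\gamma_x,\dots,\gamma_x^{(n-1)})$, and let $\Psi(\gamma)=u=\sum_{i=1}^{n-1}u_ie_{in}$ with $u_i=\det(\gamma,\dots,\gamma_x^{(i-2)},\gamma_x^{(n)},\gamma_x^{(i)},\dots,\gamma_x^{(n-1)})$; put $u_i=0$ for $i\le 0$.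 A smooth $X:S^1\to\mathbb R^n$ is tangent to $\mathcal M_n(S^1)$ at $\gamma$ if $\sum_{i=0}^{n-1}\det(\gamma,\dots,\gamma_x^{(i-1)},X_x^{(i)},\gamma_x^{(i+1)},\dots,\gamma_x^{(n-1)})=0$. For every $u\in C^\infty(S^1,V_n)$ the following objects exist and are unique: * the series $Y(u,\lambda)=e_{1n}\lambda+\sum_{i\le 0}Y_{1,i}(u)\lambda^i$ with coefficients in $C^\infty(S^1,sl(n,\mathbb R))$ such that $[\partial_x+J+u,Y]=0$ and $Y^n=\lambda I_n$; * for $j\ge1$, $j\not\equiv0\ (\mathrm{mod}\ n)$, with $Y_{j,0}(u)$ the $\lambda^0$-coefficient of $Y(u,\lambda)^j$, the $\zeta_j(u)\in C^\infty(S^1,\mathcal N_n^+)$ such that $Z_{j,0}(u):=Y_{j,0}(u)-\zeta_j(u)$ satisfies $[\partial_x+b+u,Z_{j,0}(u)]\in C^\infty(S^1,V_n)$; * for $v\in C^\infty(S^1,V_n^t)$, the $P_u(v)=C\in C^\infty(S^1,sl(n,\mathbb R))$ with $\pi_0(C)=v$ and $[\partial_x+b+u,C]\in C^\infty(S^1,V_n)$;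 * the $T=\sum_{i\ge0}T_i\lambda^{-i}$ with $T_0\in C^\infty(S^1,N_n^+)$ and first column $(1,0,\dots,0)^t$, and $f_i(u)\in C^\infty(S^1,\mathbb R)$, with $T(\partial_x+J+u)T^{-1}=\partial_x+J+\sum_{i\ge0}f_i(u)J^{-i}$. Put $H_j(u)=n\oint f_j(u)\,dx$. The gradient $\nabla F(u)\in C^\infty(S^1,V_n^t)$ of a functional $F$ on $C^\infty(S^1,V_n)$ is defined by $dF_u(v)=\langle\nabla F(u),v\rangle$ (differentials being taken along smooth families). For functionals having a gradient at every point, the two Drinfeld–Sokolov Poisson structures on $C^\infty(S^1,V_n)$ are $$\{F_1,F_2\}_1(u)=\langle[e_{1n},P_u(\nabla F_1(u))],P_u(\nabla F_2(u))\rangle,$$ $$\{F_1,F_2\}_2(u)=\langle[\partial_x+b+u,P_u(\nabla F_1(u))],P_u(\nabla F_2(u))\rangle,$$ and their pull-backs to $\mathcal M_n(S^1)$ are $\{F_1\circ\Psi,F_2\circ\Psi\}_i^\wedge=\{F_1,F_2\}_i\circ\Psi$. An evolution equation $\gamma_t=X(\gamma)$ on $\mathcal M_n(S^1)$ is called a Hamiltonian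 equation for $\hat H=H\circ\Psi$ with respect to $\{\,,\}_i^\wedge$ if $H$ has a gradient at every point, $X(\gamma)$ is tangent to $\mathcal M_n(S^1)$ at every $\gamma$, and $d(F\circ\Psi)_\gamma(X(\gamma))=\{\hat H,F\circ\Psi\}_i^\wedge(\gamma)$ for all $\gamma$ and all $F$. Then, for $j\ge1$ with $j\not\equiv0\ (\mathrm{mod}\ n)$, and $\hat H_j=H_j\circ\Psi$, the $j$-th central affine curve flow $$\gamma_t=g\,Z_{j,0}(u)\,e_1,\qquad u=\Psi(\gamma),\quad e_1=(1,0,\dots,0)^t,$$ is a Hamiltonian equation for $\hat H_j$ with respect to $\{\,,\}_2^\wedge$, and for $-\hat H_{n+j}$ with respect to $\{\,,\}_1^\wedge$. In particular, with respect to $\{\,,\}_2^\wedge$: for $n\ge3$, $$\gamma_t=-\tfrac2n u_{n-1}\gamma+\gamma_{xx}$$ is a Hamiltonian equation for $\gamma\mapsto\oint u_{n-2}\,dx$; and for $n\ne3$, $$\gamma_t=\Big(-\tfrac3n u_{n-2}+\tfrac{3(n-3)}{2n}(u_{n-1})_x\Big)\gamma-\tfrac3n u_{n-1}\gamma_x+\gamma_{xxx}$$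 is a Hamiltonian equation for $\gamma\mapsto\oint\big(u_{n-3}+\tfrac{n-3}{2n}u_{n-1}^2\big)dx$. -/

import Mathlib

open scoped ContDiff

namespace CentralAffine

noncomputable section

/-! ### Smooth functions on the circle `S¹ = ℝ / 2πℤ` -/

/-- `C^∞(S¹, ℝ)`: the smooth `2π`-periodic functions on the line. -/
def loopSubalgebra : Subalgebra ℝ (ℝ → ℝ) where
  carrier := {f | ContDiff ℝ ∞ f ∧ Function.Periodic f (2 * Real.pi)}
  mul_mem' := fun ha hb => ⟨ha.1.mul hb.1, ha.2.mul hb.2⟩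
  add_mem' := fun ha hb => ⟨ha.1.add hb.1, ha.2.add hb.2⟩
  algebraMap_mem' := fun _ => ⟨contDiff_const, fun _ => rfl⟩

/-- The ring `C^∞(S¹, ℝ)`. -/
abbrev Loop : Type := loopSubalgebra

theorem deriv_mem_loop (f : Loop) : deriv f.1 ∈ loopSubalgebra := by
  refine ⟨(contDiff_infty_iff_deriv.1 f.2.1).2, fun x => ?_⟩
  rw [← deriv_comp_add_const]
  exact congrArg (fun h => deriv h x) (funext f.2.2)

/-- The derivative `f ↦ f_x` on `C^∞(S¹, ℝ)`. -/
def dx : Loop →ₗ[ℝ] Loop where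
  toFun f := ⟨deriv f.1, deriv_mem_loop f⟩
  map_add' f g := Subtype.ext <| funext fun x =>
    deriv_add ((f.2.1.differentiable (by simp)) x) ((g.2.1.differentiable (by simp)) x)
  map_smul' c f := Subtype.ext <| funext fun x =>
    deriv_const_smul c ((f.2.1.differentiable (by simp)) x)

/-- `∮ f dx`, the integral over one period. -/
def oint (f : Loop) : ℝ := ∫ x in (0 : ℝ)..(2 * Real.pi), f.1 x

/-- Smooth loops of `n × n` real matrices. -/
abbrev MLoop (n : ℕ) : Type := Matrix (Fin n) (Fin n) Loop

/-- Entrywise derivative of a loop of matrices. -/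
def mdx (n : ℕ) : MLoop n →ₗ[ℝ] MLoop n := dx.mapMatrix

/-- The bilinear form `⟨y₁, y₂⟩ = ∮ tr (y₁ y₂) dx`. -/
def pairing {n : ℕ} (y₁ y₂ : MLoop n) : ℝ := oint (y₁ * y₂).trace

/-! ### Constant matrices and matrix subspaces (indices `0, …, n - 1` in place of `1, …, n`) -/

/-- `b = ∑ e_{i+1,i}`. -/
def bMat (n : ℕ) : MLoop n := fun i j => if (i : ℕ) = j + 1 then 1 else 0

/-- `e_{1n}`. -/
def e1n (n : ℕ) : MLoop n := fun i j => if (i : ℕ) = 0 ∧ (j : ℕ) + 1 = n then 1 else 0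

/-- `C^∞(S¹, V_n)`, `V_n = ⊕_{i=1}^{n-1} ℝ e_{in}`. -/
def VLoop (n : ℕ) : Submodule ℝ (MLoop n) where
  carrier := {u | ∀ i j : Fin n, ¬ ((i : ℕ) + 1 < n ∧ (j : ℕ) + 1 = n) → u i j = 0}
  add_mem' := fun ha hb i j h => by simp [ha i j h, hb i j h]
  zero_mem' := fun _ _ _ => rfl
  smul_mem' := fun c a ha i j h => by simp [ha i j h]

/-- `C^∞(S¹, V_n^t)`, `V_n^t = ⊕_{i=1}^{n-1} ℝ e_{ni}`. -/
def VtLoop (n : ℕ) : Submodule ℝ (MLoop n) where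
  carrier := {v | ∀ i j : Fin n, ¬ ((i : ℕ) + 1 = n ∧ (j : ℕ) + 1 < n) → v i j = 0}
  add_mem' := fun ha hb i j h => by simp [ha i j h, hb i j h]
  zero_mem' := fun _ _ _ => rfl
  smul_mem' := fun c a ha i j h => by simp [ha i j h]

/-- `C ∈ C^∞(S¹, 𝒩_n^+)`: strictly upper triangular. -/
def IsStrictUpper {n : ℕ} (C : MLoop n) : Prop := ∀ i j : Fin n, j ≤ i → C i j = 0

/-- `C ∈ C^∞(S¹, N_n^+)`: upper triangular with ones on the diagonal. -/
def IsUnipotentUpper {n : ℕ} (C : MLoop n) : Prop :=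
  (∀ i, C i i = 1) ∧ ∀ i j : Fin n, j < i → C i j = 0

/-- `[∂_x + M, C] = C_x + M C - C M`. -/
def covD {n : ℕ} (M C : MLoop n) : MLoop n := mdx n C + (M * C - C * M)

/-- The component `u_k` of `u = ∑_{k=1}^{n-1} u_k e_{kn}`; by convention `u_k = 0` for `k ≤ 0`. -/
def comp {n : ℕ} (u : VLoop n) (k : ℤ) : Loop :=
  ∑ i : Fin n, ∑ j : Fin n, if (i : ℤ) + 1 = k ∧ (j : ℕ) + 1 = n then u.1 i j else 0

/-! ### Formal Laurent series in `λ⁻¹` -/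

/-- Series `∑_{i ≤ i₀} ξ_i λ^i` with coefficients in the loops of matrices. The Hahn series
variable is `λ⁻¹`, so the coefficient of `λ^i` is `coeff (-i)`. -/
abbrev LSer (n : ℕ) : Type := HahnSeries ℤ (MLoop n)

/-- The coefficient of `λ^i`. -/
def lamCoeff {n : ℕ} (Y : LSer n) (i : ℤ) : MLoop n := Y.coeff (-i)

/-- `M λ^i` for a loop of matrices `M`. -/
def lamMono {n : ℕ} (i : ℤ) (M : MLoop n) : LSer n := HahnSeries.single (-i) M

/-- Coefficientwise `x`-derivative. -/
def sdx {n : ℕ} (Y : LSer n) : LSer n := Y.map (mdx n)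

/-- `J = e_{1n} λ + b`. -/
def JSer (n : ℕ) : LSer n := lamMono 1 (e1n n) + lamMono 0 (bMat n)

/-- `J⁻¹ = bᵗ + e_{n1} λ⁻¹`. -/
def JInv (n : ℕ) : LSer n := lamMono 0 (bMat n).transpose + lamMono (-1) (e1n n).transpose

/-- `∑_{i ≥ 0} f_i J^{-i}`. The coefficient of `λ^{-m}` in `J^{-i}` vanishes for `i ≥ n (m + 1)`,
so each coefficient of the series is a finite sum. -/
def JTail (n : ℕ) (f : ℕ → Loop) : LSer n :=
  HahnSeries.ofPowerSeries ℤ (MLoop n) (PowerSeries.mk fun m =>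
    ∑ i ∈ Finset.range (n * (m + 1)), f i • lamCoeff (JInv n ^ i) (-(m : ℤ)))

/-! ### The series `Y(u, λ)`, the matrix `Z_{j,0}(u)` and the operator `P_u` -/

/-- `Y` is a series in `λ⁻¹` of the form `e_{1n} λ + O(1)` with coefficients in `sl(n, ℝ)`,
`[∂_x + J + u, Y] = 0` and `Y^n = λ I`. -/
def IsResolvent {n : ℕ} (u : VLoop n) (Y : LSer n) : Prop :=
  (∀ i, (lamCoeff Y i).trace = 0) ∧ (∀ i, 1 < i → lamCoeff Y i = 0) ∧ lamCoeff Y 1 = e1n n ∧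
  sdx Y + ((JSer n + lamMono 0 u.1) * Y - Y * (JSer n + lamMono 0 u.1)) = 0 ∧
  Y ^ n = lamMono 1 1

open Classical in
/-- The solution `Y(u, λ)`. -/
def resolvent {n : ℕ} (u : VLoop n) : LSer n :=
  if h : ∃ Y, IsResolvent u Y then h.choose else 0

/-- `Y_{j,0}(u)`: the coefficient of `λ^0` in `Y(u, λ)^j`. -/
def Y0 {n : ℕ} (j : ℕ) (u : VLoop n) : MLoop n := lamCoeff (resolvent u ^ j) 0

/-- `ζ` is strictly upper triangular and `[∂_x + b + u, Y_{j,0}(u) - ζ] ∈ V_n`. -/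
def IsZeta {n : ℕ} (j : ℕ) (u : VLoop n) (ζ : MLoop n) : Prop :=
  IsStrictUpper ζ ∧ covD (bMat n + u.1) (Y0 j u - ζ) ∈ VLoop n

open Classical in
/-- The matrix `ζ_j(u)`. -/
def zeta {n : ℕ} (j : ℕ) (u : VLoop n) : MLoop n :=
  if h : ∃ ζ, IsZeta j u ζ then h.choose else 0

/-- `Z_{j,0}(u) = Y_{j,0}(u) - ζ_j(u)`. -/
def Z0 {n : ℕ} (j : ℕ) (u : VLoop n) : MLoop n := Y0 j u - zeta j u

/-- `C = P_u(v)`: `C` is `sl(n, ℝ)`-valued, `π₀(C) = v` and `[∂_x + b + u, C] ∈ V_n`. -/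
def IsP {n : ℕ} (u : VLoop n) (v : VtLoop n) (C : MLoop n) : Prop :=
  C.trace = 0 ∧ (∀ i j : Fin n, (i : ℕ) + 1 = n → (j : ℕ) + 1 < n → C i j = v.1 i j) ∧
  covD (bMat n + u.1) C ∈ VLoop n

open Classical in
/-- The operator `P_u`. -/
def Pop {n : ℕ} (u : VLoop n) (v : VtLoop n) : MLoop n :=
  if h : ∃ C, IsP u v C then h.choose else 0

/-! ### The functionals `H_j` -/

/-- `T = ∑_{i ≥ 0} T_i λ^{-i}` with `T_0 ∈ C^∞(S¹, N_n^+)`, first column `e_1`, and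
`T (∂_x + J + u) T⁻¹ = ∂_x + J + ∑ f_i J^{-i}`. Such a `T` is invertible, and the last equation is
written as `T (J + u) - T_x = (J + ∑ f_i J^{-i}) T`. -/
def IsDressing {n : ℕ} (u : VLoop n) (T : LSer n) (f : ℕ → Loop) : Prop :=
  (∀ i, 0 < i → lamCoeff T i = 0) ∧ IsUnipotentUpper (lamCoeff T 0) ∧
  (∀ (i : ℤ) (k l : Fin n), (l : ℕ) = 0 →
    lamCoeff T i k l = if i = 0 ∧ k = l then 1 else 0) ∧
  T * (JSer n + lamMono 0 u.1) - sdx T = (JSer n + JTail n f) * T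

open Classical in
/-- The coefficients `f_i(u)`. -/
def fCoeff {n : ℕ} (u : VLoop n) : ℕ → Loop :=
  if h : ∃ p : LSer n × (ℕ → Loop), IsDressing u p.1 p.2 then h.choose.2 else 0

/-- `H_j(u) = n ∮ f_j(u) dx`. -/
def Hfun (n j : ℕ) (u : VLoop n) : ℝ := n * oint (fCoeff u j)

/-! ### Differentials, gradients, Poisson brackets on `C^∞(S¹, V_n)` -/

/-- A family of loops `s ↦ U s`, smooth in `(s, x)`. -/
def SmoothFamily (U : ℝ → Loop) : Prop := ContDiff ℝ ∞ fun p : ℝ × ℝ => (U p.1).1 p.2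

/-- `v` is the derivative of `s ↦ U s` at `s = 0`. -/
def HasVelocity (U : ℝ → Loop) (v : Loop) : Prop :=
  ∀ x : ℝ, HasDerivAt (fun s => (U s).1 x) (v.1 x) 0

/-- `ξ = ∇F(u)`: along every smooth family in `C^∞(S¹, V_n)` through `u` with velocity `v`, the
functional `F` has derivative `dF_u(v) = ⟨ξ, v⟩`. -/
def HasGrad {n : ℕ} (F : VLoop n → ℝ) (u : VLoop n) (ξ : VtLoop n) : Prop :=
  ∀ (U : ℝ → VLoop n) (v : VLoop n), (∀ i j, SmoothFamily fun s => (U s).1 i j) → U 0 = u →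
    (∀ i j, HasVelocity (fun s => (U s).1 i j) (v.1 i j)) →
    HasDerivAt (fun s => F (U s)) (pairing ξ.1 v.1) 0

/-- The functional `F` has a gradient at every point. -/
def IsSmoothFunctional {n : ℕ} (F : VLoop n → ℝ) : Prop := ∀ u, ∃ ξ, HasGrad F u ξ

open Classical in
/-- The gradient `∇F(u)`. -/
def grad {n : ℕ} (F : VLoop n → ℝ) (u : VLoop n) : VtLoop n :=
  if h : ∃ ξ, HasGrad F u ξ then h.choose else 0

/-- `{F₁, F₂}_1(u) = ⟨[e_{1n}, P_u(∇F₁(u))], P_u(∇F₂(u))⟩`. -/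
def bracket1 {n : ℕ} (F₁ F₂ : VLoop n → ℝ) (u : VLoop n) : ℝ :=
  pairing (e1n n * Pop u (grad F₁ u) - Pop u (grad F₁ u) * e1n n) (Pop u (grad F₂ u))

/-- `{F₁, F₂}_2(u) = ⟨[∂_x + b + u, P_u(∇F₁(u))], P_u(∇F₂(u))⟩`. -/
def bracket2 {n : ℕ} (F₁ F₂ : VLoop n → ℝ) (u : VLoop n) : ℝ :=
  pairing (covD (bMat n + u.1) (Pop u (grad F₁ u))) (Pop u (grad F₂ u))

/-! ### Central affine curves -/

/-- The matrix `(γ, γ_x, …, γ_x^{(n-1)})`. -/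
def frame {n : ℕ} (γ : Fin n → Loop) : MLoop n := fun i j => dx^[(j : ℕ)] (γ i)

/-- `ℳ_n(S¹)`: smooth closed curves with `det (γ, γ_x, …, γ_x^{(n-1)}) = 1`. -/
def Curves (n : ℕ) : Type := {γ : Fin n → Loop // (frame γ).det = 1}

/-- The `x`-derivative `γ_x^{(k)}`. -/
def dcurve {n : ℕ} (k : ℕ) (γ : Fin n → Loop) : Fin n → Loop := fun i => dx^[k] (γ i)

/-- The central affine curvature map `Ψ(γ) = ∑_{i=1}^{n-1} u_i e_{in}`, where `u_i` is the
determinant of the moving frame with its `i`-th column `γ_x^{(i-1)}` replaced by `γ_x^{(n)}`. -/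
def Psi {n : ℕ} (γ : Curves n) : VLoop n :=
  ⟨fun i j => if (i : ℕ) + 1 < n ∧ (j : ℕ) + 1 = n then
      ((frame γ.1).updateCol i (dcurve n γ.1)).det else 0,
    fun _ _ h => if_neg h⟩

/-- `X` is tangent to `ℳ_n(S¹)` at `γ`:
`∑_i det (γ, …, γ_x^{(i-1)}, X_x^{(i)}, γ_x^{(i+1)}, …, γ_x^{(n-1)}) = 0`. -/
def IsTangent {n : ℕ} (γ : Curves n) (X : Fin n → Loop) : Prop :=
  ∑ i : Fin n, ((frame γ.1).updateCol i (dcurve i X)).det = 0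

/-- `c` is a smooth path in `ℳ_n(S¹)` with `c(0) = γ` and `c'(0) = X`. -/
def IsPath {n : ℕ} (γ : Curves n) (X : Fin n → Loop) (c : ℝ → Curves n) : Prop :=
  (∀ i, SmoothFamily fun s => (c s).1 i) ∧ c 0 = γ ∧ ∀ i, HasVelocity (fun s => (c s).1 i) (X i)

/-- The differential of `G` at `γ` takes the value `r` on the tangent vector `X`: there are smooth
paths in `ℳ_n(S¹)` through `γ` with velocity `X`, and along all of them `G` has derivative `r`. -/
def HasDiff {n : ℕ} (G : Curves n → ℝ) (γ : Curves n) (X : Fin n → Loop) (r : ℝ) : Prop :=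
  (∃ c, IsPath γ X c) ∧ ∀ c, IsPath γ X c → HasDerivAt (fun s => G (c s)) r 0

/-- The pull-back of a bracket on `C^∞(S¹, V_n)` to `ℳ_n(S¹)`:
`{F₁ ∘ Ψ, F₂ ∘ Ψ}^∧ = {F₁, F₂} ∘ Ψ`. -/
def pullback {n : ℕ} (B : (VLoop n → ℝ) → (VLoop n → ℝ) → VLoop n → ℝ)
    (F₁ F₂ : VLoop n → ℝ) (γ : Curves n) : ℝ := B F₁ F₂ (Psi γ)

/-- The evolution equation `γ_t = X(γ)` on `ℳ_n(S¹)` is a Hamiltonian equation for `H ∘ Ψ` with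
respect to the pull-back `{ , }^∧` of the bracket `B`: `X` is a tangent vector field, and
`d(F ∘ Ψ)(X) = {H ∘ Ψ, F ∘ Ψ}^∧` for all functionals `F` on `C^∞(S¹, V_n)`. -/
def IsHamiltonianFlow {n : ℕ} (B : (VLoop n → ℝ) → (VLoop n → ℝ) → VLoop n → ℝ)
    (H : VLoop n → ℝ) (X : Curves n → Fin n → Loop) : Prop :=
  IsSmoothFunctional H ∧ ∀ γ, IsTangent γ (X γ) ∧
    ∀ F : VLoop n → ℝ, IsSmoothFunctional F → HasDiff (F ∘ Psi) γ (X γ) (pullback B H F γ)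

/-- The right-hand side `g Z_{j,0}(u) e_1` of the `j`-th central affine curve flow. -/
def curveFlow (n j : ℕ) (γ : Curves n) : Fin n → Loop :=
  (frame γ.1 * Z0 j (Psi γ)).mulVec fun k => if (k : ℕ) = 0 then 1 else 0

/-- `-(2/n) u_{n-1} γ + γ_xx`. -/
def flowTwo (n : ℕ) (γ : Curves n) : Fin n → Loop := fun i =>
  (-(2 / n : ℝ)) • (comp (Psi γ) (n - 1) * γ.1 i) + dx^[2] (γ.1 i)

/-- `(-(3/n) u_{n-2} + (3(n-3)/(2n)) (u_{n-1})_x) γ - (3/n) u_{n-1} γ_x + γ_xxx`. -/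
def flowThree (n : ℕ) (γ : Curves n) : Fin n → Loop := fun i =>
  ((-(3 / n : ℝ)) • comp (Psi γ) (n - 2) +
      (3 * (n - 3) / (2 * n) : ℝ) • dx (comp (Psi γ) (n - 1))) * γ.1 i -
    (3 / n : ℝ) • (comp (Psi γ) (n - 1) * dx (γ.1 i)) + dx^[3] (γ.1 i)

/-- `u ↦ ∮ u_{n-2} dx`. -/
def ham2 (n : ℕ) (u : VLoop n) : ℝ := oint (comp u (n - 2))

/-- `u ↦ ∮ (u_{n-3} + ((n-3)/(2n)) u_{n-1}²) dx`. -/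
def ham3 (n : ℕ) (u : VLoop n) : ℝ :=
  oint (comp u (n - 3) + ((n - 3) / (2 * n) : ℝ) • comp u (n - 1) ^ 2)

end

end CentralAffine

open scoped ContDiff
set_option linter.unusedSectionVars false

namespace CentralAffine

noncomputable section

/-! Identify a Laurent series in `λ⁻¹` of `n × n` matrices with an infinite matrix indexed by `ℤ ×
ℤ`, invariant under `(p, q) ↦ (p + n, q + n)`. Then `J` is the shift `p = q + 1`, `J ^ n = λ`, the
series `∑ f_i J^{-i}` are constant along diagonals, and the diagonals `q - p = d` give a grading in
which every equation is solved one diagonal at a time. All of this is done over an arbitrary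
commutative `ℝ`-algebra with a derivation, so that it applies both to loops and to smooth families
of loops.

Dressing (`exists_isDress`, `IsDress.unique`). On the `d`-th diagonal the equation for `T` is a
difference equation `a (p) - a (p - 1) = h (p) + f_d` on `ℤ / n` for the next diagonal of `T`. It is
solvable exactly when the right-hand side sums to zero over a period, which determines `f_d`; the
free constant is fixed by the first column. With `S = T⁻¹`, the series `S J T` is the resolvent.
Conversely, if `Y` is a resolvent, `T Y S` commutes with `∂ + J + ∑ f_i J^{-i}`, hence is constant
along diagonals, and `(T Y S) ^ n = J ^ n` with the right leading coefficient forces it to be `J`.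

Gradient (`variation`, `hasGrad_Hfun`). Differentiating the dressing equation along a second
derivation `E` commuting with `D` and taking the trace against `S J ^ j` gives `n E f_j = tr (E u ·
Y_{j,0})` up to a total `x`-derivative. Hence `∇H_j (u) = π₀ (Y_{j,0} (u))`.

Matrices `C` with `[∂ + b + u, C] ∈ V_n`. With `B = b + u`, such a `C` has columns `c, (∂ + B) c, (∂
+ B)² c, …`, so its first column determines it; the trace and the last row depend on `c` in a
triangular way, which gives `P_u`. The matrix generated by the first column of `Y_{j,0}` differs
from `Y_{j,0}` by a strictly upper triangular `ζ_j`, because `[∂ + b + u, Y_{j,0}] = -[e_{1n},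
Y_{n+j,0}]` lives in the first row and the last column. Therefore `Z_{j,0} = P_u (∇H_j (u))`
(`isP_Z0`).

Curves. The frame satisfies `g_x = g (b + u)`, so a velocity `g Z e_1` with `[∂ + b + u, Z] ∈ V_n`
has frame `g Z`; then `g_t = g Z`, and equality of mixed derivatives gives `u_t = [∂ + b + u, Z]`.
Tangency is `tr Z = 0` (`flow_of_firstColumn`). Since elements of `V_n` pair only with last rows,
`dF (u_t) = ⟨[∂ + b + u, Z], P_u (∇F)⟩`, which for `Z = P_u (∇H)` is the second bracket. For the
first bracket, `ζ_{n+j}` commutes with `e_{1n}`, so `-[e_{1n}, Z_{n+j,0}] = [∂ + b + u, Y_{j,0}]`,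
and the part of it coming from `ζ_j` pairs to zero after an integration by parts (`bracket1_Hfun`).

For the two explicit flows, the first column is read off from the equation, and it remains to
compute the trace and the last row of the matrix it generates. -/

/-! ### Laurent series of matrices as periodic infinite matrices -/

/-- Laurent series (in `λ⁻¹`) with coefficients in the `n × n` matrices over `R`. -/
abbrev Ser (R : Type*) [CommRing R] (n : ℕ) : Type _ := HahnSeries ℤ (Matrix (Fin n) (Fin n) R)

/-- The residue of an integer modulo `n`. -/
def res (n : ℕ) [NeZero n] (p : ℤ) : Fin n :=
  ⟨(p % n).toNat, by
    have h := Int.emod_lt_of_pos p (b := n) (by exact_mod_cast Nat.pos_of_neZero n)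
    have h' := Int.emod_nonneg p (b := n) (by exact_mod_cast NeZero.ne n)
    omega⟩

section Entries

variable {R : Type*} [CommRing R] {n : ℕ} [NeZero n]

theorem res_coe (p : ℤ) : ((res n p : ℕ) : ℤ) = p % n := by
  have h' := Int.emod_nonneg p (b := n) (by exact_mod_cast NeZero.ne n)
  simp only [res]
  omega

theorem res_add_mul (r : Fin n) (m : ℤ) : res n ((r : ℕ) + n * m) = r := by
  apply Fin.ext
  have h := res_coe (n := n) ((r : ℕ) + n * m)
  rw [Int.add_mul_emod_self_left, Int.emod_eq_of_lt (by omega) (by exact_mod_cast r.2)] at h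
  exact_mod_cast h

theorem add_mul_ediv (r : Fin n) (m : ℤ) : (((r : ℕ) : ℤ) + n * m) / n = m := by
  rw [Int.add_mul_ediv_left _ _ (by exact_mod_cast NeZero.ne n),
    Int.ediv_eq_zero_of_lt (by omega) (by exact_mod_cast r.2), zero_add]

theorem res_add_ediv (p : ℤ) : ((res n p : ℕ) : ℤ) + n * (p / n) = p := by
  rw [res_coe]; exact Int.emod_add_mul_ediv p n

theorem res_shift (p k : ℤ) : res n (p + n * k) = res n p := by
  apply Fin.ext
  have h := res_coe (n := n) (p + n * k)
  rw [Int.add_mul_emod_self_left, ← res_coe] at h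
  exact_mod_cast h

/-- Euclidean division by `n`, as an equivalence. -/
def divRes (n : ℕ) [NeZero n] : ℤ ≃ ℤ × Fin n where
  toFun p := (p / n, res n p)
  invFun x := ((x.2 : ℕ) : ℤ) + n * x.1
  left_inv p := res_add_ediv p
  right_inv _ := Prod.ext (add_mul_ediv _ _) (res_add_mul _ _)

/-- The entry `(p, q)` of the periodic infinite matrix attached to a series. -/
def ent (Y : Ser R n) (p q : ℤ) : R := Y.coeff (q / n - p / n) (res n p) (res n q)

theorem coeff_eq_ent (Y : Ser R n) (m : ℤ) (r c : Fin n) :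
    Y.coeff m r c = ent Y (r : ℕ) ((c : ℕ) + n * m) := by
  have h := add_mul_ediv r 0
  have h2 := res_add_mul r 0
  rw [mul_zero, add_zero] at h h2
  rw [ent, add_mul_ediv, res_add_mul, h, h2, sub_zero]

theorem ent_shift (Y : Ser R n) (p q k : ℤ) : ent Y (p + n * k) (q + n * k) = ent Y p q := by
  have hn : (n : ℤ) ≠ 0 := by exact_mod_cast NeZero.ne n
  rw [ent, ent, res_shift, res_shift, Int.add_mul_ediv_left _ _ hn, Int.add_mul_ediv_left _ _ hn,
    add_sub_add_right_eq_sub]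

theorem ser_ext {X Y : Ser R n} (h : ∀ p q, ent X p q = ent Y p q) : X = Y := by
  ext m r c
  rw [coeff_eq_ent, coeff_eq_ent, h]

/-- All diagonals of the infinite matrix below the `d`-th one vanish. -/
def OrdGE (Y : Ser R n) (d : ℤ) : Prop := ∀ p q, q < p + d → ent Y p q = 0

theorem exists_ordGE (Y : Ser R n) : ∃ d, OrdGE Y d := by
  have hn : (0 : ℤ) < n := by exact_mod_cast Nat.pos_of_neZero n
  -- Within the block of index `m = q / n - p / n` the difference `q - p` is within `n - 1` of `n
  -- m`, so an entry this far below the diagonal lies in a block of index less than the order.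
  refine ⟨n * Y.order - n, fun p q h => ?_⟩
  rw [ent, HahnSeries.coeff_eq_zero_of_lt_order]
  · rfl
  have h1 := Int.emod_add_mul_ediv p n
  have h2 := Int.emod_add_mul_ediv q n
  have h3 := Int.emod_lt_of_pos p hn
  have h4 := Int.emod_nonneg q hn.ne'
  have h5 : (n : ℤ) * (q / n - p / n) < n * Y.order := by
    rw [mul_sub]; omega
  exact lt_of_mul_lt_mul_left h5 hn.le

theorem OrdGE.mono {Y : Ser R n} {d e : ℤ} (h : OrdGE Y d) (hed : e ≤ d) : OrdGE Y e :=
  fun p q hpq => h p q (by omega)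

theorem coeff_mul_eq_sum (X Y : Ser R n) (m : ℤ) :
    ∃ S : Finset ℤ, (∀ i, i ∉ S → X.coeff i = 0 ∨ Y.coeff (m - i) = 0) ∧
      (X * Y).coeff m = ∑ i ∈ S, X.coeff i * Y.coeff (m - i) := by
  classical
  refine ⟨(Finset.antidiagonal X.isPWO_support Y.isPWO_support m).image Prod.fst,
    fun i hi => ?_, ?_⟩
  · by_contra! h
    refine hi (Finset.mem_image.2 ⟨(i, m - i), ?_, rfl⟩)
    simpa [Finset.mem_antidiagonal] using h
  · rw [HahnSeries.coeff_mul, Finset.sum_image]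
    · refine Finset.sum_congr rfl fun x hx => ?_
      rw [Finset.mem_antidiagonal] at hx
      rw [← hx.2.2, add_sub_cancel_left]
    · intro x hx y hy h
      rw [Finset.mem_coe, Finset.mem_antidiagonal] at hx hy
      exact Prod.ext h (by have := hx.2.2; have := hy.2.2; omega)

/-- Writing an integer as `l = r + n i` merges the convolution over the blocks `i` with the matrix
product over `r` into one matrix product over `ℤ`. -/
theorem ent_mul_finsum (X Y : Ser R n) (p q : ℤ) :
    ent (X * Y) p q = ∑ᶠ l, ent X p l * ent Y l q := by
  obtain ⟨S, hS, h⟩ := coeff_mul_eq_sum X Y (q / n - p / n)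
  let g : ℤ × Fin n → R := fun x =>
    X.coeff (x.1 - p / n) (res n p) x.2 * Y.coeff (q / n - x.1) x.2 (res n q)
  have e1 : ∀ l, ent X p l * ent Y l q = g (divRes n l) := fun l => rfl
  simp only [e1]
  rw [finsum_comp_equiv (divRes n) (f := g), ent, h, Matrix.sum_apply]
  let S' := (S.map (addRightEmbedding (p / n))) ×ˢ (Finset.univ : Finset (Fin n))
  rw [finsum_eq_sum_of_support_subset (s := S') g, Finset.sum_product, Finset.sum_map]
  · refine Finset.sum_congr rfl fun i _ => ?_
    rw [Matrix.mul_apply]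
    refine Finset.sum_congr rfl fun l _ => ?_
    simp only [g, addRightEmbedding_apply, add_sub_cancel_right]
    rw [show q / (n : ℤ) - p / n - i = q / n - (i + p / n) by ring]
  · intro x hx
    by_contra hx'
    refine hx ?_
    have : x.1 - p / n ∉ S := fun h => hx' (by
      simp only [S', Finset.coe_product, Finset.coe_map, Finset.coe_univ, Set.mem_prod,
        Set.mem_image, Set.mem_univ, and_true]
      exact ⟨_, h, by simp⟩)
    rcases hS _ this with h0 | h0
    · simp [g, h0]
    · have : q / (n : ℤ) - p / n - (x.1 - p / n) = q / n - x.1 := by ring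
      rw [this] at h0
      simp [g, h0]

theorem ent_mul {X Y : Ser R n} {d e : ℤ} (hX : OrdGE X d) (hY : OrdGE Y e) (p q : ℤ) :
    ent (X * Y) p q = ∑ l ∈ Finset.Icc (p + d) (q - e), ent X p l * ent Y l q := by
  rw [ent_mul_finsum]
  refine finsum_eq_sum_of_support_subset _ fun l hl => ?_
  rw [Finset.coe_Icc, Set.mem_Icc]
  by_contra h
  refine hl ?_
  rcases not_and_or.1 h with h | h
  · simp only [hX p l (by omega), zero_mul]
  · simp only [hY l q (by omega), mul_zero]

theorem OrdGE.mul {X Y : Ser R n} {d e : ℤ} (hX : OrdGE X d) (hY : OrdGE Y e) :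
    OrdGE (X * Y) (d + e) := fun p q h => by
  rw [ent_mul hX hY, Finset.Icc_eq_empty (by omega), Finset.sum_empty]

theorem ent_mul_lead {X Y : Ser R n} {d e : ℤ} (hX : OrdGE X d) (hY : OrdGE Y e) (p : ℤ) :
    ent (X * Y) p (p + d + e) = ent X p (p + d) * ent Y (p + d) (p + d + e) := by
  rw [ent_mul hX hY, add_sub_cancel_right, Finset.Icc_self, Finset.sum_singleton]

theorem ent_add (X Y : Ser R n) (p q : ℤ) : ent (X + Y) p q = ent X p q + ent Y p q := rfl

theorem ent_sub (X Y : Ser R n) (p q : ℤ) : ent (X - Y) p q = ent X p q - ent Y p q := by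
  simp [ent]

theorem ent_zero (p q : ℤ) : ent (0 : Ser R n) p q = 0 := rfl

theorem ent_single_zero (M : Matrix (Fin n) (Fin n) R) (p q : ℤ) :
    ent (HahnSeries.single 0 M : Ser R n) p q =
      if q / n = p / n then M (res n p) (res n q) else 0 := by
  rw [ent, HahnSeries.coeff_single]
  by_cases h : q / (n : ℤ) = p / n
  · rw [if_pos (by omega), if_pos h]
  · rw [if_neg (by omega), if_neg h]; rfl

theorem ent_one (p q : ℤ) : ent (1 : Ser R n) p q = if p = q then 1 else 0 := by
  change ent (HahnSeries.single 0 (1 : Matrix (Fin n) (Fin n) R) : Ser R n) p q = _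
  rw [ent_single_zero]
  by_cases h : p = q
  · subst h; simp
  · rw [if_neg h]
    split_ifs with h1
    · refine Matrix.one_apply_ne fun h2 => h ?_
      rw [← res_add_ediv (n := n) p, ← res_add_ediv (n := n) q, h1, h2]
    · rfl

/-- The series with prescribed entries. -/
def ofEnt (n : ℕ) [NeZero n] (f : ℤ → ℤ → R) (d : ℤ) (hf : ∀ p q, q < p + d → f p q = 0) :
    Ser R n :=
  HahnSeries.ofSuppBddBelow
    (fun m => (Matrix.of fun r c : Fin n => f (r : ℕ) ((c : ℕ) + n * m)))
    -- If `m ≤ -|d| - 2` then `c + n m < -n (|d| + 1) ≤ d ≤ r + d`, so the whole block lies below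
    -- the `d`-th diagonal.
    ⟨-|d| - 1, fun m => by
      contrapose!
      intro hm h
      refine h ?_
      ext r c
      refine hf _ _ ?_
      have hc : ((c : ℕ) : ℤ) < n := by exact_mod_cast c.2
      have hn : (0 : ℤ) < n := by omega
      have h1 : (n : ℤ) * m ≤ n * (-|d| - 2) := mul_le_mul_of_nonneg_left (by omega) hn.le
      have h2 := neg_abs_le d
      have h3 : (0 : ℤ) ≤ |d| := abs_nonneg d
      nlinarith⟩

theorem ent_ofEnt (f : ℤ → ℤ → R) (d : ℤ) (hf : ∀ p q, q < p + d → f p q = 0)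
    (hper : ∀ p q k : ℤ, f (p + n * k) (q + n * k) = f p q) (p q : ℤ) :
    ent (ofEnt n f d hf) p q = f p q := by
  change f ((res n p : ℕ) : ℤ) ((res n q : ℕ) + n * (q / n - p / n)) = _
  rw [← hper _ _ (p / n), res_add_ediv, mul_sub]
  congr 1
  have := res_add_ediv (n := n) q
  linarith

/-- Traces of the coefficients are cyclic. -/
theorem trace_coeff_mul_comm (X Y : Ser R n) (m : ℤ) :
    ((X * Y).coeff m).trace = ((Y * X).coeff m).trace := by
  obtain ⟨S, hS, h⟩ := coeff_mul_eq_sum X Y m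
  obtain ⟨S', hS', h'⟩ := coeff_mul_eq_sum Y X m
  classical
  have f1 : ((X * Y).coeff m).trace = ∑ᶠ i, (X.coeff i * Y.coeff (m - i)).trace := by
    rw [h, Matrix.trace_sum, finsum_eq_sum_of_support_subset]
    intro i hi
    by_contra h0
    exact hi (by rcases hS i h0 with h | h <;> simp [h])
  have f2 : ((Y * X).coeff m).trace = ∑ᶠ i, (Y.coeff i * X.coeff (m - i)).trace := by
    rw [h', Matrix.trace_sum, finsum_eq_sum_of_support_subset]
    intro i hi
    by_contra h0
    exact hi (by rcases hS' i h0 with h | h <;> simp [h])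
  rw [f1, f2, ← finsum_comp_equiv (Equiv.subLeft m)]
  refine finsum_congr fun i => ?_
  rw [Equiv.subLeft_apply, sub_sub_cancel, Matrix.trace_mul_comm]

theorem trace_coeff_eq (X : Ser R n) (m : ℤ) :
    (X.coeff m).trace = ∑ r : Fin n, ent X (r : ℕ) ((r : ℕ) + n * m) := by
  simp only [Matrix.trace, Matrix.diag_apply, coeff_eq_ent]

end Entries

/-! ### First-order difference equations on `ℤ / n` -/

section Difference

variable {R : Type*} [CommRing R] [Algebra ℝ R] {n : ℕ} [NeZero n]

theorem const_of_sub_one {α : Type*} {g : ℤ → α} (h : ∀ p, g p = g (p - 1)) (p q : ℤ) :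
    g p = g q := by
  have key : ∀ p, g p = g 0 := fun p => by
    induction p using Int.induction_on with
    | zero => rfl
    | succ i hi => rw [h, add_sub_cancel_right, hi]
    | pred i hi => rw [← h, hi]
  rw [key p, key q]

/-- The sum of a function over the period ending at `p`. -/
def windowSum (n : ℕ) (h : ℤ → R) (p : ℤ) : R := ∑ l ∈ Finset.range n, h (p - l)

theorem windowSum_eq {h : ℤ → R} (hp : ∀ p, h (p + n) = h p) (p q : ℤ) :
    windowSum n h p = windowSum n h q := by
  refine const_of_sub_one (fun p => ?_) p q
  have e : ∀ l : ℕ, h (p - 1 - l) = h (p - (l + 1 : ℕ)) := fun l => by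
    congr 1; push_cast; ring
  rw [windowSum, windowSum, Finset.sum_congr rfl fun l _ => e l, ← sub_eq_zero,
    ← Finset.sum_sub_distrib, ← neg_eq_zero, ← Finset.sum_neg_distrib]
  simp only [neg_sub]
  rw [Finset.sum_range_sub (fun l : ℕ => h (p - l)), Nat.cast_zero, sub_zero, ← hp (p - n),
    sub_add_cancel, sub_self]

theorem windowSum_sub_shift {a : ℤ → R} (ha : ∀ p, a (p + n) = a p) (p : ℤ) :
    windowSum n (fun p => a p - a (p - 1)) p = 0 := by
  have e : ∀ l : ℕ, a (p - l - 1) = a (p - (l + 1 : ℕ)) := fun l => by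
    congr 1; push_cast; ring
  rw [windowSum, Finset.sum_congr rfl fun l _ => by rw [e l], ← neg_eq_zero,
    ← Finset.sum_neg_distrib]
  simp only [neg_sub]
  rw [Finset.sum_range_sub (fun l : ℕ => a (p - l)), Nat.cast_zero, sub_zero, ← ha (p - n),
    sub_add_cancel, sub_self]

/-- A periodic solution of `a p - a (p - 1) = h p`. -/
def diffSol (n : ℕ) (h : ℤ → R) (p : ℤ) : R :=
  -((1 / n : ℝ) • ∑ l ∈ Finset.range n, (l : R) * h (p - l))

/-- Abel summation: `l h(p - 1 - l) = (l + 1) h(p - (l + 1)) - h(p - 1 - l)`. The first terms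
telescope against `l h(p - l)` to `n h(p - n) = n h(p)`, and the second ones add up to a window sum,
which vanishes. -/
theorem diffSol_sub {h : ℤ → R} (hp : ∀ p, h (p + n) = h p) (h0 : ∀ p, windowSum n h p = 0)
    (p : ℤ) : diffSol n h p - diffSol n h (p - 1) = h p := by
  have e : ∀ l : ℕ, (l : R) * h (p - 1 - l) =
      ((l + 1 : ℕ) : R) * h (p - (l + 1 : ℕ)) - h (p - 1 - l) := fun l => by
    rw [show p - (l + 1 : ℕ) = p - 1 - l by push_cast; ring]; push_cast; ring
  have key : ∑ l ∈ Finset.range n, (l : R) * h (p - 1 - l) -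
      ∑ l ∈ Finset.range n, (l : R) * h (p - l) = (n : R) * h p := by
    rw [Finset.sum_congr rfl fun l _ => e l, Finset.sum_sub_distrib, ← windowSum, h0, sub_zero,
      ← Finset.sum_sub_distrib, Finset.sum_range_sub (fun l : ℕ => (l : R) * h (p - l)),
      ← hp (p - n), sub_add_cancel]
    simp
  rw [diffSol, diffSol, sub_neg_eq_add, neg_add_eq_sub, ← smul_sub, key, ← nsmul_eq_mul,
    ← Nat.cast_smul_eq_nsmul ℝ, smul_smul, one_div,
    inv_mul_cancel₀ (Nat.cast_ne_zero.2 (NeZero.ne n)), one_smul]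

theorem diffSol_periodic {h : ℤ → R} (hp : ∀ p, h (p + n) = h p) (p : ℤ) :
    diffSol n h (p + n) = diffSol n h p := by
  rw [diffSol, diffSol]
  congr 2
  refine Finset.sum_congr rfl fun l _ => ?_
  rw [add_sub_right_comm, hp]

end Difference

/-! ### The dressing recursion -/

section Recursion

variable {R : Type*} [CommRing R] [Algebra ℝ R] {n : ℕ} [NeZero n]

/-- The right-hand side of the dressing recursion without the term in the unknown `f d`. -/
def dressKnown (D : Derivation ℝ R R) (v : ℕ → ℤ → R) (d : ℕ) (x : ℕ → (ℤ → R) × R) (p : ℤ) : R :=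
  D ((x d).1 p) - ∑ i ∈ Finset.range (d + 1), (x i).1 p * v (d - i) (p + i) +
    ∑ i ∈ Finset.range d, (x (i + 1)).2 * (x (d - i)).1 (p + i)

/-- One step of the dressing recursion. -/
def dressStep (n : ℕ) (D : Derivation ℝ R R) (v : ℕ → ℤ → R) (d : ℕ) (x : ℕ → (ℤ → R) × R) :
    (ℤ → R) × R :=
  -- The value of `f_d` for which the right-hand side has sum zero over a period.
  let f := -((1 / n : ℝ) • windowSum n (dressKnown D v d x) 0)
  let h := fun p => dressKnown D v d x p + f
  -- The diagonal `d + 1` meets column `0` in row `-(d + 1)`; subtracting the value there makes the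
  -- first column of `T` equal to `e_1`.
  (fun p => diffSol n h p - diffSol n h (-(d + 1 : ℕ)), f)

/-- The first terms of the dressing recursion. -/
def dressTable (n : ℕ) (D : Derivation ℝ R R) (v : ℕ → ℤ → R) : ℕ → ℕ → (ℤ → R) × R
  | 0 => fun _ => (fun _ => 1, 0)
  | d + 1 => Function.update (dressTable n D v d) (d + 1) (dressStep n D v d (dressTable n D v d))

/-- The solution of the dressing recursion. -/
def dressSeq (n : ℕ) (D : Derivation ℝ R R) (v : ℕ → ℤ → R) (d : ℕ) : (ℤ → R) × R :=
  dressTable n D v d d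

/-- The table encodes a course-of-values recursion: stage `d + 1` overwrites only the entry `d + 1`,
so an entry is final once computed. -/
theorem dressTable_of_le (D : Derivation ℝ R R) (v : ℕ → ℤ → R) (d k : ℕ) :
    dressTable n D v (d + k) d = dressSeq n D v d := by
  induction k with
  | zero => rfl
  | succ k ih => rw [← ih, ← add_assoc, dressTable, Function.update_of_ne (by omega)]

theorem dressKnown_congr (D : Derivation ℝ R R) (v : ℕ → ℤ → R) (d : ℕ) {x y : ℕ → (ℤ → R) × R}
    (h : ∀ i ≤ d, x i = y i) : dressKnown D v d x = dressKnown D v d y := by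
  funext p
  rw [dressKnown, dressKnown, h d le_rfl]
  congr 1
  · congr 1
    refine Finset.sum_congr rfl fun i hi => ?_
    rw [h i (by simp at hi; omega)]
  · refine Finset.sum_congr rfl fun i hi => ?_
    rw [Finset.mem_range] at hi
    rw [h (i + 1) (by omega), h (d - i) (by omega)]

theorem dressSeq_succ (D : Derivation ℝ R R) (v : ℕ → ℤ → R) (d : ℕ) :
    dressSeq n D v (d + 1) = dressStep n D v d (dressSeq n D v) := by
  rw [dressSeq, dressTable, Function.update_self, dressStep, dressStep,
    dressKnown_congr D v d (y := dressSeq n D v)]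
  intro i hi
  obtain ⟨k, rfl⟩ := Nat.exists_eq_add_of_le hi
  exact dressTable_of_le D v i k

/-- A solution of the dressing recursion. -/
structure IsDressSeq (n : ℕ) (D : Derivation ℝ R R) (v : ℕ → ℤ → R) (a : ℕ → ℤ → R) (f : ℕ → R) :
    Prop where
  zero : ∀ p, a 0 p = 1
  per : ∀ d p, a d (p + n) = a d p
  norm : ∀ d, a (d + 1) (-(d + 1 : ℕ)) = 0
  step : ∀ d p, a (d + 1) p - a (d + 1) (p - 1) =
    D (a d p) - ∑ i ∈ Finset.range (d + 1), a i p * v (d - i) (p + i) +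
      ∑ i ∈ Finset.range (d + 1), f i * a (d - i) (p + i)

theorem dressKnown_periodic (D : Derivation ℝ R R) {v : ℕ → ℤ → R}
    (hv : ∀ d p, v d (p + n) = v d p) (d : ℕ) {x : ℕ → (ℤ → R) × R}
    (hx : ∀ i ≤ d, ∀ p, (x i).1 (p + n) = (x i).1 p) (p : ℤ) :
    dressKnown D v d x (p + n) = dressKnown D v d x p := by
  rw [dressKnown, dressKnown, hx d le_rfl]
  congr 1
  · congr 1
    refine Finset.sum_congr rfl fun i hi => ?_
    rw [Finset.mem_range] at hi
    rw [hx i (by omega), add_right_comm, hv]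
  · refine Finset.sum_congr rfl fun i _ => ?_
    rw [add_right_comm, hx (d - i) (by omega)]

/-- Stage `d + 1` produces the diagonal `a_{d+1}` together with `f_d`, hence the shift of index in
the second component; the second component at stage `0` is a dummy. -/
theorem isDressSeq_dressSeq (D : Derivation ℝ R R) {v : ℕ → ℤ → R}
    (hv : ∀ d p, v d (p + n) = v d p) :
    IsDressSeq n D v (fun d => (dressSeq n D v d).1) (fun d => (dressSeq n D v (d + 1)).2) := by
  have hper : ∀ d, ∀ i ≤ d, ∀ p, (dressSeq n D v i).1 (p + n) = (dressSeq n D v i).1 p := by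
    intro d
    induction d with
    | zero =>
      intro i hi p
      obtain rfl : i = 0 := by omega
      rfl
    | succ d ih =>
      intro i hi p
      rcases Nat.lt_or_eq_of_le hi with h | rfl
      · exact ih i (by omega) p
      · rw [dressSeq_succ, dressStep]
        dsimp only
        rw [diffSol_periodic]
        intro p
        rw [dressKnown_periodic D hv d ih]
  refine ⟨fun p => rfl, fun d p => hper d d le_rfl p, fun d => ?_, fun d p => ?_⟩
  · simp only [dressSeq_succ, dressStep, sub_self]
  · have hk := dressKnown_periodic D hv d (x := dressSeq n D v) (hper d)
    have hf : ∀ p, windowSum n (fun p => dressKnown D v d (dressSeq n D v) p +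
        -((1 / n : ℝ) • windowSum n (dressKnown D v d (dressSeq n D v)) 0)) p = 0 := fun p => by
      rw [windowSum, Finset.sum_add_distrib, ← windowSum, Finset.sum_const, Finset.card_range,
        windowSum_eq hk p 0, smul_neg, ← Nat.cast_smul_eq_nsmul ℝ, smul_smul, one_div,
        mul_inv_cancel₀ (Nat.cast_ne_zero.2 (NeZero.ne n)), one_smul, add_neg_cancel]
    have h := diffSol_sub (fun p => by rw [hk p]) hf p
    rw [Finset.sum_range_succ (fun i => (dressSeq n D v (i + 1)).2 * (dressSeq n D v (d - i)).1 (p + i)),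
      ← add_assoc, ← dressKnown, dressSeq_succ, dressStep]
    dsimp only
    rw [sub_sub_sub_cancel_right, h, Nat.sub_self]
    simp [dressSeq, dressTable]

/-- Given agreement so far, the difference `e` of the two diagonals `d + 1` satisfies `e p - e (p -
1) = f d - f' d`. Summing over a period gives `f d = f' d`; then `e` is constant, and the
normalisation makes it zero. -/
theorem IsDressSeq.unique {D : Derivation ℝ R R} {v : ℕ → ℤ → R} {a a' : ℕ → ℤ → R}
    {f f' : ℕ → R} (h : IsDressSeq n D v a f) (h' : IsDressSeq n D v a' f') :
    a = a' ∧ f = f' := by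
  have key : ∀ d, (∀ i ≤ d, a i = a' i) ∧ (∀ i < d, f i = f' i) := by
    intro d
    induction d with
    | zero =>
      refine ⟨fun i hi => ?_, fun i hi => by omega⟩
      obtain rfl : i = 0 := by omega
      funext p
      rw [h.zero, h'.zero]
    | succ d ih =>
      let e : ℤ → R := fun p => a (d + 1) p - a' (d + 1) p
      have he : ∀ p, e p - e (p - 1) = f d - f' d := fun p => by
        have h1 := h.step d p
        have h2 := h'.step d p
        rw [Finset.sum_range_succ (fun i => f i * a (d - i) (p + i)), Nat.sub_self, h.zero] at h1
        rw [Finset.sum_range_succ (fun i => f' i * a' (d - i) (p + i)), Nat.sub_self,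
          h'.zero] at h2
        have s1 : ∑ i ∈ Finset.range (d + 1), a i p * v (d - i) (p + i) =
            ∑ i ∈ Finset.range (d + 1), a' i p * v (d - i) (p + i) :=
          Finset.sum_congr rfl fun i hi => by
            rw [Finset.mem_range] at hi; rw [ih.1 i (by omega)]
        have s2 : ∑ i ∈ Finset.range d, f i * a (d - i) (p + i) =
            ∑ i ∈ Finset.range d, f' i * a' (d - i) (p + i) :=
          Finset.sum_congr rfl fun i hi => by
            rw [Finset.mem_range] at hi; rw [ih.1 (d - i) (by omega), ih.2 i hi]
        rw [s1, s2, ih.1 d le_rfl] at h1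
        simp only [e]
        linear_combination h1 - h2
      have hper : ∀ p, e (p + n) = e p := fun p => by simp only [e, h.per, h'.per]
      have hf : f d = f' d := by
        have h0 := windowSum_sub_shift hper 0
        simp only [windowSum, he, Finset.sum_const, Finset.card_range] at h0
        rw [← Nat.cast_smul_eq_nsmul ℝ] at h0
        have h1 := congrArg (fun z : R => (n : ℝ)⁻¹ • z) h0
        simp only [smul_smul, smul_zero] at h1
        rw [inv_mul_cancel₀ (Nat.cast_ne_zero.2 (NeZero.ne n)), one_smul] at h1
        exact sub_eq_zero.1 h1
      have ha : a (d + 1) = a' (d + 1) := by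
        funext p
        have h0 := const_of_sub_one (g := e)
          (fun p => by rw [← sub_eq_zero, he, hf, sub_self]) p (-(d + 1 : ℕ))
        rw [show e (-(d + 1 : ℕ)) = 0 by simp only [e]; rw [h.norm, h'.norm, sub_zero]] at h0
        exact sub_eq_zero.1 h0
      refine ⟨fun i hi => ?_, fun i hi => ?_⟩
      · rcases Nat.lt_or_eq_of_le hi with h1 | rfl
        · exact ih.1 i (by omega)
        · exact ha
      · rcases Nat.lt_or_eq_of_le (Nat.le_of_lt_succ hi) with h1 | rfl
        · exact ih.2 i h1
        · exact hf
  exact ⟨funext fun d => (key d).1 d le_rfl, funext fun d => (key (d + 1)).2 d (by omega)⟩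

end Recursion

/-! ### The matrix `J` and Toeplitz series -/

section Shift

variable (R : Type*) [CommRing R] (n : ℕ)

/-- `b = ∑ e_{i+1,i}` over a commutative ring. -/
def lowerShift : Matrix (Fin n) (Fin n) R := fun i j => if (i : ℕ) = j + 1 then 1 else 0

/-- `e_{1n}` over a commutative ring. -/
def cornerMat : Matrix (Fin n) (Fin n) R := fun i j => if (i : ℕ) = 0 ∧ (j : ℕ) + 1 = n then 1 else 0

/-- `J = e_{1n} λ + b` over a commutative ring. -/
def serJ : Ser R n := HahnSeries.single (-1) (cornerMat R n) + HahnSeries.single 0 (lowerShift R n)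

/-- `J⁻¹` over a commutative ring. -/
def serJInv : Ser R n :=
  HahnSeries.single 0 (lowerShift R n).transpose + HahnSeries.single 1 (cornerMat R n).transpose

variable {R n}

/-- `∑_{i ≥ 0} f_i J^{-i}` over a commutative ring. -/
def serTail [NeZero n] (f : ℕ → R) : Ser R n :=
  ofEnt n (fun p q => if p ≤ q then f (q - p).toNat else 0) 0
    (fun p q h => if_neg (by omega))

variable [NeZero n]

theorem ent_of_coeff {Y : Ser R n} {f : ℤ → ℤ → R}
    (hper : ∀ p q k : ℤ, f (p + n * k) (q + n * k) = f p q)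
    (h : ∀ (m : ℤ) (r c : Fin n), Y.coeff m r c = f (r : ℕ) ((c : ℕ) + n * m)) (p q : ℤ) :
    ent Y p q = f p q := by
  rw [ent, h, ← hper _ _ (p / n), res_add_ediv, mul_sub]
  congr 1
  have := res_add_ediv (n := n) q
  linarith

/-- Neighbouring integers lie in the same period or on the two sides of a boundary between periods.
The boundary cases are the corner entries of `J` and `J⁻¹`, the other ones come from `b` and its
transpose. -/
theorem mul_bounds {n r c : ℕ} (hr : r < n) (hc : c < n) (m k : ℤ)
    (h : (r : ℤ) = c + n * m + k) (h1 : -1 ≤ k) (h2 : k ≤ 1) :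
    (m = 0 ∧ (r : ℤ) = c + k) ∨ (m = -1 ∧ r = 0 ∧ c + 1 = n ∧ k = 1) ∨
      (m = 1 ∧ c = 0 ∧ r + 1 = n ∧ k = -1) := by
  have hn : (0 : ℤ) < n := by omega
  have hm1 : -1 ≤ m := by
    by_contra hm
    have : (n : ℤ) * m ≤ n * (-2) := mul_le_mul_of_nonneg_left (by omega) hn.le
    omega
  have hm2 : m ≤ 1 := by
    by_contra hm
    have : (n : ℤ) * 2 ≤ n * m := mul_le_mul_of_nonneg_left (by omega) hn.le
    omega
  obtain rfl | rfl | rfl : m = -1 ∨ m = 0 ∨ m = 1 := by omega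
  all_goals omega

theorem ent_serJ (p q : ℤ) : ent (serJ R n) p q = if p = q + 1 then 1 else 0 := by
  refine ent_of_coeff (f := fun p q => if p = q + 1 then 1 else 0) (fun p q k => ?_)
    (fun m r c => ?_) p q
  · exact if_congr (by constructor <;> intro h <;> linarith) rfl rfl
  · rw [serJ, HahnSeries.coeff_add, Matrix.add_apply, HahnSeries.coeff_single,
      HahnSeries.coeff_single]
    have hr := r.2
    have hc := c.2
    by_cases h : ((r : ℕ) : ℤ) = (c : ℕ) + n * m + 1
    · rw [if_pos h]
      rcases mul_bounds hr hc m 1 h (by omega) (by omega) with ⟨rfl, h⟩ | ⟨rfl, h1, h2, -⟩ | h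
      · rw [if_neg (by omega), if_pos rfl, lowerShift, if_pos (by omega)]; simp
      · rw [if_pos rfl, if_neg (by omega), cornerMat, if_pos ⟨h1, h2⟩]; simp
      · omega
    · rw [if_neg h]
      split_ifs with h1 h2 h2
      · omega
      · subst h1
        rw [cornerMat, if_neg (by intro h3; apply h; omega)]; simp
      · subst h2
        rw [lowerShift, if_neg (by intro h3; apply h; omega)]; simp
      · simp

theorem ent_serJInv (p q : ℤ) : ent (serJInv R n) p q = if q = p + 1 then 1 else 0 := by
  refine ent_of_coeff (f := fun p q => if q = p + 1 then 1 else 0) (fun p q k => ?_)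
    (fun m r c => ?_) p q
  · exact if_congr (by constructor <;> intro h <;> linarith) rfl rfl
  · rw [serJInv, HahnSeries.coeff_add, Matrix.add_apply, HahnSeries.coeff_single,
      HahnSeries.coeff_single]
    have hr := r.2
    have hc := c.2
    by_cases h : ((c : ℕ) + n * m : ℤ) = ((r : ℕ) : ℤ) + 1
    · rw [if_pos h]
      rcases mul_bounds hr hc m (-1) (by omega) (by omega) (by omega) with
        ⟨rfl, h⟩ | h | ⟨rfl, h1, h2, -⟩
      · rw [if_pos rfl, if_neg (by omega), Matrix.transpose_apply, lowerShift,
          if_pos (by omega)]; simp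
      · omega
      · rw [if_neg (by omega), if_pos rfl, Matrix.transpose_apply, cornerMat,
          if_pos ⟨h1, h2⟩]; simp
    · rw [if_neg h]
      split_ifs with h1 h2 h2
      · omega
      · subst h1
        rw [Matrix.transpose_apply, lowerShift, if_neg (by intro h3; apply h; omega)]; simp
      · subst h2
        rw [Matrix.transpose_apply, cornerMat, if_neg (by intro h3; apply h; omega)]; simp
      · simp

theorem ent_mul_serJ (Y : Ser R n) (p q : ℤ) : ent (Y * serJ R n) p q = ent Y p (q + 1) := by
  rw [ent_mul_finsum, finsum_eq_single _ (q + 1)]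
  · rw [ent_serJ, if_pos rfl, mul_one]
  · intro l hl
    rw [ent_serJ, if_neg hl, mul_zero]

theorem ent_serJ_mul (Y : Ser R n) (p q : ℤ) : ent (serJ R n * Y) p q = ent Y (p - 1) q := by
  rw [ent_mul_finsum, finsum_eq_single _ (p - 1)]
  · rw [ent_serJ, if_pos (by omega), one_mul]
  · intro l hl
    rw [ent_serJ, if_neg (by omega), zero_mul]

theorem ent_serJInv_mul (Y : Ser R n) (p q : ℤ) :
    ent (serJInv R n * Y) p q = ent Y (p + 1) q := by
  rw [ent_mul_finsum, finsum_eq_single _ (p + 1)]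
  · rw [ent_serJInv, if_pos rfl, one_mul]
  · intro l hl
    rw [ent_serJInv, if_neg hl, zero_mul]

theorem ent_serJInv_pow (i : ℕ) (p q : ℤ) :
    ent (serJInv R n ^ i) p q = if q = p + i then 1 else 0 := by
  induction i generalizing p with
  | zero => rw [pow_zero, ent_one]; exact if_congr (by omega) rfl rfl
  | succ i ih => rw [pow_succ', ent_serJInv_mul, ih]; exact if_congr (by push_cast; omega) rfl rfl

theorem ent_mul_serJ_pow (Y : Ser R n) (j : ℕ) (p q : ℤ) :
    ent (Y * serJ R n ^ j) p q = ent Y p (q + j) := by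
  induction j generalizing q with
  | zero => simp
  | succ j ih =>
    rw [pow_succ, ← mul_assoc, ent_mul_serJ, ih]
    congr 1
    push_cast; ring

theorem ent_serJ_pow (j : ℕ) (p q : ℤ) :
    ent (serJ R n ^ j) p q = if p = q + j then 1 else 0 := by
  rw [← one_mul (serJ R n ^ j), ent_mul_serJ_pow, ent_one]

theorem serJ_pow_n : serJ R n ^ n = HahnSeries.single (-1) 1 := by
  refine ser_ext fun p q => ?_
  rw [ent_serJ_pow, ent, HahnSeries.coeff_single]
  have h1 := res_add_ediv (n := n) p
  have h2 := res_add_ediv (n := n) q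
  by_cases h : p = q + n
  · rw [if_pos h]
    have hp : p = q + n * 1 := by omega
    have h3 : p / (n : ℤ) = q / n + 1 := by
      rw [hp, Int.add_mul_ediv_left _ _ (by exact_mod_cast NeZero.ne n)]
    rw [if_pos (by omega), hp, res_shift, Matrix.one_apply_eq]
  · rw [if_neg h]
    split_ifs with h3
    · rw [Matrix.one_apply_ne]
      intro h4
      apply h
      rw [h4, show p / (n : ℤ) = q / n + 1 by omega, mul_add] at h1
      omega
    · rfl

theorem ordGE_serJ : OrdGE (serJ R n) (-1) := fun p q h => by
  rw [ent_serJ, if_neg (by omega)]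

theorem ent_serTail (f : ℕ → R) (p q : ℤ) :
    ent (serTail f : Ser R n) p q = if p ≤ q then f (q - p).toNat else 0 :=
  ent_ofEnt _ _ _ (fun p q k => by
    rw [add_sub_add_right_eq_sub]; exact if_congr (by omega) rfl rfl) p q

theorem ordGE_serTail (f : ℕ → R) : OrdGE (serTail f : Ser R n) 0 := fun p q h => by
  rw [ent_serTail, if_neg (by omega)]

theorem serJ_commute_serTail (f : ℕ → R) : Commute (serJ R n) (serTail f) := by
  refine ser_ext fun p q => ?_
  rw [ent_mul_serJ, ent_serJ_mul, ent_serTail, ent_serTail, show q - (p - 1) = q + 1 - p by ring]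
  exact if_congr (by omega) rfl rfl

/-- `tr J^j` has no `λ^m`-coefficient unless `n ∣ j`. -/
theorem trace_coeff_serJ_pow {j : ℕ} (hj : ¬ n ∣ j) (m : ℤ) :
    ((serJ R n ^ j).coeff m).trace = 0 := by
  rw [trace_coeff_eq]
  refine Finset.sum_eq_zero fun r _ => ?_
  rw [ent_serJ_pow, if_neg]
  intro h
  refine hj (Int.natCast_dvd_natCast.1 ⟨-m, ?_⟩)
  rw [mul_neg]; linarith

end Shift

/-! ### Coefficientwise derivations -/

section Deriv

variable {R : Type*} [CommRing R] [Algebra ℝ R] {n : ℕ} [NeZero n]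

/-- A derivation, applied to the entries of a matrix. -/
def matD (D : Derivation ℝ R R) : Matrix (Fin n) (Fin n) R →ₗ[ℝ] Matrix (Fin n) (Fin n) R :=
  (D : R →ₗ[ℝ] R).mapMatrix

/-- A derivation, applied to the entries of the coefficients of a series. -/
def serD (D : Derivation ℝ R R) (Y : Ser R n) : Ser R n := Y.map (matD D)

theorem ent_serD (D : Derivation ℝ R R) (Y : Ser R n) (p q : ℤ) :
    ent (serD D Y) p q = D (ent Y p q) := rfl

theorem OrdGE.serD {D : Derivation ℝ R R} {Y : Ser R n} {d : ℤ} (h : OrdGE Y d) :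
    OrdGE (serD D Y) d := fun p q hpq => by rw [ent_serD, h p q hpq, map_zero]

theorem serD_mul (D : Derivation ℝ R R) (X Y : Ser R n) :
    serD D (X * Y) = serD D X * Y + X * serD D Y := by
  obtain ⟨d, hd⟩ := exists_ordGE X
  obtain ⟨e, he⟩ := exists_ordGE Y
  refine ser_ext fun p q => ?_
  rw [ent_serD, ent_add, ent_mul hd he, ent_mul hd.serD he, ent_mul hd he.serD, map_sum,
    ← Finset.sum_add_distrib]
  refine Finset.sum_congr rfl fun l _ => ?_
  rw [ent_serD, ent_serD, D.leibniz, smul_eq_mul, smul_eq_mul]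
  ring

theorem serD_add (D : Derivation ℝ R R) (X Y : Ser R n) :
    serD D (X + Y) = serD D X + serD D Y :=
  ser_ext fun p q => by simp only [ent_serD, ent_add, map_add]

theorem serD_sub (D : Derivation ℝ R R) (X Y : Ser R n) :
    serD D (X - Y) = serD D X - serD D Y :=
  ser_ext fun p q => by simp only [ent_serD, ent_sub, map_sub]

theorem serD_one (D : Derivation ℝ R R) : serD D (1 : Ser R n) = 0 :=
  ser_ext fun p q => by
    rw [ent_serD, ent_one, ent_zero]; split_ifs <;> simp

theorem serD_serJ (D : Derivation ℝ R R) : serD D (serJ R n) = 0 :=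
  ser_ext fun p q => by
    rw [ent_serD, ent_serJ, ent_zero]; split_ifs <;> simp

theorem serD_serJ_pow (D : Derivation ℝ R R) (j : ℕ) : serD D (serJ R n ^ j) = 0 :=
  ser_ext fun p q => by
    rw [ent_serD, ent_serJ_pow, ent_zero]; split_ifs <;> simp

theorem serD_serTail (D : Derivation ℝ R R) (f : ℕ → R) :
    serD D (serTail f : Ser R n) = serTail fun i => D (f i) :=
  ser_ext fun p q => by
    rw [ent_serD, ent_serTail, ent_serTail]; split_ifs <;> simp

theorem trace_serD_coeff (D : Derivation ℝ R R) (Y : Ser R n) (m : ℤ) :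
    ((serD D Y).coeff m).trace = D (Y.coeff m).trace := by
  rw [Matrix.trace, Matrix.trace, map_sum]
  rfl

theorem serD_comm {D E : Derivation ℝ R R} (h : ∀ r, D (E r) = E (D r)) (Y : Ser R n) :
    serD D (serD E Y) = serD E (serD D Y) :=
  ser_ext fun p q => by simp only [ent_serD, h]

end Deriv

/-! ### Existence and uniqueness of the dressing -/

section Dressing

variable {R : Type*} [CommRing R] [Algebra ℝ R] {n : ℕ} [NeZero n]

/-- `T` conjugates `∂ + J + V` to `∂ + J + ∑ f_i J^{-i}`; `T` is upper unitriangular as an infinite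
matrix, with first column `e_1`. -/
structure IsDress (D : Derivation ℝ R R) (V T : Ser R n) (f : ℕ → R) : Prop where
  ord : OrdGE T 0
  diag : ∀ p, ent T p p = 1
  col : ∀ p q, (n : ℤ) ∣ q → p ≠ q → ent T p q = 0
  eq : T * (serJ R n + V) - serD D T = (serJ R n + serTail f) * T

theorem sum_Icc_add (g : ℤ → R) (p : ℤ) (d : ℕ) :
    ∑ l ∈ Finset.Icc p (p + d), g l = ∑ i ∈ Finset.range (d + 1), g (p + i) := by
  symm
  refine Finset.sum_nbij (fun i : ℕ => p + i) (fun i hi => ?_) (fun i _ j _ h => ?_)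
    (fun l hl => ?_) (fun i _ => rfl)
  · rw [Finset.mem_range] at hi
    rw [Finset.mem_Icc]; omega
  · dsimp only at h; omega
  · rw [Finset.mem_coe, Finset.mem_Icc] at hl
    exact ⟨(l - p).toNat, by rw [Finset.mem_coe, Finset.mem_range]; omega, by dsimp only; omega⟩

theorem ent_dress_lhs {D : Derivation ℝ R R} {V T : Ser R n} (hV : OrdGE V 0) (hT : OrdGE T 0)
    (p : ℤ) (d : ℕ) : ent (T * (serJ R n + V) - serD D T) p (p + d) =
      ent T p (p + (d + 1 : ℕ)) + ∑ i ∈ Finset.range (d + 1),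
        ent T p (p + i) * ent V (p + i) (p + d) - D (ent T p (p + d)) := by
  rw [mul_add, ent_sub, ent_add, ent_mul_serJ, ent_serD, ent_mul hT hV, add_zero, sub_zero,
    sum_Icc_add]
  push_cast
  rw [add_assoc p]

theorem ent_dress_rhs {T : Ser R n} (hT : OrdGE T 0) (f : ℕ → R) (p : ℤ) (d : ℕ) :
    ent ((serJ R n + serTail f) * T) p (p + d) =
      ent T (p - 1) (p + d) + ∑ i ∈ Finset.range (d + 1), f i * ent T (p + i) (p + d) := by
  rw [add_mul, ent_add, ent_serJ_mul, ent_mul (ordGE_serTail f) hT, add_zero, sub_zero,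
    sum_Icc_add]
  congr 1
  refine Finset.sum_congr rfl fun i _ => ?_
  rw [ent_serTail, if_pos (by omega), add_sub_cancel_left, Int.toNat_natCast]

/-- The recursion is the dressing equation at the entry `(p, p + d)`: `T J` contributes the diagonal
`d + 1` at `p`, and `J T` the same diagonal at `p - 1`. -/
theorem IsDress.isDressSeq {D : Derivation ℝ R R} {V T : Ser R n} {f : ℕ → R} (hV : OrdGE V 0)
    (h : IsDress D V T f) :
    IsDressSeq n D (fun d p => ent V p (p + d)) (fun d p => ent T p (p + d)) f := by
  refine ⟨fun p => by simpa using h.diag p, fun d p => ?_, fun d => ?_, fun d p => ?_⟩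
  · have := ent_shift T p (p + d) 1
    rw [mul_one] at this
    rw [add_right_comm, this]
  · refine h.col _ _ ?_ ?_
    · rw [neg_add_cancel]; exact dvd_zero _
    · push_cast; omega
  · have e := congrArg (fun Z => ent Z p (p + d)) h.eq
    simp only [ent_dress_lhs hV h.ord, ent_dress_rhs h.ord] at e
    have s1 : ∀ i ∈ Finset.range (d + 1), ent T p (p + i) * ent V (p + i) (p + i + (d - i : ℕ)) =
        ent T p (p + i) * ent V (p + i) (p + d) := fun i hi => by
      rw [Finset.mem_range] at hi
      rw [show p + i + ((d - i : ℕ) : ℤ) = p + d by omega]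
    have s2 : ∀ i ∈ Finset.range (d + 1), f i * ent T (p + i) (p + i + (d - i : ℕ)) =
        f i * ent T (p + i) (p + d) := fun i hi => by
      rw [Finset.mem_range] at hi
      rw [show p + i + ((d - i : ℕ) : ℤ) = p + d by omega]
    rw [Finset.sum_congr rfl s1, Finset.sum_congr rfl s2,
      show p - 1 + ((d + 1 : ℕ) : ℤ) = p + d by push_cast; ring]
    linear_combination e

theorem IsDress.unique {D : Derivation ℝ R R} {V T T' : Ser R n} {f f' : ℕ → R} (hV : OrdGE V 0)
    (h : IsDress D V T f) (h' : IsDress D V T' f') : T = T' ∧ f = f' := by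
  obtain ⟨h1, h2⟩ := (h.isDressSeq hV).unique (h'.isDressSeq hV)
  refine ⟨ser_ext fun p q => ?_, h2⟩
  by_cases hpq : p ≤ q
  · have := congrFun (congrFun h1 (q - p).toNat) p
    rwa [show p + ((q - p).toNat : ℤ) = q by omega] at this
  · rw [h.ord p q (by omega), h'.ord p q (by omega)]

theorem exists_isDress (D : Derivation ℝ R R) {V : Ser R n} (hV : OrdGE V 0) :
    ∃ T f, IsDress D V T f := by
  have hv : ∀ (d : ℕ) (p : ℤ), ent V (p + n) (p + n + d) = ent V p (p + d) := fun d p => by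
    have := ent_shift V p (p + d) 1
    rw [mul_one] at this
    rw [add_right_comm, this]
  have H := isDressSeq_dressSeq (n := n) D (v := fun d p => ent V p (p + d)) hv
  generalize (fun d => (dressSeq n D (fun d p => ent V p (p + d)) d).1) = a at H
  generalize (fun d => (dressSeq n D (fun d p => ent V p (p + d)) (d + 1)).2) = f at H
  have hper : ∀ d p (k : ℤ), a d (p + n * k) = a d p := fun d p k => by
    have := (show Function.Periodic (a d) n from H.per d).int_mul k p
    rwa [mul_comm] at this
  let g : ℤ → ℤ → R := fun p q => if p ≤ q then a (q - p).toNat p else 0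
  let T : Ser R n := ofEnt n g 0 (fun p q h => if_neg (by omega))
  have hT : ∀ p q, ent T p q = if p ≤ q then a (q - p).toNat p else 0 :=
    ent_ofEnt _ _ _ fun p q k => by
      simp only [g]
      rw [add_sub_add_right_eq_sub, hper]
      exact if_congr (by omega) rfl rfl
  have hTd : ∀ p (d : ℕ), ent T p (p + d) = a d p := fun p d => by
    rw [hT, if_pos (by omega), add_sub_cancel_left, Int.toNat_natCast]
  have hord : OrdGE T 0 := fun p q h => by rw [hT, if_neg (by omega)]
  have hdiag : ∀ p, ent T p p = 1 := fun p => by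
    have := hTd p 0
    rwa [Nat.cast_zero, add_zero, H.zero] at this
  refine ⟨T, f, hord, hdiag, fun p q hq hpq => ?_, ser_ext fun p q => ?_⟩
  -- By periodicity a column `n k` may be moved to column `0`, where the normalisation of the
  -- recursion applies.
  · rw [hT]
    split_ifs with h
    · obtain ⟨k, rfl⟩ := hq
      obtain ⟨d, hd⟩ : ∃ d : ℕ, n * k - p = (d + 1 : ℕ) := ⟨(n * k - p - 1).toNat, by omega⟩
      rw [hd, Int.toNat_natCast, show p = -(d + 1 : ℕ) + n * k by linarith, hper, H.norm]
    · rfl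
  · by_cases hpq : p ≤ q
    · obtain ⟨d, rfl⟩ : ∃ d : ℕ, q = p + d := ⟨(q - p).toNat, by omega⟩
      rw [ent_dress_lhs hV hord, ent_dress_rhs hord]
      have e := H.step d p
      rw [hTd, hTd, show p + (d : ℤ) = p - 1 + ((d + 1 : ℕ) : ℤ) by push_cast; ring, hTd,
        show p - 1 + ((d + 1 : ℕ) : ℤ) = p + (d : ℤ) by push_cast; ring]
      have s1 : ∀ i ∈ Finset.range (d + 1), a i p * ent V (p + i) (p + i + (d - i : ℕ)) =
          ent T p (p + i) * ent V (p + i) (p + d) := fun i hi => by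
        rw [Finset.mem_range] at hi
        rw [hTd, show p + i + ((d - i : ℕ) : ℤ) = p + d by omega]
      have s2 : ∀ i ∈ Finset.range (d + 1), f i * a (d - i) (p + i) =
          f i * ent T (p + i) (p + d) := fun i hi => by
        rw [Finset.mem_range] at hi
        rw [← hTd, show p + i + ((d - i : ℕ) : ℤ) = p + d by omega]
      rw [Finset.sum_congr rfl s1, Finset.sum_congr rfl s2] at e
      linear_combination e
    -- Below the main diagonal only the products with `J` survive, and the equation reads `T p (q +
    -- 1) = T (p - 1) q`: both sides are `1` if `q + 1 = p` and `0` otherwise.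
    · rw [mul_add, add_mul, ent_sub, ent_add, ent_add, ent_mul_serJ, ent_serJ_mul, ent_serD,
        hord p q (by omega), ((hord.mul hV).mono le_rfl) p q (by omega),
        (((ordGE_serTail f).mul hord).mono le_rfl) p q (by omega), map_zero, sub_zero]
      congr 1
      by_cases h1 : q + 1 = p
      · rw [h1, show p - 1 = q by omega, hdiag, hdiag]
      · rw [hord _ _ (by omega), hord _ _ (by omega)]

/-! ### Base change along homomorphisms of differential rings -/

/-- The image of a series under a ring homomorphism. -/
def serMap {R' : Type*} [CommRing R'] (φ : R →+* R') (Y : Ser R n) : Ser R' n :=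
  Y.map (φ.mapMatrix : Matrix (Fin n) (Fin n) R →+* Matrix (Fin n) (Fin n) R')

section Map

variable {R' : Type*} [CommRing R'] [Algebra ℝ R'] (φ : R →+* R')

theorem ent_serMap (Y : Ser R n) (p q : ℤ) : ent (serMap φ Y) p q = φ (ent Y p q) := rfl

theorem OrdGE.serMap {Y : Ser R n} {d : ℤ} (h : OrdGE Y d) : OrdGE (serMap φ Y) d :=
  fun p q hpq => by rw [ent_serMap, h p q hpq, map_zero]

theorem serMap_mul (X Y : Ser R n) : serMap φ (X * Y) = serMap φ X * serMap φ Y := by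
  obtain ⟨d, hd⟩ := exists_ordGE X
  obtain ⟨e, he⟩ := exists_ordGE Y
  refine ser_ext fun p q => ?_
  rw [ent_serMap, ent_mul hd he, ent_mul (hd.serMap φ) (he.serMap φ), map_sum]
  refine Finset.sum_congr rfl fun l _ => ?_
  rw [ent_serMap, ent_serMap, map_mul]

theorem serMap_add (X Y : Ser R n) : serMap φ (X + Y) = serMap φ X + serMap φ Y :=
  ser_ext fun p q => by simp only [ent_serMap, ent_add, map_add]

theorem serMap_sub (X Y : Ser R n) : serMap φ (X - Y) = serMap φ X - serMap φ Y :=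
  ser_ext fun p q => by simp only [ent_serMap, ent_sub, map_sub]

theorem serMap_one : serMap φ (1 : Ser R n) = 1 :=
  ser_ext fun p q => by rw [ent_serMap, ent_one, ent_one]; split_ifs <;> simp

theorem serMap_serJ : serMap φ (serJ R n) = serJ R' n :=
  ser_ext fun p q => by rw [ent_serMap, ent_serJ, ent_serJ]; split_ifs <;> simp

theorem serMap_serTail (f : ℕ → R) :
    serMap φ (serTail f : Ser R n) = serTail fun i => φ (f i) :=
  ser_ext fun p q => by rw [ent_serMap, ent_serTail, ent_serTail]; split_ifs <;> simp

/-- Used for restriction to a parameter value: a dressing of a family of potentials restricts to the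
dressing of each member. -/
theorem IsDress.map {D : Derivation ℝ R R} {D' : Derivation ℝ R' R'}
    (hφ : ∀ r, φ (D r) = D' (φ r)) {V T : Ser R n} {f : ℕ → R} (h : IsDress D V T f) :
    IsDress D' (serMap φ V) (serMap φ T) (fun i => φ (f i)) := by
  refine ⟨h.ord.serMap φ, fun p => by rw [ent_serMap, h.diag, map_one], fun p q hq hpq => by
    rw [ent_serMap, h.col p q hq hpq, map_zero], ?_⟩
  have hD : serD D' (serMap φ T) = serMap φ (serD D T) :=
    ser_ext fun p q => by simp only [ent_serMap, ent_serD, hφ]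
  rw [hD, ← serMap_serJ φ, ← serMap_serTail, ← serMap_add, ← serMap_add, ← serMap_mul,
    ← serMap_mul, ← serMap_sub, h.eq]

end Map

/-! ### Inverses of unitriangular series -/

theorem coeff_eq_zero_of_ordGE {T : Ser R n} {d : ℤ} (hT : OrdGE T d) {m : ℤ}
    (hm : n * m + n - 1 < d) : T.coeff m = 0 := by
  ext r c
  rw [coeff_eq_ent]
  have := c.2
  exact hT _ _ (by omega)

/-- Such a `T` is a power series in `λ⁻¹` whose constant term is upper unitriangular, hence a unit.
-/
theorem exists_inverse {T : Ser R n} (hT : OrdGE T 0) (hd : ∀ p, ent T p p = 1) :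
    ∃ S : Ser R n, S * T = 1 ∧ T * S = 1 := by
  have hn : (0 : ℤ) < n := by exact_mod_cast Nat.pos_of_neZero n
  let P : PowerSeries (Matrix (Fin n) (Fin n) R) := PowerSeries.mk fun m => T.coeff m
  have hP : HahnSeries.ofPowerSeries ℤ _ P = T := by
    ext1
    funext m
    rcases Int.lt_or_le m 0 with hm | hm
    · rw [coeff_eq_zero_of_ordGE hT]
      · rw [HahnSeries.ofPowerSeries_apply, HahnSeries.embDomain_of_notMem_range]
        rintro ⟨k, hk⟩
        simp at hk
        omega
      · have : (n : ℤ) * m ≤ n * (-1) := mul_le_mul_of_nonneg_left (by omega) hn.le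
        omega
    · obtain ⟨k, rfl⟩ := Int.eq_ofNat_of_zero_le hm
      rw [HahnSeries.ofPowerSeries_apply_coeff, PowerSeries.coeff_mk]
  have hdet : (T.coeff 0).det = 1 := by
    rw [Matrix.det_of_isUpperTriangular]
    · refine Finset.prod_eq_one fun r _ => ?_
      rw [coeff_eq_ent, mul_zero, add_zero, hd]
    · intro r c hrc
      rw [coeff_eq_ent]
      exact hT _ _ (by have : (c : ℕ) < r := hrc; omega)
  have hu : IsUnit (T.coeff 0) := by
    rw [Matrix.isUnit_iff_isUnit_det, hdet]; exact isUnit_one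
  obtain ⟨u, hu⟩ := hu
  have hc : PowerSeries.constantCoeff P = u := by
    rw [hu, ← PowerSeries.coeff_zero_eq_constantCoeff_apply, PowerSeries.coeff_mk, Nat.cast_zero]
  refine ⟨HahnSeries.ofPowerSeries ℤ _ (PowerSeries.invOfUnit P u), ?_, ?_⟩
  · rw [← hP, ← map_mul, PowerSeries.invOfUnit_mul P u hc, map_one]
  · rw [← hP, ← map_mul, PowerSeries.mul_invOfUnit P u hc, map_one]

/-- Each row of `S` starts somewhere because `S` is bounded below. Since `T` is unitriangular, the
first nonzero entry of a row of `S` survives in the same row of `S T = 1`, so it is the diagonal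
entry and equals `1`. -/
theorem inverse_ordGE {S T : Ser R n} (hT : OrdGE T 0) (hd : ∀ p, ent T p p = 1)
    (h : S * T = 1) : OrdGE S 0 ∧ ∀ p, ent S p p = 1 := by
  obtain ⟨d, hS⟩ := exists_ordGE S
  have red : ∀ p q, (∀ l, l < q → ent S p l = 0) → ent S p q = if p = q then 1 else 0 := by
    intro p q hl
    rw [← ent_one (R := R) (n := n), ← h, ent_mul_finsum, finsum_eq_single _ q, hd, mul_one]
    intro l hlq
    rcases lt_or_gt_of_ne hlq with h1 | h1
    · rw [hl l h1, zero_mul]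
    · rw [hT l q (by omega), mul_zero]
  have key : ∀ (k : ℕ) (p q : ℤ), q < p + d + k → q < p → ent S p q = 0 := by
    intro k
    induction k with
    | zero => intro p q h1 _; exact hS p q (by omega)
    | succ k ih =>
      intro p q h1 h2
      rw [red p q fun l hl => ih p l (by push_cast at h1; omega) (by omega), if_neg (by omega)]
  have h0 : ∀ p q : ℤ, q < p → ent S p q = 0 := fun p q h1 =>
    key (q - p - d + 1).toNat p q (by omega) h1
  exact ⟨fun p q h1 => h0 p q (by omega), fun p => by
    rw [red p p fun l hl => h0 p l hl, if_pos rfl]⟩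

end Dressing

/-! ### The resolvent `Y = T⁻¹ J T` -/

/-- Here `Td` and `Sd` stand for the derivatives of `T` and of `S = T⁻¹`. The hypothesis on `T W`
says `∂ + W = S (∂ + G) T`, so `S J T` commutes with `∂ + W` because the constant `J` commutes with
`∂ + G`. -/
theorem conj_covariant {A : Type*} [Ring A] {S T W G J Td Sd : A} (hST : S * T = 1)
    (hTS : T * S = 1) (hSd : Sd = -(S * Td * S)) (hT : T * W = Td + G * T) (hG : G * J = J * G) :
    Sd * J * T + S * J * Td + (W * (S * J * T) - S * J * T * W) = 0 := by
  have hW : W = S * Td + S * (G * T) := by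
    rw [← mul_add, ← hT, ← mul_assoc, hST, one_mul]
  have h1 : W * (S * J * T) = S * Td * S * J * T + S * J * G * T := by
    calc W * (S * J * T) = S * Td * S * J * T + S * (G * (T * S) * J) * T := by
          rw [hW]; noncomm_ring
      _ = _ := by rw [hTS, mul_one, hG]; noncomm_ring
  have h2 : S * J * T * W = S * J * Td + S * J * G * T := by
    rw [mul_assoc, hT]; noncomm_ring
  rw [h1, h2, hSd]; noncomm_ring

/-- The transport in the other direction, with `T' = T A - B T` and `Y' = Y A - A Y` already
substituted: if `Y` commutes with `∂ + A`, then `T Y S` commutes with `∂ + B`. -/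
theorem conj_covariant' {M : Type*} [Ring M] {S T Y A B : M} (hST : S * T = 1) (hTS : T * S = 1) :
    ((T * A - B * T) * Y + T * (Y * A - A * Y)) * S + T * Y * -(S * (T * A - B * T) * S) +
      (B * (T * Y * S) - T * Y * S * B) = 0 := by
  have h : S * (T * A - B * T) * S = A * S - S * B := by
    calc S * (T * A - B * T) * S = S * T * (A * S) - S * B * (T * S) := by
          simp only [mul_sub, sub_mul, mul_assoc]
      _ = _ := by rw [hST, hTS, one_mul, mul_one]
  rw [h]
  simp only [mul_sub, sub_mul, mul_neg, add_mul, ← mul_assoc]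
  abel

/-- The hypothesis is the differentiated dressing equation with `A T` for the variation of `T` and
`T L - B T` for its `x`-derivative. The terms `A T L` cancel, and multiplying by `S X` on the right
removes `T`. -/
theorem variation_aux {M : Type*} [Ring M] {A B F L S T V X dA : M} (hTS : T * S = 1)
    (e : A * T * L + T * V - (dA * T + A * (T * L - B * T)) = F * T + B * (A * T)) :
    T * V * S * X - dA * X + A * B * X = F * X + B * A * X := by
  have e1 : (T * V - dA * T + A * B * T) = F * T + B * A * T := by
    rw [mul_assoc B, ← e]
    simp only [mul_sub, ← mul_assoc]
    abel
  have e2 := congrArg (fun Z => Z * S * X) e1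
  have l : ∀ Z : M, Z * T * S = Z := fun Z => by rw [mul_assoc, hTS, mul_one]
  simpa only [add_mul, sub_mul, l] using e2

section Resolvent

variable {R : Type*} [CommRing R] [Algebra ℝ R] {n : ℕ} [NeZero n]

theorem serD_inverse (D : Derivation ℝ R R) {S T : Ser R n} (hST : S * T = 1) (hTS : T * S = 1) :
    serD D S = -(S * serD D T * S) := by
  have h := serD_mul D S T
  rw [hST, serD_one] at h
  have h2 : serD D S * T * S = serD D S := by rw [mul_assoc, hTS, mul_one]
  rw [← h2, eq_neg_iff_add_eq_zero, ← add_mul, ← h, zero_mul]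

theorem conj_pow (S T : Ser R n) (hST : S * T = 1) (hTS : T * S = 1) (Z : Ser R n) (j : ℕ) :
    (S * Z * T) ^ j = S * Z ^ j * T := by
  induction j with
  | zero => simp [hST]
  | succ j ih =>
    calc (S * Z * T) ^ (j + 1) = S * Z ^ j * (T * S) * Z * T := by
          rw [pow_succ, ih]; noncomm_ring
      _ = _ := by rw [hTS, pow_succ]; noncomm_ring

/-- `[∂ + J + V, Y] = 0`. -/
def IsCovConst (D : Derivation ℝ R R) (V Y : Ser R n) : Prop :=
  serD D Y + ((serJ R n + V) * Y - Y * (serJ R n + V)) = 0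

theorem resolvent_comm {D : Derivation ℝ R R} {V S T : Ser R n} {f : ℕ → R}
    (h : IsDress D V T f) (hST : S * T = 1) (hTS : T * S = 1) :
    IsCovConst D V (S * serJ R n * T) := by
  rw [IsCovConst]
  rw [serD_mul, serD_mul, serD_serJ, mul_zero, add_zero]
  refine conj_covariant hST hTS (serD_inverse D hST hTS) (G := serJ R n + serTail f) ?_ ?_
  · rw [← h.eq]; abel
  · rw [add_mul, mul_add, (serJ_commute_serTail f).eq]

theorem resolvent_pow_n {S T : Ser R n} (hST : S * T = 1) (hTS : T * S = 1) :
    (S * serJ R n * T) ^ n = HahnSeries.single (-1) 1 := by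
  have hc : Commute (HahnSeries.single (-1) 1 : Ser R n) S := by
    refine HahnSeries.ext (funext fun m => ?_)
    rw [HahnSeries.coeff_single_mul, HahnSeries.coeff_mul_single, one_mul, mul_one]
  rw [conj_pow S T hST hTS, serJ_pow_n, ← hc.eq, mul_assoc, hST, mul_one]

theorem ordGE_conj {S T Z : Ser R n} {d : ℤ} (hS : OrdGE S 0) (hT : OrdGE T 0) (hZ : OrdGE Z d) :
    OrdGE (S * Z * T) d := by
  have := (hS.mul hZ).mul hT
  rwa [zero_add, add_zero] at this

theorem ent_conj_lead {S T Z : Ser R n} {d : ℤ} (hS : OrdGE S 0) (hT : OrdGE T 0)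
    (hS1 : ∀ p, ent S p p = 1) (hT1 : ∀ p, ent T p p = 1) (hZ : OrdGE Z d) (p : ℤ) :
    ent (S * Z * T) p (p + d) = ent Z p (p + d) := by
  have h1 := ent_mul_lead (hS.mul hZ) hT p
  have h2 := ent_mul_lead hS hZ p
  simp only [zero_add, add_zero] at h1 h2
  rw [h1, h2, hT1, hS1, mul_one, one_mul]

theorem trace_coeff_conj {S T : Ser R n} (hTS : T * S = 1) (Z : Ser R n) (m : ℤ) :
    ((S * Z * T).coeff m).trace = (Z.coeff m).trace := by
  rw [mul_assoc, trace_coeff_mul_comm, mul_assoc, hTS, mul_one]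

theorem eq_zero_of_nsmul {x : R} (h : n • x = 0) : x = 0 := by
  rw [← Nat.cast_smul_eq_nsmul ℝ] at h
  have h1 := congrArg (fun z : R => (n : ℝ)⁻¹ • z) h
  simpa only [smul_smul, inv_mul_cancel₀ (Nat.cast_ne_zero.2 (NeZero.ne n) : (n : ℝ) ≠ 0),
    one_smul, smul_zero] using h1

/-- Series commuting with `∂ + J + ∑ f_i J^{-i}` are constant along diagonals. -/
theorem toeplitz_of_comm {D : Derivation ℝ R R} {f : ℕ → R} {W : Ser R n}
    (h : serD D W + ((serJ R n + serTail f) * W - W * (serJ R n + serTail f)) = 0) (d : ℤ) :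
    ∃ c, D c = 0 ∧ ∀ p, ent W p (p + d) = c := by
  obtain ⟨d0, hd0⟩ := exists_ordGE W
  have eqn : ∀ p q, D (ent W p q) + ent W (p - 1) q + ent (serTail f * W) p q - ent W p (q + 1)
      - ent (W * serTail f) p q = 0 := fun p q => by
    have := congrArg (fun Z => ent Z p q) h
    simp only [add_mul, mul_add, ent_add, ent_sub, ent_serJ_mul, ent_mul_serJ, ent_serD,
      ent_zero] at this
    rw [← this]; ring
  -- On a diagonal up to which `W` is constant along diagonals, `W` behaves as a Toeplitz matrix;
  -- the reflection `l ↦ 2 p + e - l` then exchanges the two products with the tail.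
  have comm : ∀ e : ℤ, (∀ d ≤ e, ∃ c, ∀ p, ent W p (p + d) = c) →
      ∀ p, ent (serTail f * W) p (p + e) = ent (W * serTail f) p (p + e) := fun e he p => by
    rw [ent_mul_finsum, ent_mul_finsum, ← finsum_comp_equiv (Equiv.subLeft (2 * p + e))]
    refine finsum_congr fun l => ?_
    rw [Equiv.subLeft_apply, ent_serTail, ent_serTail]
    by_cases hl : l ≤ p + e
    · rw [if_pos (by omega), if_pos hl, show 2 * p + e - l - p = p + e - l by ring, mul_comm]
      obtain ⟨c, hc⟩ := he (l - p) (by omega)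
      have h1 := hc p
      have h2 := hc (2 * p + e - l)
      rw [show p + (l - p) = l by ring] at h1
      rw [show 2 * p + e - l + (l - p) = p + e by ring] at h2
      rw [h1, h2]
    · rw [if_neg (by omega), if_neg hl, zero_mul, mul_zero]
  have key : ∀ (k : ℕ) (d : ℤ), d < d0 + k → ∃ c, D c = 0 ∧ ∀ p, ent W p (p + d) = c := by
    intro k
    induction k with
    | zero => exact fun d hd => ⟨0, map_zero D, fun p => hd0 _ _ (by omega)⟩
    | succ k ih =>
      intro d hd
      by_cases hdk : d < d0 + k
      · exact ih d hdk
      have low : ∀ e ≤ d - 1, ∃ c, D c = 0 ∧ ∀ p, ent W p (p + e) = c :=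
        fun e he => ih e (by push_cast at hd; omega)
      -- On the diagonal `d - 1` the commutator with the tail and the derivative both vanish, so the
      -- commutator with `J` does too: the diagonal `d` is constant.
      have const : ∀ p, ent W p (p + d) = ent W (p - 1) (p - 1 + d) := fun p => by
        obtain ⟨c, hc0, hc⟩ := low (d - 1) le_rfl
        have e := eqn p (p + (d - 1))
        rw [comm _ (fun d hd => (low d hd).imp fun _ h => h.2), hc, hc0, show p + (d - 1) + 1 = p + d by ring,
          show p + (d - 1) = p - 1 + d by ring] at e
        linear_combination -e
      have hcst : ∀ p, ent W p (p + d) = ent W 0 (0 + d) := fun p =>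
        const_of_sub_one (g := fun p => ent W p (p + d)) const p 0
      refine ⟨_, eq_zero_of_nsmul (n := n) ?_, hcst⟩
      -- The equation on the diagonal `d` expresses the derivative of its constant as a difference
      -- along the diagonal `d + 1`. Such differences sum to zero over a period, so `n` times the
      -- derivative vanishes.
      have step : ∀ p, ent W p (p + (d + 1)) - ent W (p - 1) (p - 1 + (d + 1)) =
          D (ent W 0 (0 + d)) := fun p => by
        have e := eqn p (p + d)
        rw [comm d (fun e he => ?_), hcst] at e
        · rw [← add_assoc, show p - 1 + (d + 1) = p + d by ring]
          linear_combination -e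
        · rcases lt_or_eq_of_le he with h1 | rfl
          · exact (low e (by omega)).imp fun _ h => h.2
          · exact ⟨_, hcst⟩
      have h0 := windowSum_sub_shift (n := n) (a := fun p => ent W p (p + (d + 1))) (fun p => by
        have := ent_shift W p (p + (d + 1)) 1
        rw [mul_one] at this
        rw [add_right_comm, this]) 0
      simpa only [windowSum, step, Finset.sum_const, Finset.card_range] using h0
  exact key (d - d0 + 1).toNat d (by omega)

theorem conj_conj {S T : Ser R n} (hST : S * T = 1) (Y : Ser R n) :
    S * (T * Y * S) * T = Y := by
  calc S * (T * Y * S) * T = (S * T) * Y * (S * T) := by noncomm_ring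
    _ = Y := by rw [hST, one_mul, mul_one]

theorem ent_pow_lead {W : Ser R n} {d : ℤ} {c : R} (hW : OrdGE W d)
    (hc : ∀ p, ent W p (p + d) = c) (j : ℕ) :
    OrdGE (W ^ j) (j * d) ∧ ∀ p, ent (W ^ j) p (p + j * d) = c ^ j := by
  induction j with
  | zero =>
    refine ⟨fun p q h => ?_, fun p => ?_⟩
    · rw [pow_zero, ent_one, if_neg (by simp at h; omega)]
    · rw [pow_zero, ent_one, if_pos (by simp), pow_zero]
  | succ j ih =>
    have e : ((j + 1 : ℕ) : ℤ) * d = j * d + d := by push_cast; ring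
    rw [e, pow_succ]
    refine ⟨ih.1.mul hW, fun p => ?_⟩
    rw [← add_assoc, ent_mul_lead ih.1 hW, ih.2, hc, pow_succ]

/-- A Toeplitz series with `W^n = λ` and leading coefficient `1` is `J`. -/
theorem eq_serJ_of_pow [IsReduced R] {W : Ser R n} (hW : ∀ d, ∃ c, ∀ p, ent W p (p + d) = c)
    (hn : W ^ n = serJ R n ^ n) (h1 : OrdGE W (-1) → ∀ p, ent W p (p + -1) = 1) :
    W = serJ R n := by
  have hn1 : 1 ≤ n := Nat.pos_of_neZero n
  -- If the lowest diagonal of `W` is `d < -1` with constant `c`, then `c ^ n` stands on the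
  -- diagonal `n d < -n` of `W ^ n = J ^ n`, where `J ^ n` vanishes; as the ring is reduced, `c =
  -- 0`.
  have hord : OrdGE W (-1) := by
    obtain ⟨d0, hd0⟩ := exists_ordGE W
    have key : ∀ k : ℕ, d0 + k ≤ -1 → OrdGE W (d0 + k) := by
      intro k
      induction k with
      | zero => intro _; simpa using hd0
      | succ k ih =>
        intro hk
        push_cast at hk
        have hW0 := ih (by omega)
        obtain ⟨c, hc⟩ := hW (d0 + k)
        have hl := (ent_pow_lead hW0 hc n).2 0
        rw [hn, ent_serJ_pow, if_neg] at hl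
        · have hc0 : c = 0 := pow_eq_zero_iff (NeZero.ne n) |>.1 hl.symm
          intro p q hpq
          push_cast at hpq
          rcases lt_or_eq_of_le (show q ≤ p + (d0 + k) by omega) with h | h
          · exact hW0 p q h
          · rw [h, hc, hc0]
        · have : (n : ℤ) * (d0 + k) ≤ n * (-2) := mul_le_mul_of_nonneg_left (by omega) (by omega)
          omega
    by_cases h : d0 ≤ -1
    · have := key (-1 - d0).toNat (by omega)
      rwa [show d0 + ((-1 - d0).toNat : ℤ) = -1 by omega] at this
    · exact hd0.mono (by omega)
  have hlead := h1 hord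
  have hcomm : Commute W (serJ R n) := by
    refine ser_ext fun p q => ?_
    rw [ent_mul_serJ, ent_serJ_mul]
    obtain ⟨c, hc⟩ := hW (q + 1 - p)
    have e1 := hc p
    have e2 := hc (p - 1)
    rw [show p + (q + 1 - p) = q + 1 by ring] at e1
    rw [show p - 1 + (q + 1 - p) = q by ring] at e2
    rw [e1, e2]
  -- Factor `0 = W ^ n - J ^ n = (W - J) G`. All `n` summands of `G` have leading coefficient `1`,
  -- so the leading coefficient of `G` is `n`, which can be cancelled.
  have hprod := hcomm.mul_geom_sum₂ n
  rw [hn, sub_self] at hprod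
  have hJl : ∀ p, ent (serJ R n) p (p + -1) = 1 := fun p => by rw [ent_serJ, if_pos (by omega)]
  have hterm : ∀ i ∈ Finset.range n, OrdGE (W ^ i * serJ R n ^ (n - 1 - i)) (-((n : ℤ) - 1)) ∧
      ∀ p, ent (W ^ i * serJ R n ^ (n - 1 - i)) p (p + -((n : ℤ) - 1)) = 1 := fun i hi => by
    rw [Finset.mem_range] at hi
    obtain ⟨a1, a2⟩ := ent_pow_lead hord hlead i
    obtain ⟨b1, b2⟩ := ent_pow_lead ordGE_serJ hJl (n - 1 - i)
    have e : -((n : ℤ) - 1) = (i : ℤ) * -1 + ((n - 1 - i : ℕ) : ℤ) * -1 := by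
      rw [Nat.sub_sub, Nat.cast_sub (by omega)]; push_cast; ring
    rw [e]
    refine ⟨a1.mul b1, fun p => ?_⟩
    rw [← add_assoc, ent_mul_lead a1 b1, a2, b2, one_pow, one_pow, one_mul]
  have ent_sum : ∀ (s : Finset ℕ) (g : ℕ → Ser R n) (p q : ℤ),
      ent (∑ i ∈ s, g i) p q = ∑ i ∈ s, ent (g i) p q := fun s g p q => by
    induction s using Finset.cons_induction with
    | empty => rfl
    | cons i s hi ih => rw [Finset.sum_cons, Finset.sum_cons, ent_add, ih]
  set G := ∑ i ∈ Finset.range n, W ^ i * serJ R n ^ (n - 1 - i)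
  have hG : OrdGE G (-((n : ℤ) - 1)) := fun p q h => by
    rw [ent_sum]
    exact Finset.sum_eq_zero fun i hi => (hterm i hi).1 p q h
  have hG1 : ∀ p, ent G p (p + -((n : ℤ) - 1)) = n := fun p => by
    rw [ent_sum, Finset.sum_congr rfl fun i hi => (hterm i hi).2 p]
    simp
  -- The lowest diagonal of `W - J` times `n` is the lowest diagonal of `(W - J) G = 0`, so the
  -- diagonals vanish one after the other.
  have key : ∀ k : ℕ, OrdGE (W - serJ R n) (-1 + k) := by
    intro k
    induction k with
    | zero =>
      intro p q h
      rw [ent_sub, hord p q (by simpa using h), ordGE_serJ p q (by simpa using h), sub_zero]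
    | succ k ih =>
      intro p q h
      push_cast at h
      rcases lt_or_eq_of_le (show q ≤ p + (-1 + k) by omega) with h' | h'
      · exact ih p q h'
      · have hl := ent_mul_lead ih hG p
        rw [hprod, ent_zero, hG1, mul_comm, ← nsmul_eq_mul] at hl
        rw [h']
        exact eq_zero_of_nsmul hl.symm
  rw [← sub_eq_zero]
  refine ser_ext fun p q => ?_
  rw [ent_zero]
  exact key (q - p + 2).toNat p q (by omega)

theorem IsCovConst.pow {D : Derivation ℝ R R} {V Y : Ser R n} (h : IsCovConst D V Y) (j : ℕ) :
    IsCovConst D V (Y ^ j) := by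
  rw [IsCovConst] at *
  induction j with
  | zero => rw [pow_zero, serD_one, mul_one, one_mul, sub_self, add_zero]
  | succ j ih =>
    rw [pow_succ, serD_mul]
    calc _ = (serD D (Y ^ j) + ((serJ R n + V) * Y ^ j - Y ^ j * (serJ R n + V))) * Y +
          Y ^ j * (serD D Y + ((serJ R n + V) * Y - Y * (serJ R n + V))) := by
            simp only [add_mul, mul_add, mul_sub, sub_mul, ← mul_assoc]
            abel
      _ = 0 := by rw [ih, h, zero_mul, mul_zero, add_zero]

/-- `[∂ + M, C] = D C + M C - C M`. -/
def covDer (D : Derivation ℝ R R) (M C : Matrix (Fin n) (Fin n) R) : Matrix (Fin n) (Fin n) R :=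
  matD D C + (M * C - C * M)

/-- In the `λ^0`-coefficient of `[∂ + J + u, Y ^ j] = 0` the term `e_{1n} λ` meets the
`λ^{-1}`-coefficient of `Y ^ j`, which is the `λ^0`-coefficient of `Y ^ (n + j) = λ Y ^ j`. This
links the two Poisson structures. -/
theorem IsCovConst.covDer_coeff {D : Derivation ℝ R R} {u : Matrix (Fin n) (Fin n) R} {Y : Ser R n}
    (h : IsCovConst D (HahnSeries.single 0 u) Y) (hn : Y ^ n = HahnSeries.single (-1) 1) (j : ℕ) :
    covDer D (lowerShift R n + u) ((Y ^ j).coeff 0) +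
      (cornerMat R n * (Y ^ (n + j)).coeff 0 - (Y ^ (n + j)).coeff 0 * cornerMat R n) = 0 := by
  have hj := congrArg (fun Z : Ser R n => Z.coeff 0) (h.pow j)
  have hY1 : (Y ^ (n + j)).coeff 0 = (Y ^ j).coeff 1 := by
    rw [pow_add, hn, HahnSeries.coeff_single_mul, one_mul]; rfl
  have hD : (serD D (Y ^ j)).coeff 0 = matD D ((Y ^ j).coeff 0) := rfl
  simp only [add_mul, mul_add, HahnSeries.coeff_add, HahnSeries.coeff_sub, serJ,
    HahnSeries.coeff_single_mul, HahnSeries.coeff_mul_single, hD, sub_zero, zero_sub, neg_neg,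
    HahnSeries.coeff_zero] at hj
  rw [hY1, covDer, ← hj, add_mul, mul_add]
  abel

/-- The resolvent is unique. -/
theorem resolvent_unique [IsReduced R] {D : Derivation ℝ R R} {V S T Y : Ser R n} {f : ℕ → R}
    (h : IsDress D V T f) (hST : S * T = 1) (hTS : T * S = 1)
    (hYn : Y ^ n = HahnSeries.single (-1) 1)
    (hlead : OrdGE Y (-1) → ∃ p, ent Y p (p + -1) = 1)
    (hY : IsCovConst D V Y) : Y = S * serJ R n * T := by
  obtain ⟨hS, hS1⟩ := inverse_ordGE h.ord h.diag hST
  -- Conjugation by `T` turns `Y` into a series commuting with `∂ + J + ∑ f_i J^{-i}`; such a series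
  -- is constant along diagonals, and it will be identified with `J`.
  have hW : serD D (T * Y * S) + ((serJ R n + serTail f) * (T * Y * S) -
      T * Y * S * (serJ R n + serTail f)) = 0 := by
    have hdT : serD D T = T * (serJ R n + V) - (serJ R n + serTail f) * T := by rw [← h.eq]; abel
    have hdY : serD D Y = Y * (serJ R n + V) - (serJ R n + V) * Y := by
      rw [← sub_eq_zero, ← show _ = _ from hY]; abel
    rw [serD_mul, serD_mul, serD_inverse D hST hTS, hdT, hdY]
    generalize serJ R n + V = A
    generalize serJ R n + serTail f = B
    exact conj_covariant' hST hTS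
  have ht := toeplitz_of_comm hW
  have hT1 := h.diag
  rw [← conj_conj hST Y, eq_serJ_of_pow (fun d => (ht d).imp fun _ h => h.2)]
  · rw [conj_pow T S hTS hST, hYn, serJ_pow_n, ← serJ_pow_n]
    have hc : Commute (serJ R n ^ n) S := by
      rw [serJ_pow_n]
      refine HahnSeries.ext (funext fun m => ?_)
      rw [HahnSeries.coeff_single_mul, HahnSeries.coeff_mul_single, one_mul, mul_one]
    rw [mul_assoc, hc.eq, ← mul_assoc, hTS, one_mul]
  · intro hord
    have hY1 : OrdGE Y (-1) := by
      rw [← conj_conj hST Y]; exact ordGE_conj hS h.ord hord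
    obtain ⟨p0, hp0⟩ := hlead hY1
    obtain ⟨c, -, hc⟩ := ht (-1)
    have := ent_conj_lead hS h.ord hS1 hT1 hord p0
    rw [conj_conj hST, hp0, hc] at this
    intro p
    rw [hc, this]

/-- The first variation of the coefficients `f_j`. -/
theorem variation {D E : Derivation ℝ R R} (hDE : ∀ r, D (E r) = E (D r)) {V S T : Ser R n}
    {f : ℕ → R} (h : IsDress D V T f) (hST : S * T = 1) (hTS : T * S = 1) (j : ℕ) :
    n • E (f j) = ((serD E V * (S * serJ R n * T) ^ j).coeff 0).trace -
      D ((serD E T * S * serJ R n ^ j).coeff 0).trace := by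
  -- The logarithmic variation of `T`. In terms of `A` the differentiated dressing equation says `T
  -- (E V) S - D A = E (∑ f_i J^{-i}) + [B, A]` with `B = J + ∑ f_i J^{-i}`.
  set A := serD E T * S with hA
  have hET : serD E T = A * T := by rw [hA, mul_assoc, hST, mul_one]
  have hDT : serD D T = T * (serJ R n + V) - (serJ R n + serTail f) * T := by rw [← h.eq]; abel
  have e := congrArg (serD E) h.eq
  rw [serD_sub, serD_mul, serD_mul, serD_add, serD_add, serD_serJ, zero_add, zero_add,
    ← serD_comm hDE, hET, serD_mul, hDT, serD_serTail] at e
  generalize hB : serJ R n + serTail f = B at e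
  have hBJ : Commute B (serJ R n ^ j) := by
    rw [← hB]
    exact ((Commute.refl _).add_left (serJ_commute_serTail f).symm).pow_right j
  set X := serJ R n ^ j with hX
  have e2 : T * serD E V * S * X - serD D A * X + A * B * X =
      serTail (fun i => E (f i)) * X + B * A * X := by
    exact variation_aux hTS e
  have e3 := congrArg (fun Z : Ser R n => (Z.coeff 0).trace) e2
  simp only [HahnSeries.coeff_add, HahnSeries.coeff_sub, Matrix.trace_add, Matrix.trace_sub] at e3
  -- As `B` commutes with `J ^ j`, cyclicity of the trace removes the commutator `[B, A]`.
  have t1 : ((A * B * X).coeff 0).trace = ((B * A * X).coeff 0).trace := by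
    rw [mul_assoc, hBJ.eq, ← mul_assoc, trace_coeff_mul_comm, ← mul_assoc]
  have t2 : ((T * serD E V * S * X).coeff 0).trace =
      ((serD E V * (S * serJ R n * T) ^ j).coeff 0).trace := by
    rw [conj_pow S T hST hTS, mul_assoc, mul_assoc, trace_coeff_mul_comm]
    congr 2; noncomm_ring
  have t3 : serD D A * X = serD D (A * X) := by
    rw [serD_mul D A X, hX, serD_serJ_pow, mul_zero, add_zero]
  -- Multiplication by `J ^ j` moves the `j`-th diagonal to the main one, whose `n` entries over a
  -- period are all `E (f_j)`.
  have t4 : ((serTail (fun i => E (f i)) * X : Ser R n).coeff 0).trace = n • E (f j) := by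
    rw [trace_coeff_eq]
    simp only [hX, ent_mul_serJ_pow, mul_zero, add_zero, ent_serTail]
    rw [Finset.sum_congr rfl fun r _ => by
      rw [if_pos (by omega), add_sub_cancel_left, Int.toNat_natCast]]
    simp
  rw [t1, t2, t3, t4, trace_serD_coeff] at e3
  linear_combination -e3

end Resolvent

/-! ### Existence and uniqueness of `Y(u, λ)`, `T` and `f_i(u)` -/

theorem Loop.differentiable (f : Loop) : Differentiable ℝ f.1 := f.2.1.differentiable (by simp)

/-- The derivative `f ↦ f_x` as a derivation. -/
def dxD : Derivation ℝ Loop Loop :=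
  Derivation.mk' dx fun a b => Subtype.ext <| funext fun x => by
    change deriv (a.1 * b.1) x = a.1 x * deriv b.1 x + b.1 x * deriv a.1 x
    rw [deriv_mul (a.differentiable x) (b.differentiable x)]
    ring

/-- Loops have zero divisors, but reducedness is all that is needed to pass from `c ^ n = 0` to `c =
0` in the uniqueness of the resolvent. -/
instance : IsReduced Loop where
  eq_zero f hf := by
    obtain ⟨k, hk⟩ := hf
    refine Subtype.ext (funext fun x => ?_)
    have h : f.1 x ^ k = 0 := congrFun (congrArg Subtype.val hk) x
    exact eq_zero_of_pow_eq_zero h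

section Potential

variable {R : Type*} [CommRing R] {n : ℕ}

/-- Matrices in `V_n`. -/
def IsVMat (M : Matrix (Fin n) (Fin n) R) : Prop :=
  ∀ i j : Fin n, ¬ ((i : ℕ) + 1 < n ∧ (j : ℕ) + 1 = n) → M i j = 0

theorem IsVMat.ordGE_single [NeZero n] {u : Matrix (Fin n) (Fin n) R} (hu : IsVMat u) :
    OrdGE (HahnSeries.single 0 u : Ser R n) 0 := by
  intro p q h
  rw [ent_single_zero]
  split_ifs with hb
  · refine hu _ _ fun h' => ?_
    have h1 := res_add_ediv (n := n) p
    have h2 := res_add_ediv (n := n) q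
    rw [hb] at h2
    omega
  · rfl

end Potential

section Transfer

variable {n : ℕ} [NeZero n]

theorem JInv_eq : JInv n = serJInv Loop n := rfl

/-- `J^{-i}` is the shift `q = p + i`, so at most one index contributes to the entry `(r, c + n k)`,
namely `i = c + n k - r`. It is less than `n (k + 1)`, so the truncation of the sum loses nothing.
-/
theorem JTail_eq (f : ℕ → Loop) : JTail n f = serTail f := by
  have hn : (0 : ℤ) < n := by exact_mod_cast Nat.pos_of_neZero n
  ext1
  funext m
  rcases Int.lt_or_le m 0 with hm | hm
  · rw [coeff_eq_zero_of_ordGE (ordGE_serTail f)]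
    · rw [JTail, HahnSeries.ofPowerSeries_apply, HahnSeries.embDomain_of_notMem_range]
      rintro ⟨k, hk⟩
      simp at hk
      omega
    · have : (n : ℤ) * m ≤ n * (-1) := mul_le_mul_of_nonneg_left (by omega) hn.le
      omega
  · obtain ⟨k, rfl⟩ := Int.eq_ofNat_of_zero_le hm
    rw [JTail, HahnSeries.ofPowerSeries_apply_coeff, PowerSeries.coeff_mk, JInv_eq]
    ext1 r c
    rw [coeff_eq_ent, ent_serTail, Matrix.sum_apply]
    have e : ∀ i : ℕ, (f i • lamCoeff (serJInv Loop n ^ i) (-(k : ℤ))) r c =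
        if (((c : ℕ) : ℤ) + n * k = (r : ℕ) + i) then f i else 0 := fun i => by
      rw [Matrix.smul_apply, lamCoeff, neg_neg, coeff_eq_ent, ent_serJInv_pow]
      split_ifs <;> simp
    rw [Finset.sum_congr rfl fun i _ => e i]
    have hc := c.2
    have hnk : n * (k + 1) = n * k + n := by ring
    split_ifs with h
    · rw [Finset.sum_eq_single (((c : ℕ) : ℤ) + n * k - (r : ℕ)).toNat, if_pos (by omega)]
      · intro i _ hi
        rw [if_neg (by omega)]
      · intro hi
        exfalso
        apply hi
        rw [Finset.mem_range]
        zify at hnk ⊢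
        omega
    · refine Finset.sum_eq_zero fun i _ => if_neg ?_
      omega

theorem ordGE_potential (u : VLoop n) : OrdGE (HahnSeries.single 0 u.1 : LSer n) 0 :=
  IsVMat.ordGE_single u.2

/-- No positive powers of `λ` together with a unipotent upper triangular `T_0` means that the
infinite matrix is upper unitriangular. The first columns of the coefficients are the columns with
index divisible by `n`. -/
theorem isDressing_iff (u : VLoop n) (T : LSer n) (f : ℕ → Loop) :
    IsDressing u T f ↔ IsDress dxD (HahnSeries.single 0 u.1) T f := by
  have hn : (0 : ℤ) < n := by exact_mod_cast Nat.pos_of_neZero n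
  have heq : (T * (JSer n + lamMono 0 u.1) - sdx T = (JSer n + JTail n f) * T) ↔
      (T * (serJ Loop n + HahnSeries.single 0 u.1) - serD dxD T =
        (serJ Loop n + serTail f) * T) := by
    rw [JTail_eq]; rfl
  have hperiod : ∀ p q : ℤ, ent T p q =
      T.coeff (q / n - p / n) (res n p) (res n q) := fun p q => rfl
  constructor
  · rintro ⟨h1, ⟨h2, h3⟩, h4, h5⟩
    refine ⟨fun p q h => ?_, fun p => ?_, fun p q hq hpq => ?_, heq.1 h5⟩
    · rw [hperiod]
      have hp := res_add_ediv (n := n) p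
      have hq := res_add_ediv (n := n) q
      have := (res n p).2
      rcases lt_trichotomy (q / (n : ℤ)) (p / n) with hm | hm | hm
      · have := h1 (-(q / (n : ℤ) - p / n)) (by omega)
        rw [lamCoeff, neg_neg] at this
        rw [this]; rfl
      · have := h3 (res n p) (res n q) (by rw [Fin.lt_def]; rw [hm] at hq; omega)
        rw [lamCoeff, neg_zero] at this
        rw [hm, sub_self, this]
      · have h6 : (n : ℤ) * (p / n + 1) ≤ n * (q / n) :=
          mul_le_mul_of_nonneg_left (by omega) hn.le
        rw [mul_add] at h6
        omega
    · have := h2 (res n p)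
      rw [lamCoeff, neg_zero] at this
      rw [hperiod, sub_self, this]
    · have h0 : (res n q : ℕ) = 0 := by
        have := res_coe (n := n) q
        rw [Int.emod_eq_zero_of_dvd hq] at this
        omega
      have := h4 (-(q / (n : ℤ) - p / n)) (res n p) (res n q) h0
      rw [lamCoeff, neg_neg] at this
      rw [hperiod, this, if_neg]
      rintro ⟨h6, h7⟩
      have hp := res_add_ediv (n := n) p
      have hq := res_add_ediv (n := n) q
      rw [h7, show p / (n : ℤ) = q / n by omega] at hp
      omega
  · rintro ⟨h1, h2, h3, h4⟩
    refine ⟨fun i hi => ?_, ⟨fun r => ?_, fun r c h => ?_⟩, fun i r c hc => ?_, heq.2 h4⟩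
    · refine coeff_eq_zero_of_ordGE h1 ?_
      have : (n : ℤ) * (-i) ≤ n * (-1) := mul_le_mul_of_nonneg_left (by omega) hn.le
      omega
    · rw [lamCoeff, neg_zero, coeff_eq_ent, mul_zero, add_zero, h2]
    · rw [lamCoeff, neg_zero, coeff_eq_ent, mul_zero, add_zero, h1]
      rw [Fin.lt_def] at h
      omega
    · rw [lamCoeff, coeff_eq_ent]
      split_ifs with h
      · rw [h.1, h.2, neg_zero, mul_zero, add_zero, h2]
      · refine h3 _ _ ?_ ?_
        · rw [hc, Nat.cast_zero, zero_add]; exact dvd_mul_right _ _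
        · intro h5
          apply h
          rw [hc, Nat.cast_zero, zero_add] at h5
          have hr := r.2
          have hi : i = 0 := by
            by_contra hi
            rcases lt_or_gt_of_ne hi with h6 | h6
            · have : (n : ℤ) * 1 ≤ n * (-i) := mul_le_mul_of_nonneg_left (by omega) hn.le
              omega
            · have : (n : ℤ) * (-i) ≤ n * (-1) := mul_le_mul_of_nonneg_left (by omega) hn.le
              omega
          subst hi
          refine ⟨rfl, Fin.ext ?_⟩
          rw [neg_zero, mul_zero] at h5
          omega

theorem isCovConst_iff (u : VLoop n) (Y : LSer n) :
    sdx Y + ((JSer n + lamMono 0 u.1) * Y - Y * (JSer n + lamMono 0 u.1)) = 0 ↔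
      IsCovConst dxD (HahnSeries.single 0 u.1) Y := Iff.rfl

theorem existsUnique_isDressing (u : VLoop n) :
    ∃! p : LSer n × (ℕ → Loop), IsDressing u p.1 p.2 := by
  obtain ⟨T, f, h⟩ := exists_isDress dxD (ordGE_potential u)
  refine ⟨(T, f), (isDressing_iff u T f).2 h, ?_⟩
  rintro ⟨T', f'⟩ h'
  obtain ⟨h1, h2⟩ := ((isDressing_iff u T' f').1 h').unique (ordGE_potential u) h
  exact Prod.ext h1 h2

theorem fCoeff_eq {u : VLoop n} {T : LSer n} {f : ℕ → Loop}
    (h : IsDress dxD (HahnSeries.single 0 u.1) T f) : fCoeff u = f := by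
  have hex : ∃ p : LSer n × (ℕ → Loop), IsDressing u p.1 p.2 :=
    ⟨(T, f), (isDressing_iff u T f).2 h⟩
  rw [fCoeff, dif_pos hex]
  exact (((isDressing_iff u _ _).1 hex.choose_spec).unique (ordGE_potential u) h).2

theorem isResolvent_conj (hn : 2 ≤ n) {u : VLoop n} {S T : LSer n} {f : ℕ → Loop}
    (h : IsDress dxD (HahnSeries.single 0 u.1) T f) (hST : S * T = 1) (hTS : T * S = 1) :
    IsResolvent u (S * serJ Loop n * T) := by
  have hn0 : (0 : ℤ) < n := by omega
  obtain ⟨hS, hS1⟩ := inverse_ordGE h.ord h.diag hST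
  have hY := ordGE_conj hS h.ord (ordGE_serJ (R := Loop) (n := n))
  have hY1 := ent_conj_lead hS h.ord hS1 h.diag (ordGE_serJ (R := Loop) (n := n))
  refine ⟨fun i => ?_, fun i hi => ?_, ?_, ?_, ?_⟩
  · rw [lamCoeff, trace_coeff_conj hTS, ← pow_one (serJ Loop n), trace_coeff_serJ_pow]
    intro hd
    have := Nat.le_of_dvd one_pos hd
    omega
  · refine coeff_eq_zero_of_ordGE hY ?_
    have : (n : ℤ) * (-i) ≤ n * (-2) := mul_le_mul_of_nonneg_left (by omega) hn0.le
    omega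
  -- The `λ`-coefficient is the block of index `-1`. Its entry `(r, c - n)` lies below the diagonal
  -- `-1` except in the corner `r = 0`, `c = n - 1`, where it is the leading coefficient of `J`.
  · ext1 r c
    have hr := r.2
    have hc := c.2
    rw [lamCoeff, coeff_eq_ent]
    by_cases h1 : (r : ℕ) = 0 ∧ (c : ℕ) + 1 = n
    · have := hY1 (r : ℕ)
      rw [ent_serJ, if_pos (by omega)] at this
      rw [e1n, if_pos h1, ← this]
      congr 1
      omega
    · rw [e1n, if_neg h1]
      exact hY _ _ (by omega)
  · exact (isCovConst_iff u _).2 (resolvent_comm h hST hTS)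
  · exact resolvent_pow_n hST hTS

theorem IsResolvent.eq_conj {u : VLoop n} {Y S T : LSer n} {f : ℕ → Loop} (hY : IsResolvent u Y)
    (h : IsDress dxD (HahnSeries.single 0 u.1) T f) (hST : S * T = 1) (hTS : T * S = 1) :
    Y = S * serJ Loop n * T := by
  obtain ⟨-, -, h3, h4, h5⟩ := hY
  -- One entry of the leading diagonal suffices; the entry `(0, -1)` is the corner of the
  -- `λ`-coefficient `e_{1n}`.
  refine resolvent_unique h hST hTS h5 (fun _ => ⟨0, ?_⟩) ((isCovConst_iff u _).1 h4)
  have hr := res_add_mul (n := n) ⟨0, Nat.pos_of_neZero n⟩ 0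
  have hc := res_add_mul (n := n) ⟨n - 1, Nat.sub_lt (Nat.pos_of_neZero n) one_pos⟩ (-1)
  have hq := add_mul_ediv (n := n) ⟨n - 1, Nat.sub_lt (Nat.pos_of_neZero n) one_pos⟩ (-1)
  have e : (((⟨n - 1, Nat.sub_lt (Nat.pos_of_neZero n) one_pos⟩ : Fin n) : ℕ) : ℤ) + n * (-1)
      = 0 + -1 := by
    have := Nat.pos_of_neZero n
    simp only
    omega
  rw [e] at hc hq
  simp only [Nat.cast_zero, mul_zero, add_zero] at hr
  rw [ent, hc, hq, hr, Int.zero_ediv, sub_zero]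
  have := congrFun (congrFun h3 ⟨0, Nat.pos_of_neZero n⟩)
    ⟨n - 1, Nat.sub_lt (Nat.pos_of_neZero n) one_pos⟩
  rw [lamCoeff] at this
  rw [this, e1n, if_pos]
  have := Nat.pos_of_neZero n
  exact ⟨rfl, by simp only; omega⟩

theorem existsUnique_isResolvent (hn : 2 ≤ n) (u : VLoop n) : ∃! Y, IsResolvent u Y := by
  obtain ⟨T, f, h⟩ := exists_isDress dxD (ordGE_potential u)
  obtain ⟨S, hST, hTS⟩ := exists_inverse h.ord h.diag
  exact ⟨_, isResolvent_conj hn h hST hTS, fun Y hY => hY.eq_conj h hST hTS⟩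

theorem isResolvent_resolvent (hn : 2 ≤ n) (u : VLoop n) : IsResolvent u (resolvent u) := by
  have h := (existsUnique_isResolvent hn u).exists
  rw [resolvent, dif_pos h]
  exact h.choose_spec

theorem resolvent_eq (hn : 2 ≤ n) {u : VLoop n} {S T : LSer n} {f : ℕ → Loop}
    (h : IsDress dxD (HahnSeries.single 0 u.1) T f) (hST : S * T = 1) (hTS : T * S = 1) :
    resolvent u = S * serJ Loop n * T :=
  (isResolvent_resolvent hn u).eq_conj h hST hTS

theorem trace_Y0 (hn : 2 ≤ n) {j : ℕ} (hj : ¬ n ∣ j) (u : VLoop n) : (Y0 j u).trace = 0 := by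
  obtain ⟨T, f, h⟩ := exists_isDress dxD (ordGE_potential u)
  obtain ⟨S, hST, hTS⟩ := exists_inverse h.ord h.diag
  rw [Y0, resolvent_eq hn h hST hTS, conj_pow S T hST hTS, lamCoeff, trace_coeff_conj hTS,
    trace_coeff_serJ_pow hj]

/-- The `λ^0`-coefficient of `[∂_x + J + u, Y^j] = 0`. -/
theorem covD_Y0 (hn : 2 ≤ n) (j : ℕ) (u : VLoop n) :
    covD (bMat n + u.1) (Y0 j u) + (e1n n * Y0 (n + j) u - Y0 (n + j) u * e1n n) = 0 := by
  obtain ⟨-, -, -, h4, h5⟩ := isResolvent_resolvent hn u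
  exact ((isCovConst_iff u _).1 h4).covDer_coeff h5 j

end Transfer

/-! ### Matrices with `[∂_x + b + u, C] ∈ V_n` -/

/-- A triangular additive map with bijective diagonal coefficients is bijective. -/
theorem triangular_bijective {A : Type*} [AddCommGroup A] {n : ℕ}
    (Φ : (Fin n → A) →+ (Fin n → A)) (κ : Fin n → A → A) (hκ : ∀ m, Function.Bijective (κ m))
    (h : ∀ (m : Fin n) (c : Fin n → A), (∀ i, m < i → c i = 0) →
      (∀ i, m < i → Φ c i = 0) ∧ Φ c m = κ m (c m)) : Function.Bijective Φ := by
  have hκ0 : ∀ m, κ m 0 = 0 := fun m => by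
    have := (h m 0 fun _ _ => rfl).2
    rw [map_zero] at this
    exact this.symm
  constructor
  · rw [injective_iff_map_eq_zero]
    intro c hc
    have key : ∀ (k : ℕ) (i : Fin n), n ≤ i + k → c i = 0 := by
      intro k
      induction k with
      | zero => intro i hi; omega
      | succ k ih =>
        intro i hi
        have h1 := (h i c fun l hl => ih l (by rw [Fin.lt_def] at hl; omega)).2
        rw [hc, Pi.zero_apply, ← hκ0 i] at h1
        exact ((hκ i).1 h1).symm
    exact funext fun i => key n i (by omega)
  · have key : ∀ (k : ℕ) (w : Fin n → A), (∀ i : Fin n, k ≤ i → w i = 0) → ∃ c, Φ c = w := by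
      intro k
      induction k with
      | zero => intro w hw; exact ⟨0, by rw [map_zero]; exact funext fun i => (hw i (by omega)).symm⟩
      | succ k ih =>
        intro w hw
        by_cases hk : k < n
        · obtain ⟨x, hx⟩ := (hκ ⟨k, hk⟩).2 (w ⟨k, hk⟩)
          obtain ⟨h1, h2⟩ := h ⟨k, hk⟩ (Pi.single ⟨k, hk⟩ x) fun i hi => by
            rw [Pi.single_eq_of_ne hi.ne']
          rw [Pi.single_eq_same, hx] at h2
          obtain ⟨c, hc⟩ := ih (w - Φ (Pi.single ⟨k, hk⟩ x)) fun i hi => by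
            rw [Pi.sub_apply]
            rcases Nat.lt_or_eq_of_le hi with h3 | h3
            · rw [hw i h3, h1 i (Fin.lt_def.2 h3), sub_zero]
            · obtain rfl : i = ⟨k, hk⟩ := Fin.ext h3.symm
              rw [h2, sub_self]
          exact ⟨c + Pi.single ⟨k, hk⟩ x, by rw [map_add, hc, sub_add_cancel]⟩
        · exact ih w fun i hi => by omega
    exact fun w => key n w fun i hi => by omega

section Columns

variable {R : Type*} [CommRing R] [Algebra ℝ R] {n : ℕ} [NeZero n]

/-- The last index. -/
def lastIdx (n : ℕ) [NeZero n] : Fin n := ⟨n - 1, Nat.sub_lt (Nat.pos_of_neZero n) one_pos⟩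

theorem lastIdx_val : ((lastIdx n : Fin n) : ℕ) + 1 = n := by
  have := Nat.pos_of_neZero n
  simp only [lastIdx]; omega

theorem eq_lastIdx {j : Fin n} (h : (j : ℕ) + 1 = n) : j = lastIdx n :=
  Fin.ext (by have := lastIdx_val (n := n); omega)

/-- The operator `c ↦ c_x + B c` on column vectors. -/
def colOp (D : Derivation ℝ R R) (B : Matrix (Fin n) (Fin n) R) (c : Fin n → R) : Fin n → R :=
  fun i => D (c i) + B.mulVec c i

/-- The matrix with columns `c, (∂ + B) c, (∂ + B)² c, …`. -/
def krylov (D : Derivation ℝ R R) (B : Matrix (Fin n) (Fin n) R) (c : Fin n → R) :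
    Matrix (Fin n) (Fin n) R := fun i j => (colOp D B)^[(j : ℕ)] c i

theorem lowerShift_mulVec (c : Fin n → R) (i : Fin n) :
    (lowerShift R n).mulVec c i = if 0 < (i : ℕ) then c ⟨i - 1, by omega⟩ else 0 := by
  rw [Matrix.mulVec, dotProduct]
  split_ifs with h
  · rw [Finset.sum_eq_single ⟨i - 1, by omega⟩, lowerShift, if_pos (by simp only; omega), one_mul]
    · intro l _ hl
      rw [lowerShift, if_neg, zero_mul]
      intro h'
      exact hl (Fin.ext (by simp only; omega))
    · intro h'; exact absurd (Finset.mem_univ _) h'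
  · refine Finset.sum_eq_zero fun l _ => ?_
    rw [lowerShift, if_neg (by omega), zero_mul]

theorem IsVMat.mulVec {u : Matrix (Fin n) (Fin n) R} (hu : IsVMat u) (c : Fin n → R) (i : Fin n) :
    u.mulVec c i = u i (lastIdx n) * c (lastIdx n) := by
  rw [Matrix.mulVec, dotProduct, Finset.sum_eq_single (lastIdx n)]
  · intro l _ hl
    rw [hu i l fun h => hl (eq_lastIdx h.2), zero_mul]
  · intro h; exact absurd (Finset.mem_univ _) h

theorem colOp_apply {D : Derivation ℝ R R} {u : Matrix (Fin n) (Fin n) R} (hu : IsVMat u)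
    (c : Fin n → R) (i : Fin n) : colOp D (lowerShift R n + u) c i =
      D (c i) + ((if 0 < (i : ℕ) then c ⟨i - 1, by omega⟩ else 0) +
        u i (lastIdx n) * c (lastIdx n)) := by
  rw [colOp, Matrix.add_mulVec, Pi.add_apply, lowerShift_mulVec, hu.mulVec]

theorem mul_shift_apply {u : Matrix (Fin n) (Fin n) R} (hu : IsVMat u)
    (C : Matrix (Fin n) (Fin n) R) (i j : Fin n) (hj : (j : ℕ) + 1 < n) :
    (C * (lowerShift R n + u)) i j = C i ⟨j + 1, hj⟩ := by
  rw [Matrix.mul_apply, Finset.sum_eq_single ⟨j + 1, hj⟩]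
  · rw [Matrix.add_apply, hu _ j (by omega), lowerShift, if_pos rfl, add_zero, mul_one]
  · intro l _ hl
    rw [Matrix.add_apply, hu l j (by omega), lowerShift, if_neg fun h => hl (Fin.ext h), add_zero,
      mul_zero]
  · intro h; exact absurd (Finset.mem_univ _) h

/-- For `j + 1 < n` the `j`-th column of `C (b + u)` is the next column of `C`. The vanishing of
column `j` of `[∂ + b + u, C]` therefore says that column `j + 1` of `C` is `∂ + b + u` applied to
column `j`. -/
theorem covDer_apply {D : Derivation ℝ R R} {u : Matrix (Fin n) (Fin n) R} (hu : IsVMat u)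
    (C : Matrix (Fin n) (Fin n) R) (i j : Fin n) (hj : (j : ℕ) + 1 < n) :
    covDer D (lowerShift R n + u) C i j =
      colOp D (lowerShift R n + u) (fun k => C k j) i - C i ⟨j + 1, hj⟩ := by
  rw [covDer, Matrix.add_apply, Matrix.sub_apply, mul_shift_apply hu C i j hj, ← add_sub_assoc]
  rfl

theorem covDer_krylov {D : Derivation ℝ R R} {u : Matrix (Fin n) (Fin n) R} (hu : IsVMat u)
    (c : Fin n → R) (i j : Fin n) (hj : (j : ℕ) + 1 < n) :
    covDer D (lowerShift R n + u) (krylov D (lowerShift R n + u) c) i j = 0 := by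
  rw [covDer_apply hu _ _ _ hj]
  simp only [krylov, Function.iterate_succ_apply']
  exact sub_self _

theorem eq_krylov {D : Derivation ℝ R R} {u C : Matrix (Fin n) (Fin n) R} (hu : IsVMat u)
    (h : ∀ i j : Fin n, (j : ℕ) + 1 < n → covDer D (lowerShift R n + u) C i j = 0) :
    C = krylov D (lowerShift R n + u) fun i => C i 0 := by
  have key : ∀ (k : ℕ) (hk : k < n), (fun i => C i ⟨k, hk⟩) =
      (colOp D (lowerShift R n + u))^[k] fun i => C i 0 := by
    intro k
    induction k with
    | zero => intro hk; rfl
    | succ k ih =>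
      intro hk
      rw [Function.iterate_succ_apply', ← ih (by omega)]
      funext i
      have := h i ⟨k, by omega⟩ hk
      rw [covDer_apply hu _ _ _ hk] at this
      exact (sub_eq_zero.1 this).symm
  ext i j
  exact congrFun (key j j.2) i

theorem trace_covDer (D : Derivation ℝ R R) (B C : Matrix (Fin n) (Fin n) R) :
    (covDer D B C).trace = D C.trace := by
  rw [covDer, Matrix.trace_add, Matrix.trace_sub, Matrix.trace_mul_comm, sub_self, add_zero,
    Matrix.trace, Matrix.trace, map_sum]
  rfl

/-- Outside `V_n` and the columns already known to vanish there is only the bottom right entry,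
which is then the trace. -/
theorem isVMat_of_trace {M : Matrix (Fin n) (Fin n) R}
    (h : ∀ i j : Fin n, (j : ℕ) + 1 < n → M i j = 0) (ht : M.trace = 0) : IsVMat M := by
  have hl : M (lastIdx n) (lastIdx n) = 0 := by
    rw [← ht, Matrix.trace, Finset.sum_eq_single (lastIdx n)]
    · rfl
    · intro j _ hj
      exact h j j (by
        by_contra h'
        exact hj (eq_lastIdx (by have := j.2; omega)))
    · intro h; exact absurd (Finset.mem_univ _) h
  intro i j hij
  by_cases hj : (j : ℕ) + 1 < n
  · exact h i j hj
  · have hi := i.2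
    have hj2 := j.2
    rw [eq_lastIdx (show (j : ℕ) + 1 = n by omega), eq_lastIdx (show (i : ℕ) + 1 = n by omega), hl]

theorem isVMat_covDer_krylov {D : Derivation ℝ R R} {u : Matrix (Fin n) (Fin n) R} (hu : IsVMat u)
    (c : Fin n → R) (ht : (krylov D (lowerShift R n + u) c).trace = 0) :
    IsVMat (covDer D (lowerShift R n + u) (krylov D (lowerShift R n + u) c)) :=
  isVMat_of_trace (covDer_krylov hu c) (by rw [trace_covDer, ht, map_zero])

theorem IsVMat.eq_krylov {D : Derivation ℝ R R} {u C : Matrix (Fin n) (Fin n) R} (hu : IsVMat u)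
    (h : IsVMat (covDer D (lowerShift R n + u) C)) :
    C = krylov D (lowerShift R n + u) fun i => C i 0 :=
  CentralAffine.eq_krylov hu fun i j hj => h i j (by omega)

theorem colOp_add (D : Derivation ℝ R R) (B : Matrix (Fin n) (Fin n) R) (c d : Fin n → R) :
    colOp D B (c + d) = colOp D B c + colOp D B d := by
  funext i
  simp only [colOp, Pi.add_apply, map_add, Matrix.mulVec_add]
  ring

theorem krylov_add (D : Derivation ℝ R R) (B : Matrix (Fin n) (Fin n) R) (c d : Fin n → R) :
    krylov D B (c + d) = krylov D B c + krylov D B d := by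
  have key : ∀ k : ℕ, (colOp D B)^[k] (c + d) = (colOp D B)^[k] c + (colOp D B)^[k] d := by
    intro k
    induction k with
    | zero => rfl
    | succ k ih => rw [Function.iterate_succ_apply', Function.iterate_succ_apply',
        Function.iterate_succ_apply', ih, colOp_add]
  ext i j
  exact congrFun (key j) i

/-- Each application of `∂ + b + u` moves the lowest nonzero entry one row down without changing it.
The potential does not interfere, because it multiplies the last entry of the vector, which is still
zero. -/
theorem iterate_colOp_lead {D : Derivation ℝ R R} {u : Matrix (Fin n) (Fin n) R} (hu : IsVMat u)
    {c : Fin n → R} {m : Fin n} (hc : ∀ i, m < i → c i = 0) (k : ℕ) :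
    (∀ i : Fin n, (m : ℕ) + k < i → (colOp D (lowerShift R n + u))^[k] c i = 0) ∧
      ∀ i : Fin n, (m : ℕ) + k = i → (colOp D (lowerShift R n + u))^[k] c i = c m := by
  induction k with
  | zero => exact ⟨fun i hi => hc i (Fin.lt_def.2 (by omega)), fun i hi => by
      rw [show i = m from Fin.ext (by omega)]; rfl⟩
  | succ k ih =>
    have hl := lastIdx_val (n := n)
    simp only [Function.iterate_succ_apply']
    refine ⟨fun i hi => ?_, fun i hi => ?_⟩
    · have := i.2
      rw [colOp_apply hu, ih.1 i (by omega), map_zero, if_pos (by omega),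
        ih.1 ⟨i - 1, by omega⟩ (by simp only; omega), ih.1 (lastIdx n) (by omega), mul_zero,
        add_zero, add_zero]
    · have := i.2
      rw [colOp_apply hu, ih.1 i (by omega), map_zero, if_pos (by omega),
        ih.2 ⟨i - 1, by omega⟩ (by simp only; omega), ih.1 (lastIdx n) (by omega), mul_zero,
        add_zero, zero_add]

theorem nsmul_bijective : Function.Bijective fun x : R => n • x := by
  have hn : (n : ℝ) ≠ 0 := Nat.cast_ne_zero.2 (NeZero.ne n)
  refine ⟨fun x y h => ?_, fun y => ⟨(n : ℝ)⁻¹ • y, ?_⟩⟩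
  · refine sub_eq_zero.1 (eq_zero_of_nsmul (n := n) ?_)
    rw [smul_sub]; exact sub_eq_zero.2 h
  · dsimp only
    rw [← Nat.cast_smul_eq_nsmul ℝ, smul_smul, mul_inv_cancel₀ hn, one_smul]

/-- The trace and the last row of the matrix generated by a first column. -/
def lastRowMap (D : Derivation ℝ R R) (B : Matrix (Fin n) (Fin n) R) :
    (Fin n → R) →+ (Fin n → R) where
  toFun c m := if (m : ℕ) = 0 then (krylov D B c).trace else
    krylov D B c (lastIdx n) ⟨n - 1 - m, by have := m.2; omega⟩
  map_zero' := by
    have h : krylov D B (0 : Fin n → R) = 0 := by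
      have := krylov_add D B 0 0
      rw [add_zero] at this
      exact left_eq_add.1 this
    funext m
    rw [h]
    simp
  map_add' c d := by
    funext m
    rw [krylov_add, Pi.add_apply]
    split_ifs
    · rw [Matrix.trace_add]
    · rfl

/-- If `c` vanishes below row `m`, then the entry `c m` arrives in the last row in column `n - 1 -
m`, and the earlier columns have last entry zero. For `m = 0` every diagonal entry is `c 0`, so the
trace is `n • c 0`. The map is thus triangular with the identity or multiplication by `n` on its
diagonal. -/
theorem lastRowMap_bijective (D : Derivation ℝ R R) {u : Matrix (Fin n) (Fin n) R}
    (hu : IsVMat u) : Function.Bijective (lastRowMap D (lowerShift R n + u)) := by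
  have hl := lastIdx_val (n := n)
  refine triangular_bijective _ (fun m x => if (m : ℕ) = 0 then n • x else x) (fun m => ?_)
    fun m c hc => ⟨fun i hi => ?_, ?_⟩
  · by_cases h : (m : ℕ) = 0
    · simp only [if_pos h]; exact nsmul_bijective
    · simp only [if_neg h]; exact Function.bijective_id
  · rw [Fin.lt_def] at hi
    have := i.2
    change (if (i : ℕ) = 0 then _ else _) = _
    rw [if_neg (by omega)]
    exact (iterate_colOp_lead hu hc _).1 _ (by simp only; omega)
  · have := m.2
    change (if (m : ℕ) = 0 then _ else _) = if (m : ℕ) = 0 then _ else _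
    split_ifs with h
    · have hd : ∀ j ∈ Finset.univ, (krylov D (lowerShift R n + u) c).diag j = c m := fun j _ =>
        (iterate_colOp_lead hu hc j).2 j (by omega)
      rw [Matrix.trace, Finset.sum_congr rfl hd]
      simp
    · exact (iterate_colOp_lead hu hc _).2 _ (by simp only; omega)

/-- Existence and uniqueness of `P_u`. -/
theorem existsUnique_lastRow (D : Derivation ℝ R R) {u : Matrix (Fin n) (Fin n) R}
    (hu : IsVMat u) (v : Fin n → R) :
    ∃! C : Matrix (Fin n) (Fin n) R, C.trace = 0 ∧
      (∀ j : Fin n, (j : ℕ) + 1 < n → C (lastIdx n) j = v j) ∧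
      IsVMat (covDer D (lowerShift R n + u) C) := by
  have hn := Nat.pos_of_neZero n
  let w : Fin n → R := fun m =>
    if (m : ℕ) = 0 then 0 else v ⟨n - 1 - m, by have := m.2; omega⟩
  have hw : ∀ c, lastRowMap D (lowerShift R n + u) c = w ↔
      (krylov D (lowerShift R n + u) c).trace = 0 ∧
        ∀ j : Fin n, (j : ℕ) + 1 < n → krylov D (lowerShift R n + u) c (lastIdx n) j = v j := by
    intro c
    constructor
    · intro h
      refine ⟨?_, fun j hj => ?_⟩
      · have := congrFun h 0
        have h0 : ((0 : Fin n) : ℕ) = 0 := rfl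
        simpa only [w, h0, if_true, lastRowMap, AddMonoidHom.coe_mk, ZeroHom.coe_mk] using this
      · have := congrFun h ⟨n - 1 - j, by omega⟩
        change (if n - 1 - (j : ℕ) = 0 then _ else _) = if n - 1 - (j : ℕ) = 0 then _ else _ at this
        rw [if_neg (by omega), if_neg (by omega)] at this
        have e : (⟨n - 1 - (n - 1 - (j : ℕ)), by omega⟩ : Fin n) = j :=
          Fin.ext (by simp only; omega)
        rwa [e] at this
    · rintro ⟨h1, h2⟩
      funext m
      change (if (m : ℕ) = 0 then _ else _) = if (m : ℕ) = 0 then _ else _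
      split_ifs with hm
      · exact h1
      · exact h2 _ (by have := m.2; simp only; omega)
  obtain ⟨c, hc, huniq⟩ := (lastRowMap_bijective D hu).existsUnique w
  obtain ⟨h1, h2⟩ := (hw c).1 hc
  refine ⟨krylov D (lowerShift R n + u) c, ⟨h1, h2, isVMat_covDer_krylov hu c h1⟩, ?_⟩
  rintro C ⟨g1, g2, g3⟩
  have g4 := hu.eq_krylov g3
  rw [g4] at g1 g2
  rw [g4, huniq _ ((hw _).2 ⟨g1, g2⟩)]

/-- If `[∂ + b + u, Y] + [e_{1n}, E] = 0` then the matrix generated by the first column of `Y`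
differs from `Y` by a strictly upper triangular matrix. -/
theorem sub_krylov_strictUpper {D : Derivation ℝ R R} {u Y E : Matrix (Fin n) (Fin n) R}
    (hu : IsVMat u)
    (h : covDer D (lowerShift R n + u) Y + (cornerMat R n * E - E * cornerMat R n) = 0) :
    ∀ i j : Fin n, j ≤ i →
      (Y - krylov D (lowerShift R n + u) fun i => Y i 0) i j = 0 := by
  set Z := krylov D (lowerShift R n + u) fun i => Y i 0 with hZ
  have hl := lastIdx_val (n := n)
  -- `[e_{1n}, E]` is supported in the first row and the last column, so away from them the columns
  -- of `Y`, like those of `Z`, follow the recursion by `∂ + b + u`.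
  have hrow : ∀ i j : Fin n, 0 < (i : ℕ) → ∀ hj : (j : ℕ) + 1 < n,
      (Y - Z) i ⟨j + 1, hj⟩ = colOp D (lowerShift R n + u) (fun k => (Y - Z) k j) i := by
    intro i j hi hj
    have h1 : covDer D (lowerShift R n + u) Y i j = 0 := by
      have := congrFun (congrFun h i) j
      rw [Matrix.add_apply, Matrix.sub_apply, Matrix.mul_apply, Matrix.mul_apply,
        Finset.sum_eq_zero, Finset.sum_eq_zero, sub_zero, add_zero] at this
      · exact this
      · intro l _
        rw [cornerMat, if_neg (by omega), mul_zero]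
      · intro l _
        rw [cornerMat, if_neg (by omega), zero_mul]
    have h2 := covDer_krylov (D := D) hu (fun i => Y i 0) i j hj
    rw [← hZ, covDer_apply hu _ _ _ hj] at h2
    rw [covDer_apply hu _ _ _ hj] at h1
    have h3 : (fun k => Y k j) = (fun k => (Y - Z) k j) + fun k => Z k j := by
      funext k; simp
    rw [h3, colOp_add, Pi.add_apply] at h1
    rw [Matrix.sub_apply]
    linear_combination h2 - h1
  -- The first column of `Y - Z` is zero, and nonzero entries created in the first row descend by at
  -- most one row per column, hence stay strictly above the diagonal.
  have key : ∀ (k : ℕ) (hk : k < n) (i : Fin n), k ≤ i → (Y - Z) i ⟨k, hk⟩ = 0 := by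
    intro k
    induction k with
    | zero =>
      intro hk i _
      have : (⟨0, hk⟩ : Fin n) = 0 := rfl
      rw [this, Matrix.sub_apply, hZ]
      exact sub_self _
    | succ k ih =>
      intro hk i hi
      rw [hrow i ⟨k, by omega⟩ (by omega) hk, colOp_apply hu, ih _ i (by omega), map_zero,
        if_pos (by omega), ih _ ⟨i - 1, by omega⟩ (by simp only; omega),
        ih _ (lastIdx n) (by omega), mul_zero, add_zero, add_zero]
  intro i j hij
  exact key j j.2 i hij

end Columns

/-! ### `P_u`, `ζ_j` and `Z_{j,0}` -/

section PopZeta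

variable {n : ℕ} [NeZero n]

theorem isVMat_coe (u : VLoop n) : IsVMat u.1 := u.2

theorem covD_mem_iff (u : VLoop n) (C : MLoop n) :
    covD (bMat n + u.1) C ∈ VLoop n ↔ IsVMat (covDer dxD (lowerShift Loop n + u.1) C) := Iff.rfl

theorem isP_iff (u : VLoop n) (v : VtLoop n) (C : MLoop n) : IsP u v C ↔
    C.trace = 0 ∧ (∀ j : Fin n, (j : ℕ) + 1 < n → C (lastIdx n) j = v.1 (lastIdx n) j) ∧
      IsVMat (covDer dxD (lowerShift Loop n + u.1) C) := by
  rw [IsP, covD_mem_iff]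
  refine and_congr_right fun _ => and_congr_left fun _ => ⟨fun h j hj => h _ _ lastIdx_val hj,
    fun h i j hi hj => ?_⟩
  rw [eq_lastIdx hi]
  exact h j hj

theorem existsUnique_isP (u : VLoop n) (v : VtLoop n) : ∃! C, IsP u v C := by
  simp only [isP_iff]
  exact existsUnique_lastRow dxD (isVMat_coe u) _

theorem isP_Pop (u : VLoop n) (v : VtLoop n) : IsP u v (Pop u v) := by
  have h := (existsUnique_isP u v).exists
  rw [Pop, dif_pos h]
  exact h.choose_spec

theorem IsP.eq_Pop {u : VLoop n} {v : VtLoop n} {C : MLoop n} (h : IsP u v C) : C = Pop u v :=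
  (existsUnique_isP u v).unique h (isP_Pop u v)

/-- A strictly upper triangular `ζ` has zero first column, so `Y_{j,0} - ζ` has the first column of
`Y_{j,0}`, which generates it. -/
theorem IsZeta.sub_eq {j : ℕ} {u : VLoop n} {ζ : MLoop n} (h : IsZeta j u ζ) :
    Y0 j u - ζ = krylov dxD (lowerShift Loop n + u.1) fun i => Y0 j u i 0 := by
  have h1 := (isVMat_coe u).eq_krylov ((covD_mem_iff u _).1 h.2)
  rw [h1]
  congr 1
  funext i
  rw [Matrix.sub_apply, h.1 i 0 (Fin.zero_le i), sub_zero]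

theorem existsUnique_isZeta (hn : 2 ≤ n) {j : ℕ} (hj : ¬ n ∣ j) (u : VLoop n) :
    ∃! ζ, IsZeta j u ζ := by
  have hs := sub_krylov_strictUpper (D := dxD) (isVMat_coe u) (covD_Y0 hn j u)
  set Z := krylov dxD (lowerShift Loop n + u.1) fun i => Y0 j u i 0 with hZ
  -- The correction is strictly upper triangular and leaves the diagonal alone, so `Z` inherits the
  -- trace of `Y_{j,0}`, which is zero since `n ∤ j`.
  have ht : Z.trace = 0 := by
    rw [← trace_Y0 hn hj u, Matrix.trace, Matrix.trace]
    refine Finset.sum_congr rfl fun i _ => ?_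
    have := hs i i le_rfl
    rw [Matrix.sub_apply] at this
    exact (sub_eq_zero.1 this).symm
  refine ⟨Y0 j u - Z, ⟨hs, ?_⟩, fun ζ hζ => ?_⟩
  · rw [sub_sub_cancel]
    exact (covD_mem_iff u _).2 (isVMat_covDer_krylov (isVMat_coe u) _ ht)
  · rw [hZ, ← hζ.sub_eq, sub_sub_cancel]

theorem isZeta_zeta (hn : 2 ≤ n) {j : ℕ} (hj : ¬ n ∣ j) (u : VLoop n) : IsZeta j u (zeta j u) := by
  have h := (existsUnique_isZeta hn hj u).exists
  rw [zeta, dif_pos h]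
  exact h.choose_spec

/-- The projection `π₀`. -/
def piZero (C : MLoop n) : VtLoop n :=
  ⟨fun i j => if (i : ℕ) + 1 = n ∧ (j : ℕ) + 1 < n then C i j else 0, fun _ _ h => if_neg h⟩

/-- `Z_{j,0}(u) = P_u(π₀(Y_{j,0}(u)))`. -/
theorem isP_Z0 (hn : 2 ≤ n) {j : ℕ} (hj : ¬ n ∣ j) (u : VLoop n) :
    IsP u (piZero (Y0 j u)) (Z0 j u) := by
  have h := isZeta_zeta hn hj u
  refine ⟨?_, fun i k hi hk => ?_, h.2⟩
  · rw [Z0, Matrix.trace_sub, trace_Y0 hn hj, zero_sub, neg_eq_zero]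
    exact Finset.sum_eq_zero fun i _ => h.1 i i le_rfl
  · have : (piZero (Y0 j u)).1 i k = Y0 j u i k := if_pos ⟨hi, hk⟩
    rw [this, Z0, Matrix.sub_apply, h.1 i k (by rw [Fin.le_def]; omega), sub_zero]

end PopZeta

/-! ### Smooth families of loops -/

/-- Smooth functions of `(s, x)` that are `2π`-periodic in `x`. -/
def famSubalgebra : Subalgebra ℝ (ℝ × ℝ → ℝ) where
  carrier := {f | ContDiff ℝ ∞ f ∧ Function.Periodic f ((0 : ℝ), 2 * Real.pi)}
  mul_mem' := fun ha hb => ⟨ha.1.mul hb.1, ha.2.mul hb.2⟩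
  add_mem' := fun ha hb => ⟨ha.1.add hb.1, ha.2.add hb.2⟩
  algebraMap_mem' := fun _ => ⟨contDiff_const, fun _ => rfl⟩

/-- The ring of smooth families of loops. -/
abbrev Fam : Type := famSubalgebra

theorem Fam.differentiable (f : Fam) : Differentiable ℝ f.1 := f.2.1.differentiable (by simp)

theorem fderiv_mem_fam (v : ℝ × ℝ) (f : Fam) : (fun p => fderiv ℝ f.1 p v) ∈ famSubalgebra := by
  refine ⟨(f.2.1.fderiv_right (m := ∞) (by simp)).clm_apply contDiff_const, fun p => ?_⟩
  have h : (fun q => f.1 (q + ((0 : ℝ), 2 * Real.pi))) = f.1 := funext f.2.2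
  change fderiv ℝ f.1 (p + ((0 : ℝ), 2 * Real.pi)) v = fderiv ℝ f.1 p v
  rw [← fderiv_comp_add_right, h]

/-- Directional derivatives of families. -/
def famD (v : ℝ × ℝ) : Derivation ℝ Fam Fam :=
  Derivation.mk'
    { toFun := fun f => ⟨fun p => fderiv ℝ f.1 p v, fderiv_mem_fam v f⟩
      map_add' := fun f g => Subtype.ext <| funext fun p => by
        change fderiv ℝ (f.1 + g.1) p v = _
        rw [fderiv_add (f.differentiable p) (g.differentiable p)]
        rfl
      map_smul' := fun c f => Subtype.ext <| funext fun p => by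
        change fderiv ℝ (c • f.1) p v = _
        rw [fderiv_const_smul (f.differentiable p)]
        rfl }
    fun f g => Subtype.ext <| funext fun p => by
      change fderiv ℝ (f.1 * g.1) p v = f.1 p * fderiv ℝ g.1 p v + g.1 p * fderiv ℝ f.1 p v
      rw [fderiv_mul (f.differentiable p) (g.differentiable p)]
      rfl

theorem famD_comm (v w : ℝ × ℝ) (f : Fam) : famD v (famD w f) = famD w (famD v f) := by
  refine Subtype.ext (funext fun p => ?_)
  have hd : DifferentiableAt ℝ (fderiv ℝ f.1) p :=
    (f.2.1.fderiv_right (m := ∞) (by simp)).differentiable (by simp) p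
  have key : ∀ v w : ℝ × ℝ, (famD v (famD w f)).1 p = fderiv ℝ (fderiv ℝ f.1) p v w := by
    intro v w
    change fderiv ℝ (fun q => fderiv ℝ f.1 q w) p v = _
    rw [fderiv_clm_apply hd (differentiableAt_const w)]
    simp
  rw [key, key]
  exact (f.2.1.contDiffAt.isSymmSndFDerivAt
    (by simpa using ENat.LEInfty.out)).eq v w

/-- The derivative of a family in the `x`-direction. -/
abbrev famDx : Derivation ℝ Fam Fam := famD (0, 1)

/-- The derivative of a family in the `s`-direction. -/
abbrev famDs : Derivation ℝ Fam Fam := famD (1, 0)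

/-- The loop at the parameter `s` of a family. -/
def restr (s : ℝ) : Fam →+* Loop where
  toFun f := ⟨fun x => f.1 (s, x),
    f.2.1.comp (contDiff_const.prodMk contDiff_id), fun x => by
      have := f.2.2 (s, x)
      simpa using this⟩
  map_one' := rfl
  map_mul' _ _ := rfl
  map_zero' := rfl
  map_add' _ _ := rfl

theorem fam_ext {f g : Fam} (h : ∀ s, restr s f = restr s g) : f = g :=
  Subtype.ext <| funext fun p => congrFun (congrArg Subtype.val (h p.1)) p.2

theorem restr_famDx (s : ℝ) (f : Fam) : restr s (famDx f) = dxD (restr s f) := by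
  refine Subtype.ext (funext fun x => ?_)
  have h : HasDerivAt (fun y : ℝ => f.1 (s, y)) (fderiv ℝ f.1 (s, x) (0, 1)) x :=
    HasFDerivAt.comp_hasDerivAt x (f.differentiable (s, x)).hasFDerivAt
      ((hasDerivAt_const x s).prodMk (hasDerivAt_id x))
  exact h.deriv.symm

theorem hasDerivAt_restr (f : Fam) (s x : ℝ) :
    HasDerivAt (fun s => (restr s f).1 x) ((restr s (famDs f)).1 x) s :=
  HasFDerivAt.comp_hasDerivAt s (f.differentiable (s, x)).hasFDerivAt
    ((hasDerivAt_id s).prodMk (hasDerivAt_const s x))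

theorem smoothFamily_restr (f : Fam) : SmoothFamily fun s => restr s f := f.2.1

/-- A smooth family as an element of the ring of families. -/
def toFam (U : ℝ → Loop) (h : SmoothFamily U) : Fam :=
  ⟨fun p => (U p.1).1 p.2, h, fun p => by
    have := (U p.1).2.2 p.2
    simpa using this⟩

theorem restr_famDs_of_velocity {f : Fam} {v : Loop} (h : HasVelocity (fun s => restr s f) v) :
    restr 0 (famDs f) = v :=
  Subtype.ext <| funext fun x => (hasDerivAt_restr f 0 x).unique (h x)

/-! ### Integrals over the circle -/

theorem Loop.continuous (f : Loop) : Continuous f.1 := f.2.1.continuous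

theorem oint_add (f g : Loop) : oint (f + g) = oint f + oint g :=
  intervalIntegral.integral_add (f.continuous.intervalIntegrable _ _)
    (g.continuous.intervalIntegrable _ _)

theorem oint_sub (f g : Loop) : oint (f - g) = oint f - oint g :=
  intervalIntegral.integral_sub (f.continuous.intervalIntegrable _ _)
    (g.continuous.intervalIntegrable _ _)

theorem oint_smul (c : ℝ) (f : Loop) : oint (c • f) = c * oint f :=
  intervalIntegral.integral_const_mul c f.1

theorem oint_dxD (f : Loop) : oint (dxD f) = 0 := by
  have h := intervalIntegral.integral_deriv_eq_sub (a := 0) (b := 2 * Real.pi) (f := f.1)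
    (fun x _ => f.differentiable x) ((dxD f).continuous.intervalIntegrable _ _)
  refine h.trans ?_
  have := f.2.2 0
  rw [zero_add] at this
  rw [this, sub_self]

theorem oint_eq_zero {f : Loop} (h0 : ∀ x, 0 ≤ f.1 x) (h : oint f = 0) (x : ℝ) : f.1 x = 0 := by
  by_contra hx
  have hpi : (0 : ℝ) < 2 * Real.pi := by positivity
  obtain ⟨y, hy, hxy⟩ := f.2.2.exists_mem_Ico₀ hpi x
  refine absurd h (ne_of_gt ?_)
  refine intervalIntegral.integral_pos hpi f.continuous.continuousOn (fun z _ => h0 z)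
    ⟨y, ⟨hy.1, hy.2.le⟩, ?_⟩
  rw [← hxy]
  exact lt_of_le_of_ne (h0 x) (Ne.symm hx)

theorem hasDerivAt_oint (f : Fam) (s : ℝ) :
    HasDerivAt (fun s => oint (restr s f)) (oint (restr s (famDs f))) s := by
  have hc : Continuous (famDs f).1 := (famDs f).2.1.continuous
  obtain ⟨M, hM⟩ := ((isCompact_Icc (a := s - 1) (b := s + 1)).prod
    (isCompact_Icc (a := (0 : ℝ)) (b := 2 * Real.pi))).exists_bound_of_continuousOn hc.continuousOn
  refine (intervalIntegral.hasDerivAt_integral_of_dominated_loc_of_deriv_le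
    (F := fun s x => (restr s f).1 x) (F' := fun s x => (restr s (famDs f)).1 x)
    (bound := fun _ => M) (s := Set.Icc (s - 1) (s + 1)) (Icc_mem_nhds (by linarith) (by linarith))
    (Filter.Eventually.of_forall fun t => (restr t f).continuous.aestronglyMeasurable)
    ((restr s f).continuous.intervalIntegrable _ _)
    ((restr s (famDs f)).continuous.aestronglyMeasurable) ?_
    (continuous_const.intervalIntegrable _ _) ?_).2
  · refine Filter.Eventually.of_forall fun x hx t ht => hM (t, x) ⟨ht, ?_⟩
    rw [Set.uIoc_of_le (by positivity)] at hx
    exact ⟨hx.1.le, hx.2⟩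
  · exact Filter.Eventually.of_forall fun x _ t _ => hasDerivAt_restr f t x

/-! ### Gradients -/

section Gradient

variable {n : ℕ} [NeZero n]

/-- Elements of `V_n` see only the first `n - 1` entries of the last row of the other factor. This
is why the brackets depend on `P_u (∇F)` only through `∇F` once the first factor lies in `V_n`. -/
theorem trace_mul_of_isVMat {R : Type*} [CommRing R] {M C C' : Matrix (Fin n) (Fin n) R}
    (hM : IsVMat M) (h : ∀ j : Fin n, (j : ℕ) + 1 < n → C (lastIdx n) j = C' (lastIdx n) j) :
    (M * C).trace = (M * C').trace := by
  simp only [Matrix.trace, Matrix.diag_apply, Matrix.mul_apply]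
  refine Finset.sum_congr rfl fun i _ => Finset.sum_congr rfl fun k _ => ?_
  by_cases hik : (i : ℕ) + 1 < n ∧ (k : ℕ) + 1 = n
  · rw [eq_lastIdx hik.2, h i hik.1]
  · rw [hM i k hik, zero_mul, zero_mul]

theorem pairing_comm (M C : MLoop n) : pairing M C = pairing C M := by
  rw [pairing, pairing, Matrix.trace_mul_comm]

theorem pairing_of_isVMat {M C C' : MLoop n} (hM : IsVMat M)
    (h : ∀ j : Fin n, (j : ℕ) + 1 < n → C (lastIdx n) j = C' (lastIdx n) j) :
    pairing M C = pairing M C' := by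
  rw [pairing, pairing, trace_mul_of_isVMat hM h]

theorem pairing_sub_left (A B C : MLoop n) : pairing (A - B) C = pairing A C - pairing B C := by
  rw [pairing, sub_mul, Matrix.trace_sub, oint_sub]; rfl

theorem pairing_add_left (A B C : MLoop n) : pairing (A + B) C = pairing A C + pairing B C := by
  rw [pairing, add_mul, Matrix.trace_add, oint_add]; rfl

/-- Test the difference `d` of two gradients on the straight line with velocity `dᵗ`, which lies in
`V_n`: the integral of the sum of the squares of the entries of `d` is zero. -/
theorem HasGrad.unique {F : VLoop n → ℝ} {u : VLoop n} {ξ ξ' : VtLoop n} (h : HasGrad F u ξ)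
    (h' : HasGrad F u ξ') : ξ = ξ' := by
  have key : ∀ v : VLoop n, pairing (ξ.1 - ξ'.1) v.1 = 0 := by
    intro v
    have hs : ∀ i j, SmoothFamily fun s => (u + s • v).1 i j := fun i j =>
      ((u.1 i j).2.1.comp contDiff_snd).add (contDiff_fst.mul ((v.1 i j).2.1.comp contDiff_snd))
    have hv : ∀ i j, HasVelocity (fun s => (u + s • v).1 i j) (v.1 i j) := fun i j x => by
      have := ((hasDerivAt_id (0 : ℝ)).mul_const ((v.1 i j).1 x)).const_add ((u.1 i j).1 x)
      rw [one_mul] at this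
      exact this
    have h0 : u + (0 : ℝ) • v = u := by rw [zero_smul, add_zero]
    rw [pairing_sub_left, sub_eq_zero]
    exact (h _ v hs h0 hv).unique (h' _ v hs h0 hv)
  set d := ξ.1 - ξ'.1 with hd
  have hd0 : ∀ i j : Fin n, ¬ ((i : ℕ) + 1 = n ∧ (j : ℕ) + 1 < n) → d i j = 0 := fun i j hij => by
    rw [hd, Matrix.sub_apply, ξ.2 i j hij, ξ'.2 i j hij, sub_zero]
  have hp := key ⟨d.transpose, fun i j hij => hd0 j i fun h => hij ⟨h.2, h.1⟩⟩
  have hval : ∀ x, ((d * d.transpose).trace).1 x = ∑ i, ∑ j, (d i j).1 x * (d i j).1 x := by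
    intro x
    simp only [Matrix.trace, Matrix.diag_apply, Matrix.mul_apply, Matrix.transpose_apply]
    simp [Finset.sum_apply]
  have hz := oint_eq_zero (f := (d * d.transpose).trace) (fun x => by
    rw [hval]
    exact Finset.sum_nonneg fun i _ => Finset.sum_nonneg fun j _ => mul_self_nonneg _) hp
  refine Subtype.ext (sub_eq_zero.1 ?_)
  rw [← hd]
  ext1 i j
  refine Subtype.ext (funext fun x => ?_)
  have h1 := hz x
  rw [hval, Finset.sum_eq_zero_iff_of_nonneg
    (fun i _ => Finset.sum_nonneg fun j _ => mul_self_nonneg _)] at h1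
  have h2 := h1 i (Finset.mem_univ i)
  rw [Finset.sum_eq_zero_iff_of_nonneg (fun j _ => mul_self_nonneg _)] at h2
  exact mul_self_eq_zero.1 (h2 j (Finset.mem_univ j))

theorem HasGrad.grad_eq {F : VLoop n → ℝ} {u : VLoop n} {ξ : VtLoop n} (h : HasGrad F u ξ) :
    grad F u = ξ := by
  have hex : ∃ ξ, HasGrad F u ξ := ⟨ξ, h⟩
  rw [grad, dif_pos hex]
  exact hex.choose_spec.unique h

theorem HasGrad.neg {F : VLoop n → ℝ} {u : VLoop n} {ξ : VtLoop n} (h : HasGrad F u ξ) :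
    HasGrad (fun u => -F u) u (-ξ) := by
  intro U v hU h0 hv
  have h1 : pairing (-ξ).1 v.1 = -pairing ξ.1 v.1 := by
    have h2 := pairing_add_left (-ξ).1 ξ.1 v.1
    have h3 := pairing_sub_left ξ.1 ξ.1 v.1
    rw [sub_self, sub_self] at h3
    rw [show (-ξ).1 + ξ.1 = 0 from neg_add_cancel ξ.1, h3] at h2
    linarith
  rw [h1]
  exact (h U v hU h0 hv).neg

/-- A smooth family of potentials as a matrix over the ring of families. -/
def famMat {U : ℝ → VLoop n} (hU : ∀ i j, SmoothFamily fun s => (U s).1 i j) :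
    Matrix (Fin n) (Fin n) Fam := fun i j => toFam _ (hU i j)

theorem isVMat_famMat {U : ℝ → VLoop n} (hU : ∀ i j, SmoothFamily fun s => (U s).1 i j) :
    IsVMat (famMat hU) := fun i j hij => fam_ext fun s => by
  rw [map_zero]; exact (U s).2 i j hij

theorem serMap_single {R R' : Type*} [CommRing R] [Algebra ℝ R] [CommRing R'] [Algebra ℝ R'] (φ : R →+* R')
    (M : Matrix (Fin n) (Fin n) R) :
    serMap φ (HahnSeries.single 0 M : Ser R n) = HahnSeries.single 0 (M.map φ) :=
  ser_ext fun p q => by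
    rw [ent_serMap, ent_single_zero, ent_single_zero]
    split_ifs
    · rfl
    · exact map_zero φ

theorem serMap_pow {R R' : Type*} [CommRing R] [Algebra ℝ R] [CommRing R']
    [Algebra ℝ R'] (φ : R →+* R') (Y : Ser R n) (j : ℕ) :
    serMap φ (Y ^ j) = serMap φ Y ^ j := by
  induction j with
  | zero => rw [pow_zero, pow_zero, serMap_one]
  | succ j ih => rw [pow_succ, pow_succ, serMap_mul, ih]

/-- `∇H_j(u) = π₀(Y_{j,0}(u))`. -/
theorem hasGrad_Hfun (hn : 2 ≤ n) (j : ℕ) (u : VLoop n) :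
    HasGrad (Hfun n j) u (piZero (Y0 j u)) := by
  intro U v hU h0 hv
  -- The dressing is solved once over the ring of families, which makes `f_j` smooth in the
  -- parameter; by uniqueness its restrictions are the dressings of the individual potentials `U s`.
  obtain ⟨T, f, h⟩ := exists_isDress famDx (isVMat_famMat hU).ordGE_single
  obtain ⟨S, hST, hTS⟩ := exists_inverse h.ord h.diag
  have hmap : ∀ s, IsDress dxD (HahnSeries.single 0 (U s).1) (serMap (restr s) T)
      fun i => restr s (f i) := fun s => by
    have := h.map (restr s) (D' := dxD) (restr_famDx s)
    rwa [serMap_single] at this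
  have hH : (fun s => Hfun n j (U s)) = fun s => (n : ℝ) * oint (restr s (f j)) := by
    funext s
    rw [Hfun, fCoeff_eq (hmap s)]
  rw [hH]
  have hvar := congrArg (restr 0) (variation (famD_comm (0, 1) (1, 0)) h hST hTS j)
  have hST0 : serMap (restr 0) S * serMap (restr 0) T = 1 := by
    rw [← serMap_mul, hST, serMap_one]
  have hTS0 : serMap (restr 0) T * serMap (restr 0) S = 1 := by
    rw [← serMap_mul, hTS, serMap_one]
  have hres := resolvent_eq hn (hmap 0) hST0 hTS0
  have hY0 : Y0 j u = (((S * serJ Fam n * T) ^ j).coeff 0).map (restr 0) := by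
    have h1 : serMap (restr 0) ((S * serJ Fam n * T) ^ j) = resolvent (U 0) ^ j := by
      rw [serMap_pow, serMap_mul, serMap_mul, serMap_serJ, hres]
    rw [Y0, ← h0, ← h1]
    rfl
  have hE : serD famDs (HahnSeries.single 0 (famMat hU) : Ser Fam n) =
      HahnSeries.single 0 (matD famDs (famMat hU)) := ser_ext fun p q => by
    rw [ent_serD, ent_single_zero, ent_single_zero]
    split_ifs
    · rfl
    · exact map_zero _
  have hvel : (matD famDs (famMat hU)).map (restr 0) = v.1 := by
    ext1 i k
    exact restr_famDs_of_velocity (hv i k)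
  rw [map_sub, map_nsmul, restr_famDx, hE, HahnSeries.coeff_single_mul, sub_zero] at hvar
  have htr : restr 0 ((matD famDs (famMat hU)) * ((S * serJ Fam n * T) ^ j).coeff 0).trace =
      (v.1 * Y0 j u).trace := by
    rw [hY0, ← hvel, ← Matrix.map_mul, Matrix.trace, Matrix.trace, map_sum]
    rfl
  rw [htr] at hvar
  -- The total `x`-derivative integrates to zero over the circle, and the velocity, lying in `V_n`,
  -- sees only `π₀` of `Y_{j,0}`.
  have hint : (n : ℝ) * oint (restr 0 (famDs (f j))) = pairing (piZero (Y0 j u)).1 v.1 := by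
    rw [← oint_smul, Nat.cast_smul_eq_nsmul ℝ, hvar, oint_sub, oint_dxD, sub_zero, pairing_comm]
    refine pairing_of_isVMat (isVMat_coe v) fun k hk => ?_
    exact (if_pos ⟨lastIdx_val, hk⟩).symm
  rw [← hint]
  exact (hasDerivAt_oint (f j) 0).const_mul _

end Gradient

/-! ### Moving frames over a differential ring -/

section Frames

variable {R : Type*} [CommRing R] [Algebra ℝ R] {n : ℕ} [NeZero n]

theorem derivation_prod {ι : Type*} [DecidableEq ι] (D : Derivation ℝ R R) (s : Finset ι)
    (f : ι → R) :
    D (∏ i ∈ s, f i) = ∑ j ∈ s, ∏ i ∈ s, Function.update f j (D (f j)) i := by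
  induction s using Finset.induction_on with
  | empty => simp
  | insert a s ha ih =>
    rw [Finset.prod_insert ha, Finset.sum_insert ha, D.leibniz, ih, Finset.prod_insert ha,
      Function.update_self, smul_eq_mul, smul_eq_mul, Finset.mul_sum, add_comm]
    congr 1
    · rw [mul_comm]
      congr 1
      refine Finset.prod_congr rfl fun i hi => ?_
      have h : i ≠ a := fun h => ha (h ▸ hi)
      rw [Function.update_of_ne h]
    · refine Finset.sum_congr rfl fun j hj => ?_
      have h : a ≠ j := fun h => ha (h ▸ hj)
      rw [Finset.prod_insert ha, Function.update_of_ne h]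

theorem derivation_det (D : Derivation ℝ R R) (M : Matrix (Fin n) (Fin n) R) :
    D M.det = ∑ j, (M.updateCol j fun i => D (M i j)).det := by
  simp only [Matrix.det_apply', map_sum]
  rw [Finset.sum_comm]
  refine Finset.sum_congr rfl fun σ _ => ?_
  rw [D.leibniz, D.map_intCast, smul_zero, add_zero, derivation_prod, smul_eq_mul, Finset.mul_sum]
  refine Finset.sum_congr rfl fun j _ => ?_
  congr 1
  refine Finset.prod_congr rfl fun i _ => ?_
  rw [Matrix.updateCol_apply, Function.update_apply]
  split_ifs with h
  · rw [h]
  · rfl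

/-- The moving frame `(γ, γ_x, …, γ_x^{(n-1)})` over a differential ring. -/
def gframe (D : Derivation ℝ R R) (γ : Fin n → R) : Matrix (Fin n) (Fin n) R :=
  fun i j => D^[(j : ℕ)] (γ i)

/-- The curvature matrix over a differential ring. -/
def curv (D : Derivation ℝ R R) (γ : Fin n → R) : Matrix (Fin n) (Fin n) R :=
  fun i j => if (i : ℕ) + 1 < n ∧ (j : ℕ) + 1 = n then
    ((gframe D γ).updateCol i fun k => D^[n] (γ k)).det else 0

theorem isVMat_curv (D : Derivation ℝ R R) (γ : Fin n → R) : IsVMat (curv D γ) :=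
  fun _ _ h => if_neg h

/-- Differentiate `det g = 1`. Differentiating any column but the last repeats the next one, so only
the term with `γ_x^{(n)}` in the last column remains. -/
theorem det_updateCol_last {D : Derivation ℝ R R} {γ : Fin n → R} (h : (gframe D γ).det = 1) :
    ((gframe D γ).updateCol (lastIdx n) fun k => D^[n] (γ k)).det = 0 := by
  have h1 := derivation_det D (gframe D γ)
  have hl := lastIdx_val (n := n)
  rw [h, D.map_one_eq_zero, Finset.sum_eq_single (lastIdx n)] at h1
  · rw [h1]
    congr 2
    funext k
    rw [gframe, ← Function.iterate_succ_apply' D, Nat.succ_eq_add_one, hl]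
  · intro j _ hj
    have hj1 : (j : ℕ) + 1 < n := by
      by_contra h'
      exact hj (eq_lastIdx (by have := j.2; omega))
    have hne : j ≠ ⟨j + 1, hj1⟩ := fun h' => by
      have := congrArg Fin.val h'
      simp only at this
      omega
    refine Matrix.det_zero_of_column_eq hne fun k => ?_
    rw [Matrix.updateCol_self, Matrix.updateCol_ne hne.symm, gframe, gframe,
      ← Function.iterate_succ_apply' D]
  · intro h'; exact absurd (Finset.mem_univ _) h'

/-- `g_x = g (b + u)`. -/
theorem gframe_deriv {D : Derivation ℝ R R} {γ : Fin n → R} (h : (gframe D γ).det = 1) :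
    matD D (gframe D γ) = gframe D γ * (lowerShift R n + curv D γ) := by
  ext i j
  have e : matD D (gframe D γ) i j = D^[(j : ℕ) + 1] (γ i) := by
    rw [Function.iterate_succ_apply']; rfl
  rw [e]
  by_cases hj : (j : ℕ) + 1 < n
  · rw [mul_shift_apply (isVMat_curv D γ) _ i j hj]; rfl
  -- For the last column, Cramer's rule expands `γ_x^{(n)}` in the frame; the coefficients are the
  -- `u_i`, and that of `γ_x^{(n-1)}` vanishes.
  · have hj' : (j : ℕ) + 1 = n := by have := j.2; omega
    have hc := congrFun (Matrix.mulVec_cramer (gframe D γ) fun k => D^[n] (γ k)) i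
    rw [h, one_smul] at hc
    rw [hj', ← hc, Matrix.mul_apply, Matrix.mulVec, dotProduct]
    refine Finset.sum_congr rfl fun l _ => ?_
    congr 1
    rw [Matrix.add_apply, lowerShift, if_neg (by have := l.2; omega), zero_add, curv,
      Matrix.cramer_apply]
    split_ifs with hl
    · rfl
    · rw [show l = lastIdx n from eq_lastIdx (by have := l.2; omega), det_updateCol_last h]

theorem matD_mul (D : Derivation ℝ R R) (A B : Matrix (Fin n) (Fin n) R) :
    matD D (A * B) = matD D A * B + A * matD D B := by
  ext i j
  change D ((A * B) i j) = _
  rw [Matrix.mul_apply, map_sum, Matrix.add_apply, Matrix.mul_apply, Matrix.mul_apply,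
    ← Finset.sum_add_distrib]
  refine Finset.sum_congr rfl fun k _ => ?_
  change D (A i k * B k j) = D (A i k) * B k j + A i k * D (B k j)
  rw [D.leibniz, smul_eq_mul, smul_eq_mul]
  ring

theorem matD_lowerShift (D : Derivation ℝ R R) : matD D (lowerShift R n) = 0 := by
  ext i j
  change D (lowerShift R n i j) = 0
  rw [lowerShift]
  split_ifs <;> simp

/-- Since `g_x = g (b + u)`, differentiating `g c` amounts to applying `∂ + b + u` to the
coordinates `c`. -/
theorem iterate_gframe_mulVec {D : Derivation ℝ R R} {γ : Fin n → R} (h : (gframe D γ).det = 1)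
    (c : Fin n → R) (k : ℕ) (i : Fin n) : D^[k] ((gframe D γ).mulVec c i) =
      (gframe D γ).mulVec ((colOp D (lowerShift R n + curv D γ))^[k] c) i := by
  have step : ∀ (d : Fin n → R) (i : Fin n), D ((gframe D γ).mulVec d i) =
      (gframe D γ).mulVec (colOp D (lowerShift R n + curv D γ) d) i := fun d i => by
    have e : colOp D (lowerShift R n + curv D γ) d =
        (fun k => D (d k)) + (lowerShift R n + curv D γ).mulVec d := rfl
    have hg := fun l => congrFun (congrFun (gframe_deriv h) i) l
    rw [e, Matrix.mulVec_add, Matrix.mulVec_mulVec, Pi.add_apply, Matrix.mulVec, Matrix.mulVec,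
      Matrix.mulVec, dotProduct, dotProduct, dotProduct, map_sum, ← Finset.sum_add_distrib]
    refine Finset.sum_congr rfl fun l _ => ?_
    rw [← hg, D.leibniz, smul_eq_mul, smul_eq_mul, mul_comm (d l)]
    rfl
  induction k with
  | zero => rfl
  | succ k ih => rw [Function.iterate_succ_apply', ih, step, Function.iterate_succ_apply']

theorem gframe_mulVec {D : Derivation ℝ R R} {γ : Fin n → R} (h : (gframe D γ).det = 1)
    (c : Fin n → R) : gframe D ((gframe D γ).mulVec c) =
      gframe D γ * krylov D (lowerShift R n + curv D γ) c := by
  ext i j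
  exact iterate_gframe_mulVec h c j i

/-- By Cramer's rule, replacing the `i`-th column of `g` by that of `g C` gives the determinant `C i
i`. The tangency condition thus becomes `tr C = 0`. -/
theorem sum_det_updateCol {g : Matrix (Fin n) (Fin n) R} (h : g.det = 1)
    (C : Matrix (Fin n) (Fin n) R) :
    ∑ i, (g.updateCol i fun k => (g * C) k i).det = C.trace := by
  have e : C = g.adjugate * (g * C) := by
    rw [← mul_assoc, Matrix.adjugate_mul, h, one_smul, one_mul]
  conv_rhs => rw [e]
  rw [Matrix.trace]
  refine Finset.sum_congr rfl fun i _ => ?_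
  rw [← Matrix.cramer_apply, Matrix.cramer_eq_adjugate_mulVec]
  rfl

theorem matD_gframe {D E : Derivation ℝ R R} (hDE : ∀ r, D (E r) = E (D r)) (γ : Fin n → R) :
    matD E (gframe D γ) = gframe D fun i => E (γ i) := by
  ext i j
  exact ((show Function.Commute D E from hDE).iterate_left j (γ i)).symm

/-- The evolution of the curvature: `u_t = [∂_x + b + u, C]` if `g_t = g C`. -/
theorem curv_variation {D E : Derivation ℝ R R} (hDE : ∀ r, D (E r) = E (D r)) {γ : Fin n → R}
    (h : (gframe D γ).det = 1) {C : Matrix (Fin n) (Fin n) R}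
    (hC : gframe D (fun i => E (γ i)) = gframe D γ * C) :
    matD E (curv D γ) = covDer D (lowerShift R n + curv D γ) C := by
  have hg := gframe_deriv h
  have hE := matD_gframe hDE γ
  rw [hC] at hE
  set g := gframe D γ with hgdef
  -- Compatibility of `g_x = g (b + u)` with `g_t = g C`.
  have hcomm : matD E (matD D g) = matD D (matD E g) := by
    ext i j
    exact (hDE _).symm
  rw [hg, hE, matD_mul, matD_mul, hE, hg, map_add, matD_lowerShift, zero_add] at hcomm
  have hadj : g.adjugate * g = 1 := by rw [Matrix.adjugate_mul, h, one_smul]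
  have h2 : g * matD E (curv D γ) = g * covDer D (lowerShift R n + curv D γ) C := by
    rw [covDer, mul_add, mul_sub, ← mul_assoc, ← mul_assoc]
    rw [← sub_eq_zero] at hcomm ⊢
    rw [← hcomm]
    abel
  have h3 := congrArg (fun M => g.adjugate * M) h2
  simpa only [← mul_assoc, hadj, one_mul] using h3

/-- Multiplying a curve by a function. -/
theorem det_gframe_mul (D : Derivation ℝ R R) (φ : R) (γ : Fin n → R) :
    (gframe D fun i => φ * γ i).det = φ ^ n * (gframe D γ).det := by
  -- By the Leibniz rule the `k`-th derivative of `φ γ` combines `γ, …, γ_x^{(k)}` with top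
  -- coefficient `φ`. So the new frame is the old one times an upper triangular matrix with diagonal
  -- `φ`.
  have key : ∀ k : ℕ, ∃ a : ℕ → R, a k = φ ∧ (∀ l, k < l → a l = 0) ∧
      ∀ i, D^[k] (φ * γ i) = ∑ l ∈ Finset.range (k + 1), D^[l] (γ i) * a l := by
    intro k
    induction k with
    | zero =>
      refine ⟨fun l => if l = 0 then φ else 0, if_pos rfl, fun l hl => if_neg (by omega), fun i => ?_⟩
      simp [mul_comm]
    | succ k ih =>
      obtain ⟨a, h1, h2, h3⟩ := ih
      refine ⟨fun l => D (a l) + if l = 0 then 0 else a (l - 1), ?_, fun l hl => ?_, fun i => ?_⟩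
      · simp only [h2 (k + 1) (by omega), map_zero, Nat.succ_ne_zero, if_false, zero_add,
          Nat.add_sub_cancel, h1]
      · simp only [h2 l (by omega), map_zero, zero_add]
        rw [if_neg (by omega), h2 _ (by omega)]
      · rw [Function.iterate_succ_apply', h3, map_sum]
        have e : ∀ l, D (D^[l] (γ i) * a l) = D^[l] (γ i) * D (a l) + D^[l + 1] (γ i) * a l :=
          fun l => by
            rw [D.leibniz, smul_eq_mul, smul_eq_mul, Function.iterate_succ_apply']; ring
        simp only [e, mul_add, Finset.sum_add_distrib]
        rw [Finset.sum_range_succ (fun l => D^[l] (γ i) * D (a l)) (k + 1),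
          h2 (k + 1) (by omega), map_zero, mul_zero, add_zero,
          Finset.sum_range_succ' (fun l => D^[l] (γ i) * if l = 0 then 0 else a (l - 1)) (k + 1)]
        simp
  choose a h1 h2 h3 using key
  let U : Matrix (Fin n) (Fin n) R := fun l k => a k l
  have hU : gframe D (fun i => φ * γ i) = gframe D γ * U := by
    ext i k
    rw [Matrix.mul_apply]
    change D^[(k : ℕ)] (φ * γ i) = ∑ l : Fin n, D^[(l : ℕ)] (γ i) * a k l
    rw [h3, Fin.sum_univ_eq_sum_range (fun l => D^[l] (γ i) * a k l)]
    refine Finset.sum_subset (fun l hl => ?_) fun l _ hl => ?_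
    · rw [Finset.mem_range] at *
      have := k.2
      omega
    · rw [Finset.mem_range] at hl
      rw [h2 k l (by omega), mul_zero]
  have hdet : U.det = φ ^ n := by
    rw [Matrix.det_of_isUpperTriangular]
    · have : ∀ i ∈ Finset.univ, U i i = φ := fun i _ => h1 i
      rw [Finset.prod_congr rfl this]
      simp
    · intro l k hkl
      exact h2 k l hkl
  rw [hU, Matrix.det_mul, hdet, mul_comm]

/-! ### Frames and curvatures under base change -/

section FrameMap

variable {R' : Type*} [CommRing R'] [Algebra ℝ R'] {φ : R →+* R'} {D : Derivation ℝ R R}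
  {D' : Derivation ℝ R' R'}

theorem map_iterate (hφ : ∀ r, φ (D r) = D' (φ r)) (k : ℕ) (r : R) :
    φ (D^[k] r) = D'^[k] (φ r) :=
  (show Function.Semiconj φ D D' from hφ).iterate_right k r

theorem gframe_map (hφ : ∀ r, φ (D r) = D' (φ r)) (γ : Fin n → R) :
    (gframe D γ).map φ = gframe D' fun i => φ (γ i) := by
  ext i j
  exact map_iterate hφ j (γ i)

theorem det_gframe_map (hφ : ∀ r, φ (D r) = D' (φ r)) (γ : Fin n → R) :
    φ (gframe D γ).det = (gframe D' fun i => φ (γ i)).det := by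
  rw [← gframe_map hφ, RingHom.map_det]; rfl

theorem curv_map (hφ : ∀ r, φ (D r) = D' (φ r)) (γ : Fin n → R) :
    (curv D γ).map φ = curv D' fun i => φ (γ i) := by
  ext i j
  rw [Matrix.map_apply, curv, curv]
  split_ifs
  · rw [RingHom.map_det, ← gframe_map hφ]
    congr 1
    ext k l
    rw [RingHom.mapMatrix_apply, Matrix.map_apply, Matrix.updateCol_apply, Matrix.updateCol_apply]
    split_ifs
    · exact map_iterate hφ n (γ k)
    · rfl
  · exact map_zero φ

end FrameMap

end Frames

/-! ### Paths in the space of curves -/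

section Paths

variable {n : ℕ} [NeZero n]

/-- A loop as a constant family. -/
def constFam (f : Loop) : Fam :=
  ⟨fun p => f.1 p.2, f.2.1.comp contDiff_snd, fun p => f.2.2 p.2⟩

/-- A function of the parameter as a family. -/
def paramFam (σ : ℝ → ℝ) (h : ContDiff ℝ ∞ σ) : Fam :=
  ⟨fun p => σ p.1, h.comp contDiff_fst, fun p => by
    change σ (p.1 + 0) = σ p.1
    rw [add_zero]⟩

/-- The family of curves `γ + σ(s) X`. -/
def lineFam (σ : ℝ → ℝ) (h : ContDiff ℝ ∞ σ) (γ X : Fin n → Loop) (i : Fin n) : Fam :=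
  constFam (γ i) + paramFam σ h * constFam (X i)

theorem restr_lineFam_zero (σ : ℝ → ℝ) (h : ContDiff ℝ ∞ σ) (γ X : Fin n → Loop) {s : ℝ}
    (hs : σ s = 0) (i : Fin n) : restr s (lineFam σ h γ X i) = γ i :=
  Subtype.ext <| funext fun x => by
    change (γ i).1 x + σ s * (X i).1 x = _
    rw [hs, zero_mul, add_zero]

theorem restr_famDs_lineFam {σ : ℝ → ℝ} (h : ContDiff ℝ ∞ σ) (γ X : Fin n → Loop)
    (hσ : HasDerivAt σ 1 0) (i : Fin n) : restr 0 (famDs (lineFam σ h γ X i)) = X i :=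
  restr_famDs_of_velocity fun x => by
    have := (hσ.mul_const ((X i).1 x)).const_add ((γ i).1 x)
    rw [one_mul] at this
    exact this

theorem restr_det_gframe (s : ℝ) (γ : Fin n → Fam) :
    restr s (gframe famDx γ).det = (gframe dxD fun i => restr s (γ i)).det :=
  det_gframe_map (restr_famDx s) γ

/-- The variation of the determinant of the frame. -/
theorem restr_famDs_det_gframe (γ : Fin n → Fam) :
    restr 0 (famDs (gframe famDx γ).det) = ∑ j : Fin n,
      ((gframe dxD fun i => restr 0 (γ i)).updateCol j
        fun i => dxD^[(j : ℕ)] (restr 0 (famDs (γ i)))).det := by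
  rw [derivation_det, map_sum]
  refine Finset.sum_congr rfl fun j _ => ?_
  rw [RingHom.map_det]
  congr 1
  ext1 k l
  rw [RingHom.mapMatrix_apply, Matrix.map_apply, Matrix.updateCol_apply, Matrix.updateCol_apply]
  split_ifs
  · rw [← map_iterate (restr_famDx 0)]
    congr 1
    exact congrFun (congrFun (matD_gframe (famD_comm (0, 1) (1, 0)) γ) k) j
  · exact map_iterate (restr_famDx 0) l (γ k)

theorem Loop.pos_of_Icc {f : Loop} (h : ∀ x ∈ Set.Icc 0 (2 * Real.pi), 0 < f.1 x) (x : ℝ) :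
    0 < f.1 x := by
  obtain ⟨y, hy, hxy⟩ := f.2.2.exists_mem_Ico₀ (by positivity : (0 : ℝ) < 2 * Real.pi) x
  rw [hxy]
  exact h y ⟨hy.1, hy.2.le⟩

theorem exists_pos_of_restr_zero {P : Fam} (h : restr 0 P = 1) :
    ∃ ε > 0, ∀ t, |t| ≤ ε → ∀ x, 0 < (restr t P).1 x := by
  have h1 : ∀ᶠ t in nhds (0 : ℝ), ∀ x ∈ Set.Icc 0 (2 * Real.pi), 0 < P.1 (t, x) := by
    refine isCompact_Icc.eventually_forall_of_forall_eventually fun x _ => ?_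
    have h2 : P.1 (0, x) = 1 := congrFun (congrArg Subtype.val h) x
    exact P.2.1.continuous.continuousAt.eventually (lt_mem_nhds (by rw [h2]; exact one_pos))
  obtain ⟨ε, hε, hb⟩ := Metric.eventually_nhds_iff.1 h1
  refine ⟨ε / 2, by positivity, fun t ht => Loop.pos_of_Icc (hb ?_)⟩
  rw [Real.dist_eq, sub_zero]
  linarith

/-- A cutoff of the identity. -/
theorem exists_bounded_param {ε : ℝ} (hε : 0 < ε) :
    ∃ σ : ℝ → ℝ, ContDiff ℝ ∞ σ ∧ σ 0 = 0 ∧ HasDerivAt σ 1 0 ∧ ∀ s, |σ s| ≤ ε := by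
  refine ⟨fun s => ε * Real.sin (s / ε), contDiff_const.mul
    (Real.contDiff_sin.comp (contDiff_id.div_const ε)), by simp, ?_, fun s => ?_⟩
  · have h := (((hasDerivAt_id (0 : ℝ)).div_const ε).sin).const_mul ε
    simpa [hε.ne'] using h
  · rw [abs_mul, abs_of_pos hε]
    exact mul_le_of_le_one_right hε.le (Real.abs_sin_le_one _)

theorem exists_root {W : Fam} (hW : ∀ p, 0 < W.1 p) : ∃ φ : Fam, φ ^ n * W = 1 ∧
    ∀ p, W.1 p = 1 → φ.1 p = 1 := by
  have hn : (n : ℝ) ≠ 0 := Nat.cast_ne_zero.2 (NeZero.ne n)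
  refine ⟨⟨fun p => W.1 p ^ (-(n : ℝ)⁻¹), W.2.1.rpow_const_of_ne fun p => (hW p).ne', fun p => ?_⟩,
    Subtype.ext (funext fun p => ?_), fun p hp => ?_⟩
  · have := W.2.2 p
    simp only [this]
  · change (W.1 p ^ (-(n : ℝ)⁻¹)) ^ n * W.1 p = 1
    rw [← Real.rpow_natCast, ← Real.rpow_mul (hW p).le, neg_mul, inv_mul_cancel₀ hn,
      Real.rpow_neg_one, inv_mul_cancel₀ (hW p).ne']
  · simp only [hp, Real.one_rpow]

/-- The line `γ + σ(s) X` is rescaled by `W ^ (-1/n)`, where `W` is the determinant of its frame.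
The bound on `σ` keeps `W` positive for all `s`. Tangency of `X` means that `W` is stationary at `s
= 0`, so the rescaling does not change the velocity. -/
theorem exists_isPath {γ : Curves n} {X : Fin n → Loop} (hX : IsTangent γ X) :
    ∃ c, IsPath γ X c := by
  have hγ : (gframe dxD γ.1).det = 1 := γ.2
  obtain ⟨ε, hε, hpos⟩ := exists_pos_of_restr_zero
    (P := (gframe famDx (lineFam id contDiff_id γ.1 X)).det) (by
      have h0 : (fun i => restr 0 (lineFam id contDiff_id γ.1 X i)) = γ.1 :=
        funext fun i => restr_lineFam_zero id contDiff_id γ.1 X rfl i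
      rw [restr_det_gframe, h0, hγ])
  obtain ⟨σ, hσ, hσ0, hσd, hσb⟩ := exists_bounded_param hε
  set ℓ := lineFam σ hσ γ.1 X with hℓ
  have hℓ0 : (fun i => restr 0 (ℓ i)) = γ.1 := funext fun i => restr_lineFam_zero σ hσ γ.1 X hσ0 i
  have hℓd : ∀ i, restr 0 (famDs (ℓ i)) = X i := restr_famDs_lineFam hσ γ.1 X hσd
  set W := (gframe famDx ℓ).det with hW
  have hW0 : restr 0 W = 1 := by rw [hW, restr_det_gframe, hℓ0, hγ]
  have hWd : restr 0 (famDs W) = 0 := by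
    rw [hW, restr_famDs_det_gframe, hℓ0]
    simp only [hℓd]
    exact hX
  have hWpos : ∀ p, 0 < W.1 p := by
    intro p
    have h1 : restr p.1 W =
        restr (σ p.1) (gframe famDx (lineFam id contDiff_id γ.1 X)).det := by
      rw [hW, restr_det_gframe, restr_det_gframe]
      rfl
    have h2 := hpos (σ p.1) (hσb _) p.2
    rw [← h1] at h2
    exact h2
  obtain ⟨φ, hφ, hφ1⟩ := exists_root (n := n) hWpos
  have hφ0 : restr 0 φ = 1 := Subtype.ext <| funext fun x =>
    hφ1 (0, x) (congrFun (congrArg Subtype.val hW0) x)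
  have hφd : restr 0 (famDs φ) = 0 := by
    -- Differentiating `φ ^ n W = 1` at `s = 0`, where `φ = W = 1` and `W` is stationary, leaves `n`
    -- times the derivative of `φ`.
    have h := congrArg (fun f => restr 0 (famDs f)) hφ
    simp only [Derivation.leibniz, Derivation.leibniz_pow, Derivation.map_one_eq_zero, map_add,
      smul_eq_mul, map_mul, map_pow, map_nsmul, hφ0, hW0, hWd, one_pow, one_mul, map_zero,
      zero_add, mul_zero] at h
    exact eq_zero_of_nsmul h
  have hdet : ∀ s, (frame fun i => restr s (φ * ℓ i)).det = 1 := fun s => by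
    have := restr_det_gframe s fun i => φ * ℓ i
    rw [det_gframe_mul, ← hW, hφ, map_one] at this
    exact this.symm
  refine ⟨fun s => ⟨fun i => restr s (φ * ℓ i), hdet s⟩, fun i => smoothFamily_restr _,
    Subtype.ext (funext fun i => ?_), fun i x => ?_⟩
  · change restr 0 (φ * ℓ i) = γ.1 i
    rw [map_mul, hφ0, one_mul]
    exact congrFun hℓ0 i
  · have h := hasDerivAt_restr (φ * ℓ i) 0 x
    rw [Derivation.leibniz, map_add, smul_eq_mul, smul_eq_mul, map_mul, map_mul, hφ0, hφd, hℓd,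
      mul_zero, one_mul, add_zero] at h
    exact h

theorem matD_map {R R' : Type*} [CommRing R] [Algebra ℝ R] [CommRing R'] [Algebra ℝ R']
    {φ : R →+* R'} {D : Derivation ℝ R R} {D' : Derivation ℝ R' R'} (hφ : ∀ r, φ (D r) = D' (φ r))
    (C : Matrix (Fin n) (Fin n) R) : (matD D C).map φ = matD D' (C.map φ) := by
  ext i j
  exact hφ _

theorem covDer_map {R R' : Type*} [CommRing R] [Algebra ℝ R] [CommRing R'] [Algebra ℝ R']
    {φ : R →+* R'} {D : Derivation ℝ R R} {D' : Derivation ℝ R' R'} (hφ : ∀ r, φ (D r) = D' (φ r))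
    (M C : Matrix (Fin n) (Fin n) R) :
    (covDer D M C).map φ = covDer D' (M.map φ) (C.map φ) := by
  rw [covDer, covDer, ← matD_map hφ, ← Matrix.map_mul, ← Matrix.map_mul]
  ext i j
  simp only [Matrix.map_apply, Matrix.add_apply, Matrix.sub_apply, map_add, map_sub]

theorem lowerShift_map {R R' : Type*} [CommRing R] [Algebra ℝ R] [CommRing R'] [Algebra ℝ R']
    (φ : R →+* R') : (lowerShift R n).map φ = lowerShift R' n := by
  ext i j
  rw [Matrix.map_apply, lowerShift, lowerShift]
  split_ifs
  · exact map_one φ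
  · exact map_zero φ

theorem Psi_coe (γ : Curves n) : (Psi γ).1 = curv dxD γ.1 := rfl

theorem Psi_eq_restr {c : ℝ → Curves n} (h : ∀ i, SmoothFamily fun s => (c s).1 i) (s : ℝ)
    (i j : Fin n) :
    (Psi (c s)).1 i j = restr s (curv famDx (fun i => toFam _ (h i)) i j) :=
  (congrFun (congrFun (curv_map (restr_famDx s) fun i => toFam _ (h i)) i) j).symm

/-- If `γ_t = X` and the frame of `X` is `g C`, then `u_t = [∂_x + b + u, C]`. -/
theorem hasVelocity_Psi {γ : Curves n} {X : Fin n → Loop} {c : ℝ → Curves n} (h : IsPath γ X c)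
    {C : MLoop n} (hC : gframe dxD X = gframe dxD γ.1 * C) (i j : Fin n) :
    HasVelocity (fun s => (Psi (c s)).1 i j)
      (covDer dxD (lowerShift Loop n + (Psi γ).1) C i j) := by
  obtain ⟨hs, h0, hv⟩ := h
  set δ : Fin n → Fam := fun i => toFam _ (hs i) with hδ
  have hδ0 : (fun i => restr 0 (δ i)) = γ.1 := by rw [← h0]; rfl
  have hδd : (fun i => restr 0 (famDs (δ i))) = X :=
    funext fun i => restr_famDs_of_velocity (hv i)
  have hdet : (gframe famDx δ).det = 1 := fam_ext fun s => by
    rw [restr_det_gframe, map_one]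
    exact (c s).2
  -- The logarithmic derivative `g⁻¹ g_s` along the whole family, the adjugate being the inverse
  -- since the determinant is `1`. At `s = 0` it restricts to `C`.
  set E := (gframe famDx δ).adjugate * gframe famDx fun i => famDs (δ i) with hE
  have hgE : gframe famDx (fun i => famDs (δ i)) = gframe famDx δ * E := by
    rw [hE, ← mul_assoc, Matrix.mul_adjugate, hdet, one_smul, one_mul]
  have hγ : (gframe dxD γ.1).det = 1 := γ.2
  have hEC : E.map (restr 0) = C := by
    have h1 := congrArg (fun M : Matrix (Fin n) (Fin n) Fam => M.map (restr 0)) hgE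
    simp only [Matrix.map_mul, gframe_map (restr_famDx 0), hδ0, hδd, hC] at h1
    have h2 := congrArg (fun M => (gframe dxD γ.1).adjugate * M) h1
    simp only [← mul_assoc, Matrix.adjugate_mul, hγ, one_smul, one_mul] at h2
    exact h2.symm
  have hvar := congrArg (fun M : Matrix (Fin n) (Fin n) Fam => M.map (restr 0))
    (curv_variation (famD_comm (0, 1) (1, 0)) hdet hgE)
  simp only [covDer_map (restr_famDx 0), hEC] at hvar
  have hB : (lowerShift Fam n + curv famDx δ).map (restr 0) =
      lowerShift Loop n + (Psi γ).1 := by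
    rw [Psi_coe, ← hδ0, ← curv_map (restr_famDx 0), ← lowerShift_map (restr 0)]
    ext1 i j
    exact map_add (restr 0) _ _
  rw [hB] at hvar
  have he : (fun s => (Psi (c s)).1 i j) = fun s => restr s (curv famDx δ i j) :=
    funext fun s => Psi_eq_restr hs s i j
  rw [he, ← hvar]
  exact fun x => hasDerivAt_restr _ 0 x

theorem grad_spec {F : VLoop n → ℝ} (hF : IsSmoothFunctional F) (u : VLoop n) :
    HasGrad F u (grad F u) := by
  obtain ⟨ξ, hξ⟩ := hF u
  rw [hξ.grad_eq]
  exact hξ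

/-- A curve flow whose velocity has the frame `g Z`, where `Z` is trace free and
`[∂_x + b + u, Z] ∈ V_n`. -/
theorem flow_of_firstColumn {γ : Curves n} {Z : MLoop n} (ht : Z.trace = 0)
    (hZ : IsVMat (covDer dxD (lowerShift Loop n + (Psi γ).1) Z)) {X : Fin n → Loop}
    (hX : X = (gframe dxD γ.1).mulVec fun i => Z i 0) :
    IsTangent γ X ∧ ∀ F : VLoop n → ℝ, IsSmoothFunctional F →
      HasDiff (F ∘ Psi) γ X (pairing (grad F (Psi γ)).1
        (covDer dxD (lowerShift Loop n + (Psi γ).1) Z)) := by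
  have hγ : (gframe dxD γ.1).det = 1 := γ.2
  have hC : gframe dxD X = gframe dxD γ.1 * Z := by
    have h1 := (isVMat_coe (Psi γ)).eq_krylov hZ
    rw [hX, gframe_mulVec hγ]
    exact congrArg _ h1.symm
  have htan : IsTangent γ X := by
    have h1 := sum_det_updateCol hγ Z
    rw [ht, ← hC] at h1
    exact h1
  refine ⟨htan, fun F hF => ⟨exists_isPath htan, fun c hc => ?_⟩⟩
  exact grad_spec hF (Psi γ) (fun s => Psi (c s)) ⟨_, hZ⟩
    (fun i j => by
      simp only [Psi_eq_restr hc.1]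
      exact smoothFamily_restr _)
    (by simp only [hc.2.1]) fun i j => hasVelocity_Psi hc hC i j

end Paths

/-! ### Hamiltonian flows -/

section Brackets

variable {R : Type*} [CommRing R] [Algebra ℝ R] {n : ℕ} [NeZero n]

theorem covDer_neg (D : Derivation ℝ R R) (B C : Matrix (Fin n) (Fin n) R) :
    covDer D B (-C) = -covDer D B C := by
  rw [covDer, covDer, map_neg]
  noncomm_ring

theorem covDer_sub (D : Derivation ℝ R R) (B C C' : Matrix (Fin n) (Fin n) R) :
    covDer D B (C - C') = covDer D B C - covDer D B C' := by
  rw [covDer, covDer, covDer, map_sub]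
  noncomm_ring

theorem trace_covDer_mul (D : Derivation ℝ R R) (B C C' : Matrix (Fin n) (Fin n) R) :
    (covDer D B C * C').trace + (C * covDer D B C').trace = D (C * C').trace := by
  have h1 : covDer D B C * C' + C * covDer D B C' = covDer D B (C * C') := by
    rw [covDer, covDer, covDer, matD_mul]
    noncomm_ring
  rw [← Matrix.trace_add, h1, trace_covDer]

theorem trace_strictUpper_mul {ζ M : Matrix (Fin n) (Fin n) R} (hζ : ∀ i j : Fin n, j ≤ i → ζ i j = 0)
    (hM : IsVMat M) : (ζ * M).trace = 0 := by
  refine Finset.sum_eq_zero fun i _ => ?_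
  rw [Matrix.diag_apply, Matrix.mul_apply]
  refine Finset.sum_eq_zero fun k _ => ?_
  by_cases hk : k ≤ i
  · rw [hζ i k hk, zero_mul]
  · rw [hM k i, mul_zero]
    rw [Fin.le_def] at hk
    have := k.2
    omega

/-- `e_{1n} ζ` carries the last row of `ζ` and `ζ e_{1n}` its first column; both vanish. -/
theorem corner_comm_strictUpper {ζ : Matrix (Fin n) (Fin n) R}
    (hζ : ∀ i j : Fin n, j ≤ i → ζ i j = 0) :
    cornerMat R n * ζ - ζ * cornerMat R n = 0 := by
  have h1 : cornerMat R n * ζ = 0 := by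
    ext i j
    rw [Matrix.mul_apply]
    refine Finset.sum_eq_zero fun k _ => ?_
    by_cases h : (i : ℕ) = 0 ∧ (k : ℕ) + 1 = n
    · rw [hζ k j (by rw [Fin.le_def]; omega), mul_zero]
    · rw [cornerMat, if_neg h, zero_mul]
  have h2 : ζ * cornerMat R n = 0 := by
    ext i j
    rw [Matrix.mul_apply]
    refine Finset.sum_eq_zero fun k _ => ?_
    by_cases h : (k : ℕ) = 0 ∧ (j : ℕ) + 1 = n
    · rw [hζ i k (by rw [Fin.le_def]; omega), zero_mul]
    · rw [cornerMat, if_neg h, mul_zero]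
  rw [h1, h2, sub_zero]

theorem corner_comm_sub {Y ζ : Matrix (Fin n) (Fin n) R}
    (hζ : ∀ i j : Fin n, j ≤ i → ζ i j = 0) :
    cornerMat R n * (-(Y - ζ)) - (-(Y - ζ)) * cornerMat R n =
      -(cornerMat R n * Y - Y * cornerMat R n) := by
  rw [← sub_zero (-(cornerMat R n * Y - Y * cornerMat R n)),
    ← neg_zero, ← corner_comm_strictUpper hζ]
  noncomm_ring

theorem IsP.neg {u : VLoop n} {v : VtLoop n} {C : MLoop n} (h : IsP u v C) : IsP u (-v) (-C) := by
  rw [isP_iff] at h ⊢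
  obtain ⟨h1, h2, h3⟩ := h
  refine ⟨?_, fun j hj => ?_, ?_⟩
  · rw [Matrix.trace_neg, h1, neg_zero]
  · exact congrArg Neg.neg (h2 j hj)
  · rw [covDer_neg]
    intro i j hij
    rw [Matrix.neg_apply, h3 i j hij, neg_zero]

/-- Only the last row of `P_u (ξ)` is seen by `M`, and that row is `ξ` by construction. -/
theorem pairing_isVMat_Pop {u : VLoop n} {M : MLoop n} (hM : IsVMat M) (ξ : VtLoop n) :
    pairing M (Pop u ξ) = pairing ξ.1 M := by
  rw [pairing_comm ξ.1]
  exact pairing_of_isVMat hM fun j hj => (((isP_iff _ _ _).1 (isP_Pop u ξ)).2.1 j hj)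

theorem bracket2_eq {H : VLoop n → ℝ} {u : VLoop n} {ξ : VtLoop n} {Z : MLoop n}
    (h : HasGrad H u ξ) (hZ : IsP u ξ Z) (F : VLoop n → ℝ) : bracket2 H F u =
      pairing (grad F u).1 (covDer dxD (lowerShift Loop n + u.1) Z) := by
  rw [bracket2, h.grad_eq, ← hZ.eq_Pop]
  exact pairing_isVMat_Pop ((isP_iff _ _ _).1 hZ).2.2 _

theorem isHamiltonianFlow_bracket2 {H : VLoop n → ℝ} {X : Curves n → Fin n → Loop}
    (ξ : VLoop n → VtLoop n) (Z : VLoop n → MLoop n) (hH : ∀ u, HasGrad H u (ξ u))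
    (hZ : ∀ u, IsP u (ξ u) (Z u))
    (hX : ∀ γ, X γ = (gframe dxD γ.1).mulVec fun i => Z (Psi γ) i 0) :
    IsHamiltonianFlow bracket2 H X := by
  refine ⟨fun u => ⟨_, hH u⟩, fun γ => ?_⟩
  obtain ⟨h1, -, h3⟩ := (isP_iff _ _ _).1 (hZ (Psi γ))
  obtain ⟨ht, hd⟩ := flow_of_firstColumn h1 h3 (hX γ)
  refine ⟨ht, fun F hF => ?_⟩
  rw [pullback, bracket2_eq (hH _) (hZ _)]
  exact hd F hF

theorem mulVec_first (M : Matrix (Fin n) (Fin n) R) :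
    (M.mulVec fun k => if (k : ℕ) = 0 then 1 else 0) = fun i => M i 0 := by
  funext i
  rw [Matrix.mulVec, dotProduct, Finset.sum_eq_single 0]
  · rw [if_pos (Fin.val_zero n), mul_one]
  · intro k _ hk
    rw [if_neg fun h => hk (Fin.ext (h.trans (Fin.val_zero n).symm)), mul_zero]
  · intro h; exact absurd (Finset.mem_univ _) h

theorem curveFlow_eq (j : ℕ) (γ : Curves n) :
    curveFlow n j γ = (gframe dxD γ.1).mulVec fun i => Z0 j (Psi γ) i 0 := by
  rw [curveFlow, ← Matrix.mulVec_mulVec]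
  exact congrArg (gframe dxD γ.1).mulVec (mulVec_first _)

theorem isHamiltonianFlow_curveFlow_two (hn : 2 ≤ n) {j : ℕ} (hj : ¬ n ∣ j) :
    IsHamiltonianFlow bracket2 (Hfun n j) (curveFlow n j) :=
  isHamiltonianFlow_bracket2 _ (Z0 j) (hasGrad_Hfun hn j) (isP_Z0 hn hj) (curveFlow_eq j)

/-- Integration by parts moves `∂ + b + u` onto `C`. The result lies in `V_n`, and the product of a
strictly upper triangular matrix with an element of `V_n` has trace zero. -/
theorem pairing_covDer_strictUpper {u : VLoop n} {ζ C : MLoop n} (hζ : IsStrictUpper ζ)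
    (hC : IsVMat (covDer dxD (lowerShift Loop n + u.1) C)) :
    pairing (covDer dxD (lowerShift Loop n + u.1) ζ) C = 0 := by
  have h := trace_covDer_mul dxD (lowerShift Loop n + u.1) ζ C
  rw [trace_strictUpper_mul hζ hC, add_zero] at h
  rw [pairing, h, oint_dxD]

/-- The gradient of `-H_{n+j}` gives `-Z_{n+j,0}`, whose commutator with `e_{1n}` does not see
`ζ_{n+j}` and equals `[∂ + b + u, Y_{j,0}]`. Splitting `Y_{j,0} = Z_{j,0} + ζ_j`, the second part
pairs to zero with `P_u (∇F)`. -/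
theorem bracket1_Hfun (hn : 2 ≤ n) {j : ℕ} (hj : ¬ n ∣ j) (u : VLoop n) (F : VLoop n → ℝ) :
    bracket1 (fun u => -Hfun n (n + j) u) F u =
      pairing (grad F u).1 (covDer dxD (lowerShift Loop n + u.1) (Z0 j u)) := by
  have hj' : ¬ n ∣ n + j := fun h => hj ((Nat.dvd_add_right dvd_rfl).1 h)
  rw [bracket1, (hasGrad_Hfun hn (n + j) u).neg.grad_eq, ← (isP_Z0 hn hj' u).neg.eq_Pop]
  have h1 : e1n n * -Z0 (n + j) u - -Z0 (n + j) u * e1n n =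
      covDer dxD (lowerShift Loop n + u.1) (Y0 j u) :=
    (corner_comm_sub (isZeta_zeta hn hj' u).1).trans
      (neg_eq_of_add_eq_zero_left (covD_Y0 hn j u))
  have h2 : covDer dxD (lowerShift Loop n + u.1) (Y0 j u) =
      covDer dxD (lowerShift Loop n + u.1) (Z0 j u) +
        covDer dxD (lowerShift Loop n + u.1) (zeta j u) := by
    rw [Z0, covDer_sub, sub_add_cancel]
  rw [h1, h2, pairing_add_left, pairing_covDer_strictUpper (isZeta_zeta hn hj u).1
    ((isP_iff _ _ _).1 (isP_Pop u _)).2.2, add_zero]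
  exact pairing_isVMat_Pop ((isP_iff _ _ _).1 (isP_Z0 hn hj u)).2.2 _

theorem isHamiltonianFlow_curveFlow_one (hn : 2 ≤ n) {j : ℕ} (hj : ¬ n ∣ j) :
    IsHamiltonianFlow bracket1 (fun u => -Hfun n (n + j) u) (curveFlow n j) := by
  refine ⟨fun u => ⟨_, (hasGrad_Hfun hn (n + j) u).neg⟩, fun γ => ?_⟩
  obtain ⟨h1, -, h3⟩ := (isP_iff _ _ _).1 (isP_Z0 hn hj (Psi γ))
  obtain ⟨ht, hd⟩ := flow_of_firstColumn h1 h3 (curveFlow_eq j γ)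
  refine ⟨ht, fun F hF => ?_⟩
  rw [pullback, bracket1_Hfun hn hj]
  exact hd F hF

end Brackets

/-! ### The second and the third flow -/

section LastColumn

variable {R : Type*} [CommRing R] [Algebra ℝ R] {n : ℕ} [NeZero n]

/-- The entry `u_k` of the last column, `u_k = 0` outside `1 ≤ k ≤ n`. -/
def colEntry (u : Matrix (Fin n) (Fin n) R) (k : ℤ) : R :=
  ∑ i : Fin n, if (i : ℤ) + 1 = k then u i (lastIdx n) else 0

theorem sum_ite_mul_col (u : Matrix (Fin n) (Fin n) R) (k : ℤ) (r : R) :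
    ∑ i : Fin n, (if (i : ℤ) + 1 = k then r else 0) * u i (lastIdx n) = r * colEntry u k := by
  rw [colEntry, Finset.mul_sum]
  refine Finset.sum_congr rfl fun i _ => ?_
  split_ifs
  · rfl
  · rw [zero_mul, mul_zero]

theorem colEntry_fin (u : Matrix (Fin n) (Fin n) R) (i : Fin n) :
    colEntry u (i + 1) = u i (lastIdx n) := by
  rw [colEntry, Finset.sum_eq_single i]
  · rw [if_pos rfl]
  · intro l _ hl
    exact if_neg fun h => hl (Fin.ext (by omega))
  · intro h; exact absurd (Finset.mem_univ _) h

theorem colEntry_of_nonpos (u : Matrix (Fin n) (Fin n) R) {k : ℤ} (hk : k ≤ 0) :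
    colEntry u k = 0 :=
  Finset.sum_eq_zero fun _ _ => if_neg (by omega)

theorem colEntry_top {u : Matrix (Fin n) (Fin n) R} (hu : IsVMat u) : colEntry u n = 0 := by
  have hl := lastIdx_val (n := n)
  have := colEntry_fin u (lastIdx n)
  rw [hu _ _ fun h => by omega] at this
  rw [← this]
  congr 1
  omega

/-- The coordinate vector with entry `r` at the position `k`. -/
def posVec (n : ℕ) (k : ℕ) (r : R) : Fin n → R := fun i => if (i : ℕ) = k then r else 0

variable {D : Derivation ℝ R R} {u : Matrix (Fin n) (Fin n) R}

theorem colOp_posVec_one (hu : IsVMat u) {k : ℕ} (hk : k + 1 < n) :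
    colOp D (lowerShift R n + u) (posVec n k 1) = posVec n (k + 1) 1 := by
  have hl := lastIdx_val (n := n)
  funext i
  rw [colOp_apply hu, show posVec n k (1 : R) (lastIdx n) = 0 from if_neg (by omega), mul_zero,
    add_zero]
  have h1 : D (posVec n k (1 : R) i) = 0 := by
    rw [posVec]
    split_ifs <;> simp
  rw [h1, zero_add]
  by_cases hi : (i : ℕ) = k + 1
  · rw [if_pos (by omega)]
    simp only [posVec]
    rw [if_pos (by omega), if_pos hi]
  · simp only [posVec]
    rw [if_neg hi]
    split_ifs <;> first | rfl | omega

theorem iterate_colOp_of_lt (hu : IsVMat u) {k : ℕ} (hk : k < n) :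
    (colOp D (lowerShift R n + u))^[k] (posVec n 0 1) = posVec n k 1 := by
  induction k with
  | zero => rfl
  | succ k ih => rw [Function.iterate_succ_apply', ih (by omega), colOp_posVec_one hu hk]

theorem colEntry_pred (i : Fin n) :
    (if 0 < (i : ℕ) then colEntry u (((⟨i - 1, by omega⟩ : Fin n) : ℕ) + 1) else 0) =
      colEntry u i := by
  split_ifs with h
  · congr 1
    simp only
    omega
  · rw [colEntry_of_nonpos]
    omega

theorem iterate_colOp_n (hu : IsVMat u) (i : Fin n) :
    (colOp D (lowerShift R n + u))^[n] (posVec n 0 1) i = colEntry u (i + 1) := by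
  have hl := lastIdx_val (n := n)
  have e : (colOp D (lowerShift R n + u))^[(lastIdx n : ℕ) + 1] (posVec n 0 1) =
      colOp D (lowerShift R n + u) (posVec n (lastIdx n) 1) := by
    rw [Function.iterate_succ_apply', iterate_colOp_of_lt hu (lastIdx n).2]
  rw [hl] at e
  rw [e, colOp_apply hu, colEntry_fin]
  have h1 : D (posVec n (lastIdx n) (1 : R) i) = 0 := by
    rw [posVec]
    split_ifs <;> simp
  rw [h1, zero_add, show posVec n (lastIdx n) (1 : R) (lastIdx n) = 1 from if_pos rfl, mul_one,
    add_eq_right]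
  have := i.2
  simp only [posVec]
  split_ifs <;> first | rfl | omega

theorem iterate_colOp_n_last (hu : IsVMat u) :
    (colOp D (lowerShift R n + u))^[n] (posVec n 0 1) (lastIdx n) = 0 := by
  have hl := lastIdx_val (n := n)
  rw [iterate_colOp_n hu, ← colEntry_top hu]
  congr 1
  omega

theorem iterate_colOp_n_succ (hu : IsVMat u) (i : Fin n) :
    (colOp D (lowerShift R n + u))^[n + 1] (posVec n 0 1) i =
      D (colEntry u (i + 1)) + colEntry u i := by
  rw [Function.iterate_succ_apply', colOp_apply hu, iterate_colOp_n_last hu, mul_zero, add_zero]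
  simp only [iterate_colOp_n hu]
  rw [colEntry_pred]

theorem iterate_colOp_n_succ_last (hu : IsVMat u) :
    (colOp D (lowerShift R n + u))^[n + 1] (posVec n 0 1) (lastIdx n) = colEntry u (n - 1) := by
  have hl := lastIdx_val (n := n)
  rw [iterate_colOp_n_succ hu, show ((lastIdx n : ℕ) : ℤ) + 1 = n by omega, colEntry_top hu,
    map_zero, zero_add]
  congr 1
  omega

theorem iterate_colOp_n_add_two_last (hu : IsVMat u) (hn : 2 ≤ n) :
    (colOp D (lowerShift R n + u))^[n + 2] (posVec n 0 1) (lastIdx n) =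
      (2 : ℝ) • D (colEntry u (n - 1)) + colEntry u (n - 2) := by
  have hl := lastIdx_val (n := n)
  rw [Function.iterate_succ_apply', colOp_apply hu, iterate_colOp_n_succ_last hu,
    hu _ _ fun h => by omega, zero_mul, add_zero, if_pos (by omega), iterate_colOp_n_succ hu]
  have e1 : (((⟨lastIdx n - 1, by omega⟩ : Fin n) : ℕ) : ℤ) = n - 2 := by simp only; omega
  rw [e1, show (n : ℤ) - 2 + 1 = n - 1 by ring]
  module

/-- The diagonal of the matrix generated by `r e_2`. -/
theorem iterate_colOp_diag (hu : IsVMat u) (hn : 2 ≤ n) (r : R) (k : ℕ) (i : Fin n)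
    (hi : (i : ℕ) = k) :
    (colOp D (lowerShift R n + u))^[k] (posVec n 1 r) i = (k : ℝ) • D r := by
  have hl := lastIdx_val (n := n)
  have hlead := fun k => iterate_colOp_lead (D := D) hu (c := posVec n 1 r) (m := ⟨1, hn⟩)
    (fun i hi => if_neg (by rw [Fin.lt_def] at hi; simp only at hi; omega)) k
  induction k generalizing i with
  | zero =>
    rw [Nat.cast_zero, zero_smul]
    exact if_neg (by omega)
  | succ k ih =>
    have h0 : posVec n 1 r ⟨1, hn⟩ = r := if_pos rfl
    -- The entry in row `k + 1` after `k + 1` steps is the derivative of the leading entry `r`,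
    -- which is there after `k` steps, plus the previous diagonal entry shifted down by `b`.
    rw [Function.iterate_succ_apply', colOp_apply hu, if_pos (by omega),
      ih ⟨i - 1, by omega⟩ (by simp only; omega), (hlead k).2 i (by simp only; omega), h0]
    -- Either the vector has not yet reached the last row, or row `i` is the last row, where the
    -- potential vanishes.
    have h1 : u i (lastIdx n) * (colOp D (lowerShift R n + u))^[k] (posVec n 1 r) (lastIdx n) = 0 := by
      have := i.2
      by_cases hk : k + 2 = n
      · rw [hu _ _ fun h => by omega, zero_mul]
      · rw [(hlead k).1 (lastIdx n) (by simp only; omega), mul_zero]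
    rw [h1, Nat.cast_succ]
    module

theorem krylov_iterate (B : Matrix (Fin n) (Fin n) R) (c : Fin n → R) (m : ℕ) (i j : Fin n) :
    krylov D B ((colOp D B)^[m] c) i j = (colOp D B)^[j + m] c i := by
  rw [krylov, Function.iterate_add_apply]

theorem krylov_posVec_zero_diag (hu : IsVMat u) (a : R) :
    (krylov D (lowerShift R n + u) (posVec n 0 a)).trace = (n : ℝ) • a := by
  have hlead := fun k => iterate_colOp_lead (D := D) hu (c := posVec n 0 a) (m := 0)
    (fun i hi => if_neg (by rw [Fin.lt_def] at hi; simp only [Fin.val_zero] at hi; omega)) k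
  have h : ∀ i ∈ Finset.univ, (krylov D (lowerShift R n + u) (posVec n 0 a)).diag i = a :=
    fun i _ => ((hlead i).2 i (by simp)).trans (if_pos (Fin.val_zero n))
  rw [Matrix.trace, Finset.sum_congr rfl h]
  simp [Nat.cast_smul_eq_nsmul]

theorem krylov_posVec_zero_last (hu : IsVMat u) (a : R) {j : Fin n} (hj : (j : ℕ) + 1 < n) :
    krylov D (lowerShift R n + u) (posVec n 0 a) (lastIdx n) j = 0 := by
  have hl := lastIdx_val (n := n)
  exact (iterate_colOp_lead (D := D) hu (c := posVec n 0 a) (m := 0)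
    (fun i hi => if_neg (by rw [Fin.lt_def] at hi; simp only [Fin.val_zero] at hi; omega)) j).1 _
    (by simp only [Fin.val_zero]; omega)

theorem krylov_posVec_one_last (hu : IsVMat u) (hn : 2 ≤ n) (r : R) {j : Fin n}
    (hj : (j : ℕ) + 1 < n) : krylov D (lowerShift R n + u) (posVec n 1 r) (lastIdx n) j =
      if (j : ℤ) + 1 = n - 1 then r else 0 := by
  have hl := lastIdx_val (n := n)
  have hlead := iterate_colOp_lead (D := D) hu (c := posVec n 1 r) (m := ⟨1, hn⟩)
    (fun i hi => if_neg (by rw [Fin.lt_def] at hi; simp only at hi; omega)) j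
  split_ifs with h
  · exact (hlead.2 _ (by simp only; omega)).trans (if_pos rfl)
  · exact hlead.1 _ (by simp only; omega)

theorem trace_krylov_posVec_one (hu : IsVMat u) (hn : 2 ≤ n) (r : R) :
    (krylov D (lowerShift R n + u) (posVec n 1 r)).trace = ((n : ℝ) * (n - 1) / 2) • D r := by
  have h : ∀ i ∈ Finset.univ, (krylov D (lowerShift R n + u) (posVec n 1 r)).diag i =
      ((i : ℕ) : ℝ) • D r := fun i _ => iterate_colOp_diag hu hn r i i rfl
  rw [Matrix.trace, Finset.sum_congr rfl h, ← Finset.sum_smul,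
    Fin.sum_univ_eq_sum_range (fun k => (k : ℝ)) n, ← Nat.cast_sum]
  congr 1
  have h2 := congrArg (Nat.cast : ℕ → ℝ) (Finset.sum_range_id_mul_two n)
  rw [Nat.cast_mul, Nat.cast_mul, Nat.cast_sub (by omega)] at h2
  push_cast at h2 ⊢
  linarith

/-- Column `j` is `(∂ + b + u) ^ (j + 2) e_1`, a coordinate vector two places below the diagonal as
long as `j + 2 < n`. Only the last two columns contribute to the trace, each with `u_{n-1}`. -/
theorem trace_krylov_two (hu : IsVMat u) (hn : 2 ≤ n) :
    (krylov D (lowerShift R n + u) ((colOp D (lowerShift R n + u))^[2] (posVec n 0 1))).trace =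
      (2 : ℝ) • colEntry u (n - 1) := by
  have hl := lastIdx_val (n := n)
  have hne : (⟨n - 2, by omega⟩ : Fin n) ≠ lastIdx n := fun h => by
    have := congrArg Fin.val h
    simp only at this
    omega
  rw [Matrix.trace, Fintype.sum_eq_add _ _ hne]
  · simp only [Matrix.diag_apply, krylov_iterate]
    rw [show n - 2 + 2 = n by omega, show (lastIdx n : ℕ) + 2 = n + 1 by omega,
      iterate_colOp_n_succ_last hu, iterate_colOp_n hu]
    have e : (((⟨n - 2, by omega⟩ : Fin n) : ℕ) : ℤ) + 1 = n - 1 := by simp only; omega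
    rw [e]
    module
  · intro j ⟨h1, h2⟩
    have hj1 : (j : ℕ) + 2 < n := by
      by_contra h
      have := j.2
      have : (j : ℕ) ≠ n - 2 := fun h' => h1 (Fin.ext h')
      exact h2 (eq_lastIdx (by omega))
    rw [Matrix.diag_apply, krylov_iterate, iterate_colOp_of_lt hu hj1]
    exact if_neg (by omega)

theorem krylov_two_last (hu : IsVMat u) {j : Fin n} (hj : (j : ℕ) + 1 < n) :
    krylov D (lowerShift R n + u) ((colOp D (lowerShift R n + u))^[2] (posVec n 0 1))
      (lastIdx n) j = if (j : ℤ) + 1 = n - 2 then 1 else 0 := by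
  have hl := lastIdx_val (n := n)
  rw [krylov_iterate]
  rcases Nat.lt_or_eq_of_le (show (j : ℕ) + 2 ≤ n by omega) with h | h
  · rw [iterate_colOp_of_lt hu h, posVec]
    split_ifs <;> first | rfl | omega
  · rw [h, iterate_colOp_n_last hu, if_neg (by omega)]

/-- Only the last three diagonal entries can be nonzero: `u_{n-2}`, then `(u_{n-1})_x + u_{n-2}`,
then `2 (u_{n-1})_x + u_{n-2}`. For `n = 2` the first of them is absent, in accordance with `u_0 =
0`. -/
theorem trace_krylov_three (hu : IsVMat u) (hn : 2 ≤ n) :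
    (krylov D (lowerShift R n + u) ((colOp D (lowerShift R n + u))^[3] (posVec n 0 1))).trace =
      (3 : ℝ) • colEntry u (n - 2) + (3 : ℝ) • D (colEntry u (n - 1)) := by
  have hl := lastIdx_val (n := n)
  set v := posVec n 0 (1 : R) with hv
  set A := colOp D (lowerShift R n + u) with hA
  have hlow : ∀ j : Fin n, (j : ℕ) + 3 < n → A^[j + 3] v j = 0 := fun j hj => by
    rw [iterate_colOp_of_lt hu hj]
    exact if_neg (by omega)
  have hpred : ∀ i : Fin n, (i : ℕ) + 2 = n →
      A^[i + 3] v i = D (colEntry u (n - 1)) + colEntry u (n - 2) := fun i hi => by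
    rw [show (i : ℕ) + 3 = n + 1 by omega, iterate_colOp_n_succ hu]
    congr 3 <;> omega
  have hlast : A^[(lastIdx n : ℕ) + 3] v (lastIdx n) =
      (2 : ℝ) • D (colEntry u (n - 1)) + colEntry u (n - 2) := by
    rw [show (lastIdx n : ℕ) + 3 = n + 2 by omega, iterate_colOp_n_add_two_last hu hn]
  have htwo : ∀ i : Fin n, (i : ℕ) + 3 = n → A^[i + 3] v i = colEntry u (n - 2) := fun i hi => by
    rw [hi, iterate_colOp_n hu]
    congr 1
    omega
  have hsum : ∀ i : Fin n, A^[i + 3] v i =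
      ((if (i : ℤ) + 1 = n - 2 then colEntry u (n - 2) else 0) +
        if (i : ℕ) = n - 2 then D (colEntry u (n - 1)) + colEntry u (n - 2) else 0) +
      if i = lastIdx n then (2 : ℝ) • D (colEntry u (n - 1)) + colEntry u (n - 2) else 0 := by
    intro i
    have := i.2
    by_cases h1 : i = lastIdx n
    · rw [if_pos h1, if_neg (by rw [h1]; omega), if_neg (by rw [h1]; omega), h1, hlast, add_zero,
        zero_add]
    · have h1' : (i : ℕ) + 1 ≠ n := fun h => h1 (eq_lastIdx h)
      rw [if_neg h1, add_zero]
      by_cases h2 : (i : ℕ) + 2 = n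
      · rw [if_neg (by omega), if_pos (by omega), zero_add, hpred i h2]
      · rw [if_neg (c := (i : ℕ) = n - 2) (by omega), add_zero]
        split_ifs with h3
        · exact htwo i (by omega)
        · exact hlow i (by omega)
  have hthree : ∑ i : Fin n, (if (i : ℤ) + 1 = n - 2 then colEntry u (n - 2) else 0) =
      colEntry u (n - 2) := by
    by_cases h : 3 ≤ n
    · rw [Finset.sum_eq_single ⟨n - 3, by omega⟩]
      · exact if_pos (by simp only; omega)
      · intro l _ hl
        exact if_neg fun h => hl (Fin.ext (by simp only; omega))
      · intro h; exact absurd (Finset.mem_univ _) h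
    · rw [colEntry_of_nonpos u (by omega)]
      simp
  have htwo' : ∑ i : Fin n, (if (i : ℕ) = n - 2 then
      D (colEntry u (n - 1)) + colEntry u (n - 2) else 0) =
      D (colEntry u (n - 1)) + colEntry u (n - 2) := by
    rw [Finset.sum_eq_single ⟨n - 2, by omega⟩]
    · exact if_pos rfl
    · intro l _ hl
      exact if_neg fun h => hl (Fin.ext h)
    · intro h; exact absurd (Finset.mem_univ _) h
  have hdiag : ∀ i ∈ Finset.univ, (krylov D (lowerShift R n + u) (A^[3] v)).diag i = _ :=
    fun i _ => (krylov_iterate _ v 3 i i).trans (hsum i)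
  rw [Matrix.trace, Finset.sum_congr rfl hdiag, Finset.sum_add_distrib, Finset.sum_add_distrib,
    hthree, htwo', Finset.sum_ite_eq', if_pos (Finset.mem_univ _)]
  module

theorem krylov_three_last (hu : IsVMat u) {j : Fin n} (hj : (j : ℕ) + 1 < n) :
    krylov D (lowerShift R n + u) ((colOp D (lowerShift R n + u))^[3] (posVec n 0 1))
      (lastIdx n) j = (if (j : ℤ) + 1 = n - 3 then 1 else 0) +
        if (j : ℤ) + 1 = n - 1 then colEntry u (n - 1) else 0 := by
  have hl := lastIdx_val (n := n)
  rw [krylov_iterate]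
  rcases Nat.lt_trichotomy ((j : ℕ) + 3) n with h | h | h
  · rw [iterate_colOp_of_lt hu h, posVec, if_neg (c := (j : ℤ) + 1 = n - 1) (by omega), add_zero]
    split_ifs <;> first | rfl | omega
  · rw [h, iterate_colOp_n_last hu, if_neg (by omega), if_neg (by omega), add_zero]
  · rw [show (j : ℕ) + 3 = n + 1 by omega, iterate_colOp_n_succ_last hu, if_neg (by omega),
      if_pos (by omega), zero_add]

theorem gframe_mulVec_posVec (γ : Fin n → R) {k : ℕ} (hk : k < n) (r : R) (i : Fin n) :
    (gframe D γ).mulVec (posVec n k r) i = D^[k] (γ i) * r := by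
  rw [Matrix.mulVec, dotProduct, Finset.sum_eq_single ⟨k, hk⟩]
  · rw [posVec, if_pos rfl]; rfl
  · intro l _ hl
    rw [posVec, if_neg fun h => hl (Fin.ext h), mul_zero]
  · intro h; exact absurd (Finset.mem_univ _) h

theorem gframe_mulVec_iterate {γ : Fin n → R} (h : (gframe D γ).det = 1) (k : ℕ) (i : Fin n) :
    (gframe D γ).mulVec ((colOp D (lowerShift R n + curv D γ))^[k] (posVec n 0 1)) i =
      D^[k] (γ i) := by
  rw [← iterate_gframe_mulVec h, gframe_mulVec_posVec γ (Nat.pos_of_neZero n), mul_one]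
  rfl

end LastColumn

/-! ### Gradients of the explicit Hamiltonians and their flows -/

section ExplicitFlows

variable {n : ℕ} [NeZero n]

theorem comp_eq_colEntry (u : VLoop n) (k : ℤ) : comp u k = colEntry u.1 k := by
  refine Finset.sum_congr rfl fun i _ => ?_
  rw [Finset.sum_eq_single (lastIdx n)]
  · simp only [lastIdx_val, and_true]
  · intro j _ hj
    exact if_neg fun h => hj (eq_lastIdx h.2)
  · intro h; exact absurd (Finset.mem_univ _) h

/-- The element of `C^∞(S¹, V_n^t)` with the last row `r_1, …, r_{n-1}`. -/
def rowVec (n : ℕ) (r : ℤ → Loop) : VtLoop n :=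
  ⟨fun i j => if (i : ℕ) + 1 = n ∧ (j : ℕ) + 1 < n then r (j + 1) else 0, fun _ _ h => if_neg h⟩

theorem rowVec_last (r : ℤ → Loop) {j : Fin n} (hj : (j : ℕ) + 1 < n) :
    (rowVec n r).1 (lastIdx n) j = r (j + 1) := if_pos ⟨lastIdx_val, hj⟩

theorem trace_rowVec_mul (r : ℤ → Loop) (v : VLoop n) :
    ((rowVec n r).1 * v.1).trace = ∑ k : Fin n, r (k + 1) * v.1 k (lastIdx n) := by
  have hl := lastIdx_val (n := n)
  rw [Matrix.trace_mul_comm, Matrix.trace]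
  refine Finset.sum_congr rfl fun k _ => ?_
  rw [Matrix.diag_apply, Matrix.mul_apply, Finset.sum_eq_single (lastIdx n)]
  · by_cases hk : (k : ℕ) + 1 < n
    · rw [rowVec_last r hk, mul_comm]
    · rw [v.2 _ _ fun h => hk h.1, zero_mul, mul_zero]
  · intro j _ hj
    rw [v.2 _ _ fun h => hj (eq_lastIdx h.2), zero_mul]
  · intro h; exact absurd (Finset.mem_univ _) h

theorem restr_colEntry_famMat {U : ℝ → VLoop n} (hU : ∀ i j, SmoothFamily fun s => (U s).1 i j)
    (s : ℝ) (k : ℤ) : restr s (colEntry (famMat hU) k) = comp (U s) k := by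
  rw [comp_eq_colEntry, colEntry, colEntry, map_sum]
  refine Finset.sum_congr rfl fun i _ => ?_
  split_ifs
  · rfl
  · exact map_zero _

theorem restr_famDs_colEntry_famMat {U : ℝ → VLoop n}
    (hU : ∀ i j, SmoothFamily fun s => (U s).1 i j) {v : VLoop n}
    (hv : ∀ i j, HasVelocity (fun s => (U s).1 i j) (v.1 i j)) (k : ℤ) :
    restr 0 (famDs (colEntry (famMat hU) k)) = comp v k := by
  rw [comp_eq_colEntry, colEntry, colEntry, map_sum, map_sum]
  refine Finset.sum_congr rfl fun i _ => ?_
  split_ifs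
  · exact restr_famDs_of_velocity (hv i (lastIdx n))
  · rw [map_zero, map_zero]

/-- The gradient of `∮ u_{n-2} dx`. -/
def gradTwo (n : ℕ) : VtLoop n := rowVec n fun k => if k = n - 2 then 1 else 0

theorem hasGrad_ham2 (u : VLoop n) : HasGrad (ham2 n) u (gradTwo n) := by
  intro U v hU h0 hv
  have hH : (fun s => ham2 n (U s)) = fun s => oint (restr s (colEntry (famMat hU) (n - 2))) :=
    funext fun s => by rw [restr_colEntry_famMat]; rfl
  have hp : pairing (gradTwo n).1 v.1 =
      oint (restr 0 (famDs (colEntry (famMat hU) (n - 2)))) := by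
    rw [restr_famDs_colEntry_famMat hU hv, pairing, gradTwo, trace_rowVec_mul, sum_ite_mul_col,
      one_mul, comp_eq_colEntry]
  rw [hH, hp]
  exact hasDerivAt_oint _ 0

/-- The gradient of `∮ (u_{n-3} + ((n-3)/(2n)) u_{n-1}²) dx`. -/
def gradThree (u : VLoop n) : VtLoop n := rowVec n fun k =>
  (if k = n - 3 then 1 else 0) + if k = n - 1 then ((n - 3) / n : ℝ) • comp u (n - 1) else 0

theorem hasGrad_ham3 (u : VLoop n) : HasGrad (ham3 n) u (gradThree u) := by
  intro U v hU h0 hv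
  set q : ℝ := (n - 3) / (2 * n) with hq
  set w := colEntry (famMat hU) (n - 1) with hw
  have hH : (fun s => ham3 n (U s)) =
      fun s => oint (restr s (colEntry (famMat hU) (n - 3) + q • w ^ 2)) :=
    funext fun s => by
      have e : restr s (q • w ^ 2) = q • restr s w ^ 2 := rfl
      rw [map_add, e, hw, restr_colEntry_famMat, restr_colEntry_famMat]
      rfl
  have hw2 : restr 0 (famDs (q • w ^ 2)) = (2 * q) • (comp u (n - 1) * comp v (n - 1)) := by
    have e : restr 0 (q • famDs (w ^ 2)) = q • restr 0 (famDs (w ^ 2)) := rfl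
    rw [Derivation.map_smul, e, pow_two, Derivation.leibniz, map_add, smul_eq_mul, map_mul, hw,
      restr_famDs_colEntry_famMat hU hv, restr_colEntry_famMat, h0]
    module
  have hp : pairing (gradThree u).1 v.1 =
      oint (restr 0 (famDs (colEntry (famMat hU) (n - 3) + q • w ^ 2))) := by
    have hq2 : ((n : ℝ) - 3) / n = 2 * q := by
      have hn : (n : ℝ) ≠ 0 := Nat.cast_ne_zero.2 (NeZero.ne n)
      rw [hq]
      field_simp
    rw [map_add, map_add, hw2, restr_famDs_colEntry_famMat hU hv, pairing, gradThree,
      trace_rowVec_mul]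
    simp only [add_mul, Finset.sum_add_distrib]
    rw [sum_ite_mul_col, sum_ite_mul_col, one_mul, hq2, comp_eq_colEntry v, comp_eq_colEntry v,
      smul_mul_assoc]
  rw [hH, hp]
  exact hasDerivAt_oint _ 0

/-- The generating first column of the second flow. -/
def colTwo (u : VLoop n) : Fin n → Loop :=
  posVec n 0 ((-(2 / n : ℝ)) • comp u (n - 1)) +
    (colOp dxD (lowerShift Loop n + u.1))^[2] (posVec n 0 1)

theorem isP_krylov {u : VLoop n} {v : VtLoop n} {c : Fin n → Loop}
    (ht : (krylov dxD (lowerShift Loop n + u.1) c).trace = 0)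
    (hl : ∀ j : Fin n, (j : ℕ) + 1 < n →
      krylov dxD (lowerShift Loop n + u.1) c (lastIdx n) j = v.1 (lastIdx n) j) :
    IsP u v (krylov dxD (lowerShift Loop n + u.1) c) :=
  (isP_iff _ _ _).2 ⟨ht, hl, isVMat_covDer_krylov (isVMat_coe u) c ht⟩

/-- The trace `2 u_{n-1}` generated by `γ_xx` is cancelled by `n` times the coefficient of `γ`,
which explains `-2/n`. The term in `γ` does not reach the prescribed part of the last row, so the
gradient comes from `γ_xx` alone. -/
theorem isP_colTwo (hn : 2 ≤ n) (u : VLoop n) :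
    IsP u (gradTwo n) (krylov dxD (lowerShift Loop n + u.1) (colTwo u)) := by
  have hu := isVMat_coe u
  have hn0 : (n : ℝ) ≠ 0 := Nat.cast_ne_zero.2 (NeZero.ne n)
  refine isP_krylov ?_ fun j hj => ?_
  · rw [colTwo, krylov_add, Matrix.trace_add, krylov_posVec_zero_diag hu, trace_krylov_two hu hn,
      comp_eq_colEntry, smul_smul, ← add_smul]
    convert zero_smul ℝ _
    field_simp
    ring
  · rw [colTwo, krylov_add, Matrix.add_apply, krylov_posVec_zero_last hu _ hj, krylov_two_last hu hj,
      zero_add, gradTwo, rowVec_last _ hj]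

theorem isHamiltonianFlow_flowTwo (hn : 2 ≤ n) :
    IsHamiltonianFlow bracket2 (ham2 n) (flowTwo n) := by
  refine isHamiltonianFlow_bracket2 _ _ hasGrad_ham2 (isP_colTwo hn) fun γ => ?_
  have hγ : (gframe dxD γ.1).det = 1 := γ.2
  funext i
  have h := gframe_mulVec_iterate hγ 2 i
  change _ = (gframe dxD γ.1).mulVec (colTwo (Psi γ)) i
  rw [colTwo, Matrix.mulVec_add, Pi.add_apply, gframe_mulVec_posVec _ (Nat.pos_of_neZero n)]
  refine congrArg₂ (· + ·) ?_ h.symm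
  have e : ∀ (q : ℝ) (a b : Loop), q • (a * b) = b * q • a := fun q a b => by
    rw [mul_smul_comm, mul_comm]
  exact e _ _ _

/-- The generating first column of the third flow. -/
def colThree (u : VLoop n) : Fin n → Loop :=
  posVec n 0 ((-(3 / n : ℝ)) • comp u (n - 2) +
      (3 * (n - 3) / (2 * n) : ℝ) • dxD (comp u (n - 1))) +
    posVec n 1 ((-(3 / n : ℝ)) • comp u (n - 1)) +
    (colOp dxD (lowerShift Loop n + u.1))^[3] (posVec n 0 1)

/-- In the last row, `γ_xxx` contributes `1` at `u_{n-3}` and `u_{n-1}` at `u_{n-1}`; the term in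
`γ_x` turns the latter into `(1 - 3/n) u_{n-1}`, the gradient of `((n-3)/(2n)) u_{n-1}²`. In the
trace, the coefficients of `(u_{n-1})_x` are `3(n-3)/2`, `-3(n-1)/2` and `3`, with sum zero. -/
theorem isP_colThree (hn : 2 ≤ n) (u : VLoop n) :
    IsP u (gradThree u) (krylov dxD (lowerShift Loop n + u.1) (colThree u)) := by
  have hu := isVMat_coe u
  have hn0 : (n : ℝ) ≠ 0 := Nat.cast_ne_zero.2 (NeZero.ne n)
  refine isP_krylov ?_ fun j hj => ?_
  · rw [colThree, krylov_add, krylov_add, Matrix.trace_add, Matrix.trace_add,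
      krylov_posVec_zero_diag hu, trace_krylov_posVec_one hu hn, trace_krylov_three hu hn,
      comp_eq_colEntry, comp_eq_colEntry, Derivation.map_smul]
    match_scalars <;> field_simp <;> ring
  · rw [colThree, krylov_add, krylov_add, Matrix.add_apply, Matrix.add_apply,
      krylov_posVec_zero_last hu _ hj, krylov_posVec_one_last hu hn _ hj, krylov_three_last hu hj,
      zero_add, gradThree, rowVec_last _ hj, comp_eq_colEntry]
    split_ifs
    · omega
    · match_scalars
      field_simp
      ring
    · simp
    · simp

theorem isHamiltonianFlow_flowThree (hn : 2 ≤ n) :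
    IsHamiltonianFlow bracket2 (ham3 n) (flowThree n) := by
  refine isHamiltonianFlow_bracket2 _ _ hasGrad_ham3 (isP_colThree hn) fun γ => ?_
  have hγ : (gframe dxD γ.1).det = 1 := γ.2
  funext i
  have h := gframe_mulVec_iterate hγ 3 i
  change _ = (gframe dxD γ.1).mulVec (colThree (Psi γ)) i
  rw [colThree, Matrix.mulVec_add, Matrix.mulVec_add, Pi.add_apply, Pi.add_apply,
    gframe_mulVec_posVec _ (Nat.pos_of_neZero n), gframe_mulVec_posVec _ hn]
  refine congrArg₂ (· + ·) ?_ h.symm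
  have e : ∀ (q : ℝ) (a b c d : Loop), a * b - q • (c * d) = b * a + d * (-q) • c :=
    fun q a b c d => by
      rw [mul_smul_comm, neg_smul, sub_eq_add_neg, mul_comm a, mul_comm c]
  exact e _ _ _ _ _

end ExplicitFlows

end

end CentralAffine

theorem mainTheorem7 (n : ℕ) (hn : 2 ≤ n) :
    (∀ u : CentralAffine.VLoop n,
      (∃! Y, CentralAffine.IsResolvent u Y) ∧
      (∀ j : ℕ, ¬ n ∣ j → ∃! ζ, CentralAffine.IsZeta j u ζ) ∧
      (∀ v, ∃! C, CentralAffine.IsP u v C) ∧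
      (∃! p : CentralAffine.LSer n × (ℕ → CentralAffine.Loop),
        CentralAffine.IsDressing u p.1 p.2)) ∧
    (∀ j : ℕ, ¬ n ∣ j →
      CentralAffine.IsHamiltonianFlow CentralAffine.bracket2 (CentralAffine.Hfun n j)
        (CentralAffine.curveFlow n j) ∧
      CentralAffine.IsHamiltonianFlow CentralAffine.bracket1
        (fun u => - CentralAffine.Hfun n (n + j) u) (CentralAffine.curveFlow n j)) ∧
    (3 ≤ n →
      CentralAffine.IsHamiltonianFlow CentralAffine.bracket2 (CentralAffine.ham2 n)
        (CentralAffine.flowTwo n)) ∧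
    (n ≠ 3 →
      CentralAffine.IsHamiltonianFlow CentralAffine.bracket2 (CentralAffine.ham3 n)
        (CentralAffine.flowThree n)) := by
  have : NeZero n := ⟨by omega⟩
  exact ⟨fun u => ⟨CentralAffine.existsUnique_isResolvent hn u,
      fun _ hj => CentralAffine.existsUnique_isZeta hn hj u, CentralAffine.existsUnique_isP u,
      CentralAffine.existsUnique_isDressing u⟩,
    fun _ hj => ⟨CentralAffine.isHamiltonianFlow_curveFlow_two hn hj,
      CentralAffine.isHamiltonianFlow_curveFlow_one hn hj⟩,
    fun _ => CentralAffine.isHamiltonianFlow_flowTwo hn,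
    fun _ => CentralAffine.isHamiltonianFlow_flowThree hn⟩
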